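/- Let $\lambda$ be an infinite cardinal. Suppose that $\diamondsuit(\lambda^+)$ and $\square^B_{\lambda^+}$ both hold. Then there is a $\lambda^+$-complete $\lambda^{++}$-Souslin tree. Here, for a regular uncountable cardinal $\kappa$: $\diamondsuit(\kappa)$ asserts that there is a sequence $\langle A_\xi\mid\xi<\kappa\rangle$ with $A_\xi\subseteq\xi$ such that for every $A\subseteq\kappa$ the set $\{\xi<\kappa\mid A\cap\xi=A_\xi\}$ is stationary in $\kappa$. For a set $x$ of ordinals, $\mathrm{acc}(x)=\{\alpha\in x\mid \sup(x\cap\alpha)=\alpha>0\}$. $\square^B_\kappa$ asserts that there are a set $\Gamma$ and a sequence $\langle C_\beta\mid\beta\in\Gamma\rangle$ such that (1) $\{\alpha<\kappa^+\mid\mathrm{cf}(\alpha)=\kappa\}\subseteq\Gamma\subseteq\mathrm{acc}(\kappa^+)$; (2) for all $\beta\in\Gamma$, $C_\beta$ is club in $\beta$ and $\mathrm{otp}(C_\beta)\le\kappa$; (3) for all $\beta\in\Gamma$ and $\alpha\in\mathrm{acc}(C_\beta)$, we have $\alpha\in\Gamma$ and $C_\alpha=C_\beta\cap\alpha$. A tree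 is a partially ordered set $(T,<_T)$ such that $x_\downarrow=\{y\in T\mid y<_Tx\}$ is well-ordered by $<_T$ for every $x\in T$. It is $\chi$-complete if for every chain $C\subseteq T$ of size $<\chi$ there is $x\in T$ with $C\subseteq x_\downarrow\cup\{x\}$. A $\kappa$-Souslin tree is a tree of size $\kappa$ having no chains or antichains of size $\kappa$. -/

import Mathlib

open Set Cardinal Order

universe u

/-- The diamond principle at `κ`: there is a sequence `⟨A_ξ | ξ < κ⟩` with `A_ξ ⊆ ξ` that guesses
every subset of `κ` at stationarily many `ξ < κ`. -/
def DiamondPrinciple (κ : Cardinal.{u}) : Prop :=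
  ∃ A : Ordinal.{u} → Set Ordinal.{u},
    (∀ ξ < κ.ord, A ξ ⊆ Iio ξ) ∧
    ∀ B ⊆ Iio κ.ord, IsStationary {ξ : Iio κ.ord | B ∩ Iio ξ.1 = A ξ.1}

/-- The set of accumulation points of `x` that belong to `x`:
`acc x = {α ∈ x | sup (x ∩ α) = α > 0}`. -/
def ordAcc (x : Set Ordinal.{u}) : Set Ordinal.{u} :=
  {α | α ∈ x ∧ IsLUB (x ∩ Iio α) α ∧ 0 < α}

/-- `C` is a closed unbounded subset of the ordinal `β`. -/
def IsClubIn (C : Set Ordinal.{u}) (β : Ordinal.{u}) : Prop :=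
  C ⊆ Iio β ∧ IsClub {α : Iio β | α.1 ∈ C}

/-- `⟨C_β | β ∈ Γ⟩` is a Baumgartner square sequence at `κ`. The values of `C` outside `Γ` are
irrelevant. Order types of sets of ordinals live one universe up, whence the lift. -/
structure IsBaumgartnerSquareSeq (κ : Cardinal.{u}) (Γ : Set Ordinal.{u})
    (C : Ordinal.{u} → Set Ordinal.{u}) : Prop where
  cof_subset : {α : Ordinal.{u} | α < (succ κ).ord ∧ α.cof = κ} ⊆ Γ
  subset_acc : Γ ⊆ ordAcc (Iio (succ κ).ord)
  club : ∀ β ∈ Γ, IsClubIn (C β) β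
  otp_le : ∀ β ∈ Γ,
    Ordinal.type (fun a b : C β => a < b) ≤ Ordinal.lift.{u + 1, u} κ.ord
  coherent : ∀ β ∈ Γ, ∀ α ∈ ordAcc (C β), α ∈ Γ ∧ C α = C β ∩ Iio α

/-- Baumgartner's square principle at `κ`. -/
def BaumgartnerSquare (κ : Cardinal.{u}) : Prop :=
  ∃ (Γ : Set Ordinal.{u}) (C : Ordinal.{u} → Set Ordinal.{u}), IsBaumgartnerSquareSeq κ Γ C

/-- A partially ordered set is a tree if every downward cone `{y | y < x}` is well-ordered. -/
def IsOrderTree (T : Type u) [PartialOrder T] : Prop :=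
  ∀ x : T, IsWellOrder (Iio x) (fun a b => a < b)

/-- `χ`-completeness: every chain of size `< χ` is contained in `{y | y < x} ∪ {x}` for
some `x`. -/
def IsCompleteTree (T : Type u) [PartialOrder T] (χ : Cardinal.{u}) : Prop :=
  ∀ C : Set T, IsChain (· ≤ ·) C → #C < χ → ∃ x : T, C ⊆ Iio x ∪ {x}

/-- A `κ`-Souslin tree (for `κ` regular and uncountable): a tree of size `κ` with no chains and
no antichains of size `κ`. -/
structure IsSouslinTree (T : Type u) [PartialOrder T] (κ : Cardinal.{u}) : Prop where
  isOrderTree : IsOrderTree T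
  card_eq : #T = κ
  no_chain : ∀ C : Set T, IsChain (· ≤ ·) C → #C ≠ κ
  no_antichain : ∀ C : Set T, IsAntichain (· ≤ ·) C → #C ≠ κ

/-! Let `I`, `K` and `V` have sizes λ, λ⁺ and λ⁺⁺. The tree has levels indexed by `V`, and the nodes
of a level are named in `K`. Large antichains are killed by a colouring. A sequence of λ nodes of
one level whose projections to a lower level γ are distinct gets a colour (c, γ) with c in `K`. Its
projections to levels above γ inherit the colour, and two sequences of one level with the same
colour agree at λ indices. Among sequences on λ⁺⁺ levels over one injective sequence, two share a
colour by pigeonhole, so at some index the lower node is below the higher one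
(`Sys.IsRich.isRichTree`). Hence fewer than λ nodes of a level lie on cofinal branches
(`IsRichTree.mk_branch_lt`). In the cone of a node off these branches, an antichain of size λ⁺⁺
would yield λ distinct nodes of one level with arbitrarily high elements of the antichain above each
of them, contradicting the same principle (`IsRichTree.mk_antichain_le`).

The tree is the union of λ⁺ stages of approximations (`Sys`), each of which knows only few
predecessors of a node. The square gives a coherent matrix of sets of size at most λ with λ⁺ rows
(`exists_isMatrix`). The diamond guesses the isomorphism type of the current approximation on such a
set, together with a task: put a new node over a chain, or colour a sequence. The task is carried
out on that small structure (`exists_stage`), and the result is copied to all places that look like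
it (`Sys.Inv.sup_pull`); coherence makes the copies fit. Every task is guessed late enough
(`exists_isRich`). The diamond also gives at most λ⁺ sequences of length λ in `K`
(`IsDiamondSeq.mk_fun_le`), so that tasks can be coded.

The crux is to complete a small structure so that all predecessors within it are known and equally
coloured sequences still meet often (`exists_completion`). At a level whose known levels are bounded
there is freedom in placing the nodes. At most λ pairs of coloured sequences compete, and each pair
receives λ nodes of its own (`exists_routing`). Such a level must however be controlled by a lower
one; this is the anchoring clause of the matrix, which rests on the closure and coherence of the
square (`Fine.anchored`). -/

variable {V K I : Type u}

/-! ### Large index sets, recursion and routing -/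

/-- A set of indices that is as large as the whole index type. -/
def Big {I : Type u} (A : Set I) : Prop := #I ≤ #A

theorem Big.mono {I : Type u} {A B : Set I} (hA : Big A) (h : A ⊆ B) : Big B :=
  le_trans hA (mk_le_mk_of_subset h)

theorem Big.nonempty {I : Type u} (hI : ℵ₀ ≤ #I) {A : Set I} (hA : Big A) : A.Nonempty := by
  have : #A ≠ 0 := (lt_of_lt_of_le aleph0_pos (hI.trans hA)).ne'
  rw [mk_ne_zero_iff] at this
  exact nonempty_coe_sort.1 this

theorem big_univ {I : Type u} : Big (univ : Set I) := by
  simp [Big]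

/-- Since `R η` looks at a function only up to `η`, a step has to choose just the value at `η`. The
recursion pads the values from `η` on by a default, and `congr` makes the padding harmless. -/
theorem exists_wf_rec {V : Type*} {A : Type*} [LinearOrder V] [WellFoundedLT V] [Nonempty A]
    (R : V → (V → A) → Prop)
    (congr : ∀ η f g, (∀ ζ ≤ η, f ζ = g ζ) → R η f → R η g)
    (step : ∀ η f, (∀ ζ < η, R ζ f) → ∃ g, (∀ ζ < η, g ζ = f ζ) ∧ R η g) :
    ∃ f, ∀ η, R η f := by
  classical
  let d : A := Classical.arbitrary A
  let G : V → (V → A) → V → A := fun η f =>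
    if h : ∀ ζ < η, R ζ f then (step η f h).choose else f
  let f : V → A := (wellFounded_lt (α := V)).fix
    (fun η rec => G η (fun ζ => if h : ζ < η then rec ζ h else d) η)
  have hf : ∀ η, f η = G η (fun ζ => if ζ < η then f ζ else d) η := by
    intro η
    simp only [f]
    rw [WellFounded.fix_eq]
    rfl
  refine ⟨f, fun η => ?_⟩
  induction η using WellFoundedLT.induction with
  | ind η ih =>
    have h : ∀ ζ < η, R ζ (fun ζ => if ζ < η then f ζ else d) := fun ζ hζ =>
      congr ζ f _ (fun ξ hξ => by simp [lt_of_le_of_lt hξ hζ]) (ih ζ hζ)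
    have hs := (step η _ h).choose_spec
    refine congr η _ f (fun ζ hζ => ?_) hs.2
    rcases hζ.lt_or_eq with h1 | rfl
    · rw [hs.1 ζ h1]; simp [h1]
    · rw [hf ζ]
      simp only [G]
      rw [dif_pos h]

/-- Well-order `T × I` in its least order type: at each step fewer than `#I` values are taken, while
the set to choose from has at least `#I` elements. -/
theorem exists_injective_selector {T K I : Type u} (hI : ℵ₀ ≤ #I) (hT : #T ≤ #I)
    (E : T → Set K) (hE : ∀ t, #I ≤ #(E t)) :
    ∃ f : T × I → K, Function.Injective f ∧ ∀ t i, f (t, i) ∈ E t := by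
  classical
  rcases isEmpty_or_nonempty T with hTe | ⟨⟨t0⟩⟩
  · exact ⟨fun p => (hTe.false p.1).elim, fun p => (hTe.false p.1).elim, fun t => (hTe.false t).elim⟩
  have hIne : Nonempty I := by
    rw [← mk_ne_zero_iff]; exact (lt_of_lt_of_le aleph0_pos hI).ne'
  have hX : #(T × I) ≤ #I := by
    rw [mk_prod, lift_id, lift_id]
    exact (mul_le_mul' hT le_rfl).trans (mul_eq_self hI).le
  obtain ⟨r, wo, hr⟩ := Cardinal.exists_ord_eq (T × I)
  let _ : LinearOrder (T × I) := linearOrderOfSTO r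
  have hwf : WellFoundedLT (T × I) := ⟨wo.wf⟩
  have hIio : ∀ p : T × I, #(Iio p) < #I := by
    intro p
    refine lt_of_lt_of_le ?_ hX
    have := Ordinal.typein_lt_type r p
    rw [← hr, lt_ord, Ordinal.card_typein] at this
    exact this
  have : Nonempty K := by
    have h := hE t0
    have : #(E t0) ≠ 0 := (lt_of_lt_of_le aleph0_pos (hI.trans h)).ne'
    rw [mk_ne_zero_iff] at this
    exact ⟨this.some.1⟩
  obtain ⟨f, hf⟩ := exists_wf_rec (V := T × I) (A := K)
    (fun p f => f p ∈ E p.1 ∧ ∀ q < p, f q ≠ f p)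
    (fun η f g h => by
      rintro ⟨h1, h2⟩
      rw [h η le_rfl] at h1 h2
      exact ⟨h1, fun q hq => by rw [← h q hq.le]; exact h2 q hq⟩)
    (fun p f _ => by
      have : ∃ a ∈ E p.1, a ∉ f '' Iio p := by
        by_contra! hcon
        have h1 : #(E p.1) ≤ #(f '' Iio p) := mk_le_mk_of_subset hcon
        exact absurd ((hE p.1).trans (h1.trans mk_image_le)) (hIio p).not_ge
      obtain ⟨a, ha, hna⟩ := this
      refine ⟨Function.update f p a, fun q hq => by simp [hq.ne], by simpa, fun q hq => ?_⟩
      rw [Function.update_of_ne hq.ne, Function.update_self]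
      rintro rfl
      exact hna ⟨q, hq, rfl⟩)
  refine ⟨f, fun p q hpq => ?_, fun t i => (hf (t, i)).1⟩
  rcases lt_trichotomy p q with h | h | h
  · exact absurd hpq ((hf q).2 p h)
  · exact h
  · exact absurd hpq.symm ((hf p).2 q h)

/-- Routing: each of few families of injective sequences gets a large part of its own, on which a
single partial function takes the prescribed values. -/
theorem exists_routing {T K I X : Type u} (hI : ℵ₀ ≤ #I) (hT : #T ≤ #I)
    (z : T → I → K) (hz : ∀ t, Function.Injective (z t)) (B : T → Set I) (hB : ∀ t, Big (B t))
    (val : T → I → X) :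
    ∃ p : K → Option X,
      (∀ n x, p n = some x → ∃ t s, s ∈ B t ∧ z t s = n ∧ x = val t s) ∧
      ∀ t, Big {s | p (z t s) = some (val t s)} := by
  classical
  obtain ⟨f, hf, hfE⟩ := exists_injective_selector (K := K) hI hT (fun t => z t '' B t)
    (fun t => by rw [mk_image_eq (hz t)]; exact hB t)
  choose σ hσB hσ using hfE
  -- Injectivity of `f` makes the chosen preimage the only one; names outside the range of `f`
  -- remain free.
  refine ⟨fun n => if h : ∃ q : T × I, f q = n then
    some (val h.choose.1 (σ h.choose.1 h.choose.2)) else none, ?_, ?_⟩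
  · intro n x hx
    by_cases h : ∃ q : T × I, f q = n
    · simp only [h, dif_pos, Option.some.injEq] at hx
      refine ⟨h.choose.1, σ h.choose.1 h.choose.2, hσB _ _, ?_, hx.symm⟩
      rw [hσ]; exact h.choose_spec
    · simp [h] at hx
  · intro t
    have key : ∀ i, σ t i ∈ {s | (fun n => if h : ∃ q : T × I, f q = n then
        some (val h.choose.1 (σ h.choose.1 h.choose.2)) else none) (z t s) = some (val t s)} := by
      intro i
      have h : ∃ q : T × I, f q = z t (σ t i) := ⟨(t, i), (hσ t i).symm⟩
      have h2 : h.choose = (t, i) := hf (h.choose_spec.trans (hσ t i))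
      simp only [mem_ofPred_eq]
      rw [dif_pos h, h2]
    have hinj : Function.Injective (fun i => (⟨σ t i, key i⟩ : {s | (fun n =>
        if h : ∃ q : T × I, f q = n then
        some (val h.choose.1 (σ h.choose.1 h.choose.2)) else none) (z t s) = some (val t s)})) := by
      intro i i' h
      have h3 : σ t i = σ t i' := congrArg Subtype.val h
      have h4 : f (t, i) = f (t, i') := by rw [← hσ, ← hσ, h3]
      exact (Prod.ext_iff.1 (hf h4)).2
    exact mk_le_of_injective hinj

/-! ### Systems of approximations to the tree -/

/-- A system of approximations: `P η n χ m` says that the node `n` of level `η` has the node `m`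
as its predecessor at level `χ ≤ η`, and `F η c γ w` says that the sequence `w` of nodes of level
`η` has the colour `(c, γ)`. -/
@[ext]
structure Sys (V K I : Type u) where
  P : V → K → V → K → Prop
  F : V → K → V → (I → K) → Prop

variable {V K I : Type u}

/-- `n` is a node of level `η`. -/
def Sys.N (S : Sys V K I) (η : V) (n : K) : Prop := S.P η n η n

/-- Coherence of a system in which predecessors of nodes of level `η` are known exactly at the
levels in `x η`. -/
structure Sys.Inv [LinearOrder V] (S : Sys V K I) (x : V → Set V) : Prop where
  lt : ∀ {η χ}, χ ∈ x η → χ < η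
  P_dom : ∀ {η n χ m}, S.P η n χ m → χ ∈ x η ∨ χ = η
  P_left : ∀ {η n χ m}, S.P η n χ m → S.N η n
  P_right : ∀ {η n χ m}, S.P η n χ m → S.N χ m
  P_ex : ∀ {η n χ}, S.N η n → χ ∈ x η → ∃ m, S.P η n χ m
  P_unique : ∀ {η n χ m m'}, S.P η n χ m → S.P η n χ m' → m = m'
  P_comp : ∀ {η n χ m χ' m'}, S.P η n χ m → S.P η n χ' m' → χ' < χ → S.P χ m χ' m'
  F_dom : ∀ {η c γ w}, S.F η c γ w → γ ∈ x η ∨ γ = η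
  F_node : ∀ {η c γ w}, S.F η c γ w → ∀ s, S.N η (w s)
  F_inj : ∀ {η c γ w}, S.F η c γ w → Function.Injective w
  F_res : ∀ {η c γ w χ}, S.F η c γ w → χ ∈ x η → γ ≤ χ →
    ∃ w', S.F χ c γ w' ∧ ∀ s, S.P η (w s) χ (w' s)
  F_meet : ∀ {η c γ w w'}, S.F η c γ w → S.F η c γ w' → Big {s | w s = w' s}

/-! ### Threads: coherent choices of lower nodes -/

section Threads

variable [LinearOrder V]

theorem Sys.Inv.P_le {S : Sys V K I} {x : V → Set V} (h : S.Inv x) {η n χ m}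
    (hP : S.P η n χ m) : χ ≤ η :=
  (h.P_dom hP).elim (fun h' => (h.lt h').le) (fun h' => h'.le)

theorem Sys.Inv.F_le {S : Sys V K I} {x : V → Set V} (h : S.Inv x) {η c γ w}
    (hF : S.F η c γ w) : γ ≤ η :=
  (h.F_dom hF).elim (fun h' => (h.lt h').le) (fun h' => h'.le)

/-- The three ways in which a level `η` of `L` is controlled by lower levels of `L`. -/
def Anchored (S : Sys V K I) (x : V → Set V) (L : Set V) (η : V) : Prop :=
  (∀ ζ ∈ L, ζ < η → ∃ ζ' ∈ x η, ζ ≤ ζ') ∨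
  (∀ c γ w, S.F η c γ w → γ = η) ∨
  ∃ η' ∈ L, η' < η ∧ (∀ χ ∈ x η, χ ≤ η') ∧ ∃ a : K → K,
    (∀ n, S.N η n → S.N η' (a n)) ∧
    (∀ n χ m, S.P η n χ m → χ < η' → S.P η' (a n) χ m) ∧
    (∀ n m, S.P η n η' m → m = a n) ∧
    (∀ c γ w, S.F η c γ w → γ ≠ η → γ ≤ η' ∧ S.F η' c γ (a ∘ w))

/-- `Z` assigns to the nodes of level `η` coherent sets of nodes below them. -/
structure ThreadAt (S : Sys V K I) (x : V → Set V) (L : Set V) (Z : V → K → Set (V × K)) (η : V) :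
    Prop where
  lt : ∀ {n p}, S.N η n → p ∈ Z η n → p.1 < η ∧ p.1 ∈ L ∧ S.N p.1 p.2
  coh : ∀ {n p}, S.N η n → p ∈ Z η n → Z p.1 p.2 = {q | q ∈ Z η n ∧ q.1 < p.1}
  uniq : ∀ {n p q}, S.N η n → p ∈ Z η n → q ∈ Z η n → p.1 = q.1 → p = q
  ext : ∀ {n χ m}, S.P η n χ m → χ < η → (χ, m) ∈ Z η n
  meet : ∀ {ζ c γ w z}, ζ ∈ L → ζ < η → S.F ζ c γ w → S.F η c γ z → Big {s | (ζ, w s) ∈ Z η (z s)}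
  fresh : (∀ c γ w, S.F η c γ w → γ = η) → ∀ {n p}, S.N η n → p ∈ Z η n → ∃ ζ ∈ x η, p.1 ≤ ζ

theorem ThreadAt.congr {S : Sys V K I} {x : V → Set V} {L : Set V} {Z Z' : V → K → Set (V × K)}
    {η : V} (h : ∀ ζ ≤ η, Z ζ = Z' ζ) (hZ : ThreadAt S x L Z η) : ThreadAt S x L Z' η := by
  have h0 := h η le_rfl
  refine ⟨?_, ?_, ?_, ?_, ?_, ?_⟩
  · rw [← h0]; exact hZ.lt
  · intro n p hn hp
    rw [← h0] at hp
    rw [← h0, ← hZ.coh hn hp, h p.1 (hZ.lt hn hp).1.le]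
  · rw [← h0]; exact hZ.uniq
  · rw [← h0]; exact hZ.ext
  · rw [← h0]; exact hZ.meet
  · rw [← h0]; exact hZ.fresh

/-- The extension step when all the predecessors of a node are controlled by the known ones. -/
theorem threadAt_of_preds {S : Sys V K I} {x : V → Set V} {L : Set V} (hS : S.Inv x)
    {Z : V → K → Set (V × K)} {η : V} (hL : η ∈ L) (hxL : ∀ η ∈ L, x η ⊆ L)
    (ih : ∀ ζ ∈ L, ζ < η → ThreadAt S x L Z ζ)
    (hη : ∀ n, Z η n = {q | ∃ χ m, S.P η n χ m ∧ χ < η ∧ (q = (χ, m) ∨ q ∈ Z χ m)})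
    (hmeet : ∀ {ζ c γ w z}, ζ ∈ L → ζ < η → S.F ζ c γ w → S.F η c γ z →
      ∃ ζ' ∈ x η, ζ ≤ ζ') : ThreadAt S x L Z η := by
  have hcl : ∀ {n χ m}, S.P η n χ m → χ < η → χ ∈ L ∧ S.N χ m := fun hP hlt =>
    ⟨hxL η hL ((hS.P_dom hP).resolve_right hlt.ne), hS.P_right hP⟩
  have hsub : ∀ {n χ m}, S.P η n χ m → χ < η → ∀ {q}, q = (χ, m) ∨ q ∈ Z χ m →
      q.1 < η ∧ q.1 ∈ L ∧ S.N q.1 q.2 ∧ q.1 ≤ χ := by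
    intro n χ m hP hlt q hq
    obtain ⟨h1, h2⟩ := hcl hP hlt
    rcases hq with rfl | hq
    · exact ⟨hlt, h1, h2, le_rfl⟩
    · obtain ⟨a, b, c⟩ := (ih χ h1 hlt).lt h2 hq
      exact ⟨a.trans hlt, b, c, a.le⟩
  have hup : ∀ {n χ m χ' m'}, S.P η n χ m → χ < η → S.P η n χ' m' → χ ≤ χ' → χ' < η →
      ∀ {q}, q = (χ, m) ∨ q ∈ Z χ m → q = (χ', m') ∨ q ∈ Z χ' m' := by
    intro n χ m χ' m' hP hlt hP' hle hlt' q hq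
    rcases hle.lt_or_eq with h | rfl
    · have h1 : (χ, m) ∈ Z χ' m' := (ih χ' (hcl hP' hlt').1 hlt').ext (hS.P_comp hP' hP h) h
      rcases hq with rfl | hq
      · exact Or.inr h1
      · rw [(ih χ' (hcl hP' hlt').1 hlt').coh (hcl hP' hlt').2 h1] at hq
        exact Or.inr hq.1
    · rw [hS.P_unique hP hP'] at hq; exact hq
  -- The known predecessors of a node form a chain, so any two members of its thread are already
  -- seen from a single one of them.
  have hcommon : ∀ {n p q}, p ∈ Z η n → q ∈ Z η n → ∃ χ m, S.P η n χ m ∧ χ < η ∧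
      (p = (χ, m) ∨ p ∈ Z χ m) ∧ (q = (χ, m) ∨ q ∈ Z χ m) := by
    intro n p q hp hq
    rw [hη] at hp hq
    obtain ⟨χ, m, hP, hlt, hp⟩ := hp
    obtain ⟨χ', m', hP', hlt', hq⟩ := hq
    rcases le_total χ χ' with h | h
    · exact ⟨χ', m', hP', hlt', hup hP hlt hP' h hlt' hp, hq⟩
    · exact ⟨χ, m, hP, hlt, hp, hup hP' hlt' hP h hlt hq⟩
  refine ⟨?_, ?_, ?_, ?_, ?_, ?_⟩
  · intro n p hn hp
    rw [hη] at hp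
    obtain ⟨χ, m, hP, hlt, hp⟩ := hp
    obtain ⟨a, b, c, _⟩ := hsub hP hlt hp
    exact ⟨a, b, c⟩
  · intro n p hn hp
    ext q
    constructor
    · intro hq
      rw [hη] at hp
      obtain ⟨χ, m, hP, hlt, hp⟩ := hp
      rw [hη]
      rcases hp with rfl | hp
      · refine ⟨⟨χ, m, hP, hlt, Or.inr hq⟩, ((ih χ (hcl hP hlt).1 hlt).lt (hcl hP hlt).2 hq).1⟩
      · rw [(ih χ (hcl hP hlt).1 hlt).coh (hcl hP hlt).2 hp] at hq
        exact ⟨⟨χ, m, hP, hlt, Or.inr hq.1⟩, hq.2⟩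
    · rintro ⟨hq, hlt'⟩
      obtain ⟨χ, m, hP, hlt, hp, hq⟩ := hcommon hp hq
      rcases hp with rfl | hp
      · rcases hq with rfl | hq
        · exact absurd hlt' (lt_irrefl _)
        · exact hq
      · rw [(ih χ (hcl hP hlt).1 hlt).coh (hcl hP hlt).2 hp]
        rcases hq with rfl | hq
        · exact absurd ((ih χ (hcl hP hlt).1 hlt).lt (hcl hP hlt).2 hp).1 hlt'.not_gt
        · exact ⟨hq, hlt'⟩
  · intro n p q hn hp hq heq
    obtain ⟨χ, m, hP, hlt, hp, hq⟩ := hcommon hp hq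
    have hT := ih χ (hcl hP hlt).1 hlt
    have hN := (hcl hP hlt).2
    rcases hp with rfl | hp
    · rcases hq with rfl | hq
      · rfl
      · exact absurd heq (hT.lt hN hq).1.ne'
    · rcases hq with rfl | hq
      · exact absurd heq (hT.lt hN hp).1.ne
      · exact hT.uniq hN hp hq heq
  · intro n χ m hP hlt
    rw [hη]
    exact ⟨χ, m, hP, hlt, Or.inl rfl⟩
  · intro ζ c γ w z hζL hζ hw hz
    obtain ⟨ζ', hζ', hle⟩ := hmeet hζL hζ hw hz
    obtain ⟨w', hw', hPw⟩ := hS.F_res hz hζ' ((hS.F_le hw).trans hle)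
    have hlt' := hS.lt hζ'
    rcases hle.lt_or_eq with h | rfl
    · refine ((ih ζ' (hxL η hL hζ') hlt').meet hζL h hw hw').mono (fun s hs => ?_)
      simp only [mem_ofPred_eq, hη]
      exact ⟨ζ', w' s, hPw s, hlt', Or.inr hs⟩
    · refine (hS.F_meet hw hw').mono (fun s hs => ?_)
      simp only [mem_ofPred_eq, hη] at hs ⊢
      exact ⟨ζ, w' s, hPw s, hlt', Or.inl (by rw [hs])⟩
  · intro _ n p hn hp
    rw [hη] at hp
    obtain ⟨χ, m, hP, hlt, hp⟩ := hp
    exact ⟨χ, (hS.P_dom hP).resolve_right hlt.ne, (hsub hP hlt hp).2.2.2⟩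

/-- The extension step when each node is put on top of a single lower node, its pivot. -/
theorem threadAt_of_pivot {S : Sys V K I} {x : V → Set V} {L : Set V} (hS : S.Inv x)
    {Z : V → K → Set (V × K)} {η η' : V} (hη'L : η' ∈ L) (hη' : η' < η)
    (ih : ∀ ζ ∈ L, ζ < η → ThreadAt S x L Z ζ) {a : K → K} {p : K → V × K}
    (hx : ∀ χ ∈ x η, χ ≤ η')
    (haP : ∀ n χ m, S.P η n χ m → χ < η' → S.P η' (a n) χ m)
    (haN : ∀ n, S.N η n → S.N η' (a n))
    (haη : ∀ n m, S.P η n η' m → m = a n)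
    (haF : ∀ c γ w, S.F η c γ w → γ ≠ η → γ ≤ η' ∧ S.F η' c γ (a ∘ w))
    (hp : ∀ n, S.N η n → (p n).1 ∈ L ∧ (p n).1 < η ∧ S.N (p n).1 (p n).2 ∧
      ((η', a n) = p n ∨ (η', a n) ∈ Z (p n).1 (p n).2))
    (hη : ∀ n, Z η n = {q | q = p n ∨ q ∈ Z (p n).1 (p n).2})
    (hnot : ∃ c γ w, S.F η c γ w ∧ γ ≠ η)
    (hmeet : ∀ {ζ c γ w z}, ζ ∈ L → ζ < η → η' < ζ → S.F ζ c γ w → S.F η c γ z →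
      Big {s | p (z s) = (ζ, w s)}) : ThreadAt S x L Z η := by
  have hmem : ∀ n, (η', a n) ∈ Z η n ↔ ((η', a n) = p n ∨ (η', a n) ∈ Z (p n).1 (p n).2) := by
    intro n; rw [hη]; rfl
  have hsub : ∀ n, S.N η n → ∀ q ∈ Z η' (a n), q ∈ Z η n := by
    intro n hn q hq
    obtain ⟨h1, h2, h3, h4⟩ := hp n hn
    rw [hη]
    rcases h4 with h4 | h4
    · right; rw [← h4]; exact hq
    · right
      have := (ih _ h1 h2).coh h3 h4
      simp only at this
      rw [this] at hq
      exact hq.1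
  refine ⟨?_, ?_, ?_, ?_, ?_, ?_⟩
  · intro n q hn hq
    obtain ⟨h1, h2, h3, h4⟩ := hp n hn
    rw [hη] at hq
    rcases hq with rfl | hq
    · exact ⟨h2, h1, h3⟩
    · obtain ⟨a, b, c⟩ := (ih _ h1 h2).lt h3 hq
      exact ⟨a.trans h2, b, c⟩
  · intro n q hn hq
    obtain ⟨h1, h2, h3, h4⟩ := hp n hn
    rw [hη] at hq ⊢
    ext r
    rcases hq with rfl | hq
    · constructor
      · intro hr
        exact ⟨Or.inr hr, ((ih _ h1 h2).lt h3 hr).1⟩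
      · rintro ⟨rfl | hr, hlt⟩
        · exact absurd hlt (lt_irrefl _)
        · exact hr
    · rw [(ih _ h1 h2).coh h3 hq]
      constructor
      · rintro ⟨hr, hlt⟩
        exact ⟨Or.inr hr, hlt⟩
      · rintro ⟨rfl | hr, hlt⟩
        · exact absurd hlt ((ih _ h1 h2).lt h3 hq).1.not_gt
        · exact ⟨hr, hlt⟩
  · intro n q r hn hq hr heq
    obtain ⟨h1, h2, h3, h4⟩ := hp n hn
    rw [hη] at hq hr
    rcases hq with rfl | hq
    · rcases hr with rfl | hr
      · rfl
      · exact absurd heq ((ih _ h1 h2).lt h3 hr).1.ne'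
    · rcases hr with rfl | hr
      · exact absurd heq ((ih _ h1 h2).lt h3 hq).1.ne
      · exact (ih _ h1 h2).uniq h3 hq hr heq
  · intro n χ m hP hlt
    have hn := hS.P_left hP
    rcases (hx χ ((hS.P_dom hP).resolve_right hlt.ne)).lt_or_eq with h | rfl
    · exact hsub n hn _ ((ih η' hη'L hη').ext (haP n χ m hP h) h)
    · rw [haη n m hP, hmem]
      exact (hp n hn).2.2.2
  · intro ζ c γ w z hζL hζ hw hz
    have hzn := hS.F_node hz
    have hγ : γ ≠ η := ((hS.F_le hw).trans_lt hζ).ne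
    obtain ⟨hγ', hF'⟩ := haF c γ z hz hγ
    rcases lt_trichotomy ζ η' with h | rfl | h
    · exact ((ih η' hη'L hη').meet hζL h hw hF').mono (fun s hs => hsub _ (hzn s) _ hs)
    · refine (hS.F_meet hw hF').mono (fun s hs => ?_)
      simp only [mem_ofPred_eq, Function.comp] at hs ⊢
      rw [hs, hmem]
      exact (hp _ (hzn s)).2.2.2
    · refine (hmeet hζL hζ h hw hz).mono (fun s hs => ?_)
      simp only [mem_ofPred_eq, hη] at hs ⊢
      exact Or.inl hs.symm
  · intro hno
    obtain ⟨c, γ, w, hF, hne⟩ := hnot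
    exact absurd (hno c γ w hF) hne

/-- The set of all facts at levels in `L`. -/
def Sys.factsOn (S : Sys V K I) (L : Set V) : Set (V × K × V × (I → K)) :=
  {f | f.1 ∈ L ∧ S.F f.1 f.2.1 f.2.2.1 f.2.2.2}

/-- The set of all nodes at levels in `L`. -/
def Sys.nodesOn (S : Sys V K I) (L : Set V) : Set (V × K) := {p | p.1 ∈ L ∧ S.N p.1 p.2}

/-- Recursion on the level. If the known levels are cofinal, or all colours at `η` are based at `η`,
the thread is generated by the known predecessors. Otherwise a node `n` may be placed on any lower
node whose thread passes through the anchor image `a n`, and this freedom is spent on making equally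
coloured sequences meet. -/
theorem exists_threads [WellFoundedLT V] (hI : ℵ₀ ≤ #I) {S : Sys V K I} {x : V → Set V} {L : Set V}
    (hS : S.Inv x) (hxL : ∀ η ∈ L, x η ⊆ L) (hfacts : #(S.factsOn L) ≤ #I)
    (hanch : ∀ η ∈ L, Anchored S x L η) :
    ∃ Z : V → K → Set (V × K), ∀ η ∈ L, ThreadAt S x L Z η := by
  classical
  refine exists_wf_rec (fun η Z => η ∈ L → ThreadAt S x L Z η)
    (fun η Z Z' h hZ hη => (hZ hη).congr h) (fun η Z ih => ?_)
  by_cases hηL : η ∈ L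
  swap
  · exact ⟨Z, fun _ _ => rfl, fun h => absurd h hηL⟩
  have upd : ∀ W : K → Set (V × K), ∀ ζ < η, Function.update Z η W ζ = Z ζ :=
    fun W ζ hζ => Function.update_of_ne hζ.ne _ _
  have ih' : ∀ W : K → Set (V × K), ∀ ζ ∈ L, ζ < η →
      ThreadAt S x L (Function.update Z η W) ζ := fun W ζ hζL hζ =>
    (ih ζ hζ hζL).congr (fun ξ hξ => (upd W ξ (hξ.trans_lt hζ)).symm)
  by_cases hcase : (∀ ζ ∈ L, ζ < η → ∃ ζ' ∈ x η, ζ ≤ ζ') ∨ (∀ c γ w, S.F η c γ w → γ = η)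
  · refine ⟨Function.update Z η (fun n =>
      {q | ∃ χ m, S.P η n χ m ∧ χ < η ∧ (q = (χ, m) ∨ q ∈ Z χ m)}), upd _, fun _ => ?_⟩
    refine threadAt_of_preds hS hηL hxL (ih' _) (fun n => ?_) ?_
    · rw [Function.update_self]
      ext q
      constructor
      · rintro ⟨χ, m, hP, hlt, hq⟩
        exact ⟨χ, m, hP, hlt, by rwa [upd _ χ hlt]⟩
      · rintro ⟨χ, m, hP, hlt, hq⟩
        exact ⟨χ, m, hP, hlt, by rwa [upd _ χ hlt] at hq⟩
    · intro ζ c γ w z hζL hζ hw hz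
      rcases hcase with h | h
      · exact h ζ hζL hζ
      · exact absurd (h c γ z hz) ((hS.F_le hw).trans_lt hζ).ne
  · push Not at hcase
    obtain ⟨η', hη'L, hη', hx, a, haN, haP, haη, haF⟩ :=
      ((hanch η hηL).resolve_left (by push Not; exact hcase.1)).resolve_left
        (by push Not; exact hcase.2)
    -- Only pairs whose lower member lies strictly above the anchor need care; sequences at or below
    -- `η'` are met through the anchor.
    let T : Set (S.factsOn L × S.factsOn L) :=
      {t | t.1.1.1 = η ∧ η' < t.2.1.1 ∧ t.2.1.1 < η ∧ t.1.1.2.1 = t.2.1.2.1 ∧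
        t.1.1.2.2.1 = t.2.1.2.2.1}
    have hT : #T ≤ #I := by
      refine (mk_set_le T).trans ?_
      rw [← mul_def]
      exact (mul_le_mul' hfacts hfacts).trans (mul_eq_self hI).le
    let z : T → I → K := fun t => t.1.1.1.2.2.2
    let w : T → I → K := fun t => t.1.2.1.2.2.2
    have hz : ∀ t : T, S.F η t.1.2.1.2.1 t.1.2.1.2.2.1 (z t) := fun t => by
      have := t.1.1.2.2
      rw [t.2.1, t.2.2.2.2.1, t.2.2.2.2.2] at this
      exact this
    have hw : ∀ t : T, S.F t.1.2.1.1 t.1.2.1.2.1 t.1.2.1.2.2.1 (w t) := fun t => t.1.2.2.2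
    -- The indices offered to a pair are those at which the lower node already passes through the
    -- anchor image of the upper one. They are many by `meet` at the lower level, since the colour
    -- at `η` is also carried by the image sequence at `η'`.
    obtain ⟨p, hp1, hp2⟩ := exists_routing (X := V × K) hI hT z (fun t => hS.F_inj (hz t))
      (fun t => {s | (η', a (z t s)) ∈ Z t.1.2.1.1 (w t s)})
      (fun t => by
        have hγ : t.1.2.1.2.2.1 ≠ η := ((hS.F_le (hw t)).trans_lt t.2.2.2.1).ne
        exact (ih _ t.2.2.2.1 t.1.2.2.1).meet hη'L t.2.2.1 (haF _ _ _ (hz t) hγ).2 (hw t))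
      (fun t s => (t.1.2.1.1, w t s))
    -- Nodes claimed by no pair are placed directly on their anchor image.
    let pv : K → V × K := fun n => (p n).getD (η', a n)
    have hpv : ∀ n, S.N η n → (pv n).1 ∈ L ∧ (pv n).1 < η ∧ S.N (pv n).1 (pv n).2 ∧
        ((η', a n) = pv n ∨ (η', a n) ∈ Z (pv n).1 (pv n).2) := by
      intro n hn
      simp only [pv]
      rcases hpn : p n with _ | q
      · exact ⟨hη'L, hη', haN n hn, Or.inl rfl⟩
      · obtain ⟨t, s, hs, rfl, rfl⟩ := hp1 n q hpn
        exact ⟨t.1.2.2.1, t.2.2.2.1, hS.F_node (hw t) s, Or.inr hs⟩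
    refine ⟨Function.update Z η (fun n => {q | q = pv n ∨ q ∈ Z (pv n).1 (pv n).2}), upd _,
      fun _ => ?_⟩
    -- values at non-nodes are irrelevant, but the pivot has to stay below `η`
    have hpvlt : ∀ n, (pv n).1 < η := by
      intro n
      simp only [pv]
      rcases hpn : p n with _ | q
      · exact hη'
      · obtain ⟨t, s, hs, rfl, rfl⟩ := hp1 n q hpn
        exact t.2.2.2.1
    refine threadAt_of_pivot (p := pv) hS hη'L hη' (ih' _) hx haP haN haη haF ?_ ?_ ?_ ?_
    · intro n hn
      rw [upd _ _ (hpvlt n)]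
      exact hpv n hn
    · intro n
      rw [Function.update_self, upd _ _ (hpvlt n)]
    · exact hcase.2
    · intro ζ c γ w' z' hζL hζ hη'ζ hw' hz'
      refine (hp2 ⟨(⟨(η, c, γ, z'), hηL, hz'⟩, ⟨(ζ, c, γ, w'), hζL, hw'⟩),
        rfl, hη'ζ, hζ, rfl, rfl⟩).mono (fun s hs => ?_)
      simp only [mem_ofPred_eq, pv] at hs ⊢
      rw [hs]
      rfl

end Threads

/-! ### Completing a small system -/

section Fill

theorem exists_fresh_names (hI : ℵ₀ ≤ #I) (hK : #I < #K) (O : Set (V × K)) (hO : #O ≤ #I) :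
    ∃ ν : V × K → K, (∀ q ∈ O, ∀ q' ∈ O, ν q = ν q' → q = q') ∧
      ∀ q ∈ O, ∀ q' ∈ O, ν q ≠ q'.2 := by
  classical
  have hKi : Infinite K := infinite_iff.2 (hI.trans hK.le)
  have h1 : #(Prod.snd '' O : Set K) < #K := (mk_image_le.trans hO).trans_lt hK
  have h2 : #O ≤ #((Prod.snd '' O)ᶜ : Set K) := by
    rw [mk_compl_of_infinite _ h1]; exact hO.trans hK.le
  obtain ⟨f⟩ := h2
  have : Nonempty K := inferInstance
  refine ⟨fun q => if h : q ∈ O then (f ⟨q, h⟩).1 else Classical.arbitrary K, ?_, ?_⟩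
  · intro q hq q' hq' h
    simp only [hq, hq', dif_pos] at h
    exact congrArg Subtype.val (f.injective (Subtype.ext h))
  · intro q hq q' hq' h
    simp only [hq, dif_pos] at h
    exact (f ⟨q, hq⟩).2 ⟨q', hq', h.symm⟩

variable [LinearOrder V]

theorem Sys.Inv.trans {S : Sys V K I} {L : Set V} (h : S.Inv (fun η => L ∩ Iio η))
    {η n ξ m χ k} (h1 : S.P η n ξ m) (h2 : S.P ξ m χ k) : S.P η n χ k := by
  rcases h.P_dom h1 with h1' | rfl
  · rcases h.P_dom h2 with h2' | rfl
    · obtain ⟨k', hk'⟩ := h.P_ex (h.P_left h1) (⟨h2'.1, h2'.2.trans h1'.2⟩ : χ ∈ L ∩ Iio η)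
      rwa [h.P_unique h2 (h.P_comp h1 hk' h2'.2)]
    · rwa [h.P_unique h2 (h.P_left h2)]
  · rwa [h.P_unique (h.P_left h1) h1]

/-- The old node `q` stands for the node which it induces at level `ζ`. -/
def Stands (Z : V → K → Set (V × K)) (q : V × K) (ζ : V) : Prop :=
  ζ ≤ q.1 ∧ ∀ p ∈ Z q.1 q.2, p.1 < ζ

/-- The old node `q` and the old nodes below it. -/
def thread (Z : V → K → Set (V × K)) (q : V × K) : Set (V × K) :=
  {p | p = q ∨ p ∈ Z q.1 q.2}

variable [WellFoundedLT V]

/-- A node of level `ζ` in the completion is represented by the lowest old node at or above `ζ` on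
some thread, and predecessors are read off the threads. Colours are projected from old sequences;
two projections with one colour meet often because `ThreadAt.meet` already makes the old sequences
meet. The last clause says that a level with no colours based below it gains no old predecessors
beyond its known levels; this is what later makes an added node new. -/
theorem exists_completion (hI : ℵ₀ ≤ #I) (hK : #I < #K) {S : Sys V K I} {x : V → Set V} {L : Set V}
    (hS : S.Inv x) (hxL : ∀ η ∈ L, x η ⊆ L) (hL : #L ≤ #I) (hnodes : #(S.nodesOn L) ≤ #I)
    (hfacts : #(S.factsOn L) ≤ #I) (hanch : ∀ η ∈ L, Anchored S x L η) :
    ∃ Q : Sys V K I, Q.Inv (fun η => L ∩ Iio η) ∧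
      (∀ η ∈ L, ∀ n χ m, S.P η n χ m → Q.P η n χ m) ∧
      (∀ η ∈ L, ∀ c γ w, S.F η c γ w → Q.F η c γ w) ∧
      (∀ η n χ m, Q.P η n χ m → η ∈ L) ∧
      (∀ η c γ w, Q.F η c γ w → η ∈ L ∧ ∃ η' ∈ L, ∃ w', S.F η' c γ w') ∧
      #(Q.nodesOn L) ≤ #I ∧ #(Q.factsOn L) ≤ #I ∧
      ∀ η, (∀ c γ w, S.F η c γ w → γ = η) → ∀ n χ m, Q.P η n χ m → S.N η n → S.N χ m →
        χ = η ∨ ∃ ζ ∈ x η, χ ≤ ζ := by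
  classical
  obtain ⟨Z, hZ⟩ := exists_threads hI hS hxL hfacts hanch
  set O := S.nodesOn L with hOdef
  obtain ⟨ν, hνinj, hνfresh⟩ := exists_fresh_names hI hK O hnodes
  -- An old node keeps its name on its own level and uses a fresh one wherever it stands for a node
  -- of a lower level, so the two kinds never clash.
  let name : V → V × K → K := fun ζ q => if q.1 = ζ then q.2 else ν q
  have hname_self : ∀ q : V × K, name q.1 q = q.2 := fun q => by simp [name]
  have hname_old : ∀ {ζ q q'}, q ∈ O → q' ∈ O → name ζ q = q'.2 → q.1 = ζ := by
    intro ζ q q' hq hq' h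
    by_contra hne
    simp only [name, if_neg hne] at h
    exact hνfresh q hq q' hq' h
  have hname_inj : ∀ {ζ q q'}, q ∈ O → q' ∈ O → name ζ q = name ζ q' → q = q' := by
    intro ζ q q' hq hq' h
    by_cases h1 : q.1 = ζ
    · have h2 : name ζ q = q.2 := by simp [name, h1]
      have h3 := hname_old hq' hq (h.symm.trans h2)
      refine Prod.ext (h1.trans h3.symm) ?_
      rw [← h2, h]; simp [name, h3]
    · by_cases h3 : q'.1 = ζ
      · have h2 : name ζ q' = q'.2 := by simp [name, h3]
        exact absurd (hname_old hq hq' (h.trans h2)) h1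
      · simp only [name, if_neg h1, if_neg h3] at h
        exact hνinj q hq q' hq' h
  -- threads
  have tO : ∀ {q p}, q ∈ O → p ∈ thread Z q → p ∈ O ∧ p.1 ≤ q.1 := by
    intro q p hq hp
    rcases hp with rfl | hp
    · exact ⟨hq, le_rfl⟩
    · obtain ⟨a, b, c⟩ := (hZ q.1 hq.1).lt hq.2 hp
      exact ⟨⟨b, c⟩, a.le⟩
  have tsub : ∀ {q p}, q ∈ O → p ∈ thread Z q → Z p.1 p.2 = {r | r ∈ thread Z q ∧ r.1 < p.1} := by
    intro q p hq hp
    ext r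
    rcases hp with rfl | hp
    · constructor
      · intro hr; exact ⟨Or.inr hr, ((hZ p.1 hq.1).lt hq.2 hr).1⟩
      · rintro ⟨rfl | hr, hlt⟩
        · exact absurd hlt (lt_irrefl _)
        · exact hr
    · rw [(hZ q.1 hq.1).coh hq.2 hp]
      constructor
      · rintro ⟨hr, hlt⟩; exact ⟨Or.inr hr, hlt⟩
      · rintro ⟨rfl | hr, hlt⟩
        · exact absurd hlt ((hZ r.1 hq.1).lt hq.2 hp).1.not_gt
        · exact ⟨hr, hlt⟩
  have tuniq : ∀ {q p r}, q ∈ O → p ∈ thread Z q → r ∈ thread Z q → p.1 = r.1 → p = r := by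
    intro q p r hq hp hr h
    rcases hp with rfl | hp
    · rcases hr with rfl | hr
      · rfl
      · exact absurd h ((hZ p.1 hq.1).lt hq.2 hr).1.ne'
    · rcases hr with rfl | hr
      · exact absurd h ((hZ r.1 hq.1).lt hq.2 hp).1.ne
      · exact (hZ q.1 hq.1).uniq hq.2 hp hr h
  have ttrans : ∀ {q p r}, q ∈ O → p ∈ thread Z q → r ∈ thread Z p → r ∈ thread Z q := by
    intro q p r hq hp hr
    rcases hr with rfl | hr
    · exact hp
    · rw [tsub hq hp] at hr; exact hr.1
  have tlin : ∀ {q p r}, q ∈ O → p ∈ thread Z q → r ∈ thread Z q → r.1 ≤ p.1 →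
      r ∈ thread Z p := by
    intro q p r hq hp hr h
    rcases h.lt_or_eq with h | h
    · right; rw [tsub hq hp]; exact ⟨hr, h⟩
    · left; exact tuniq hq hr hp h
  -- The lowest member of the thread at a level at least `ζ` is the representative.
  have tex : ∀ {q ζ}, q ∈ O → ζ ≤ q.1 → ∃ r ∈ thread Z q, Stands Z r ζ := by
    intro q ζ hq hζ
    have hne : {ξ | ∃ r ∈ thread Z q, r.1 = ξ ∧ ζ ≤ ξ}.Nonempty := ⟨q.1, q, Or.inl rfl, rfl, hζ⟩
    obtain ⟨ξ, ⟨r, hr, rfl, hle⟩, hmin⟩ := WellFounded.has_min (wellFounded_lt (α := V)) _ hne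
    refine ⟨r, hr, hle, fun p hp => ?_⟩
    rw [tsub hq hr] at hp
    by_contra hcon
    exact hmin p.1 ⟨p, hp.1, rfl, not_lt.1 hcon⟩ hp.2
  have tstands : ∀ {q p r ζ χ}, q ∈ O → p ∈ thread Z q → r ∈ thread Z q → Stands Z p ζ →
      Stands Z r χ → χ ≤ ζ → r ∈ thread Z p := by
    intro q p r ζ χ hq hp hr hpζ hrχ hle
    rcases le_or_gt r.1 p.1 with h | h
    · exact tlin hq hp hr h
    · have : p ∈ Z r.1 r.2 := by rw [tsub hq hr]; exact ⟨hp, h⟩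
      exact absurd (hrχ.2 p this) (hle.trans hpζ.1).not_gt
  have tsuniq : ∀ {q p r ζ}, q ∈ O → p ∈ thread Z q → r ∈ thread Z q → Stands Z p ζ →
      Stands Z r ζ → p = r := by
    intro q p r ζ hq hp hr hpζ hrζ
    have h1 := (tO (tO hq hp).1 (tstands hq hp hr hpζ hrζ le_rfl)).2
    have h2 := (tO (tO hq hr).1 (tstands hq hr hp hrζ hpζ le_rfl)).2
    exact tuniq hq hp hr (le_antisymm h2 h1)
  have stands_self : ∀ {q}, q ∈ O → Stands Z q q.1 := fun {q} hq =>
    ⟨le_rfl, fun p hp => ((hZ q.1 hq.1).lt hq.2 hp).1⟩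
  let P : V → K → V → K → Prop := fun η n χ m => η ∈ L ∧ χ ∈ L ∧ χ ≤ η ∧
    ∃ q ∈ O, Stands Z q η ∧ ∃ r ∈ thread Z q, Stands Z r χ ∧ n = name η q ∧ m = name χ r
  have P_node : ∀ {η n}, P η n η n ↔ η ∈ L ∧ ∃ q ∈ O, Stands Z q η ∧ n = name η q := by
    intro η n
    constructor
    · rintro ⟨h1, _, _, q, hq, hqη, r, hr, hrη, h2, h3⟩
      exact ⟨h1, q, hq, hqη, h2⟩
    · rintro ⟨h1, q, hq, hqη, h2⟩
      exact ⟨h1, h1, le_rfl, q, hq, hqη, q, Or.inl rfl, hqη, h2, h2⟩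
  have hPS : ∀ η ∈ L, ∀ n χ m, S.P η n χ m → P η n χ m := by
    intro η hη n χ m h
    have hq : (η, n) ∈ O := ⟨hη, hS.P_left h⟩
    rcases hS.P_dom h with hχ | rfl
    · have hr : (χ, m) ∈ thread Z (η, n) := Or.inr ((hZ η hη).ext h (hS.lt hχ))
      exact ⟨hη, hxL η hη hχ, (hS.lt hχ).le, (η, n), hq, stands_self hq, (χ, m), hr,
        stands_self (tO hq hr).1, (hname_self (η, n)).symm, (hname_self (χ, m)).symm⟩
    · rw [← hS.P_unique (hS.P_left h) h]
      exact P_node.2 ⟨hη, (χ, n), hq, stands_self hq, (hname_self (χ, n)).symm⟩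
  have P_left : ∀ {η n χ m}, P η n χ m → P η n η n := by
    rintro η n χ m ⟨h1, h2, h3, q, hq, hqη, r, hr, hrχ, h4, h5⟩
    exact P_node.2 ⟨h1, q, hq, hqη, h4⟩
  have P_right : ∀ {η n χ m}, P η n χ m → P χ m χ m := by
    rintro η n χ m ⟨h1, h2, h3, q, hq, hqη, r, hr, hrχ, h4, h5⟩
    exact P_node.2 ⟨h2, r, (tO hq hr).1, hrχ, h5⟩
  have P_unique : ∀ {η n χ m m'}, P η n χ m → P η n χ m' → m = m' := by
    rintro η n χ m m' ⟨h1, h2, h3, q, hq, hqη, r, hr, hrχ, h4, h5⟩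
      ⟨_, _, _, q', hq', hqη', r', hr', hrχ', h4', h5'⟩
    obtain rfl := hname_inj hq hq' (h4.symm.trans h4')
    rw [h5, h5', tsuniq hq hr hr' hrχ hrχ']
  have P_comp : ∀ {η n χ m χ' m'}, P η n χ m → P η n χ' m' → χ' ≤ χ → P χ m χ' m' := by
    rintro η n χ m χ' m' ⟨h1, h2, h3, q, hq, hqη, r, hr, hrχ, h4, h5⟩
      ⟨_, h2', _, q', hq', hqη', r', hr', hrχ', h4', h5'⟩ hlt
    obtain rfl := hname_inj hq hq' (h4.symm.trans h4')
    exact ⟨h2, h2', hlt, r, (tO hq hr).1, hrχ, r', tstands hq hr hr' hrχ hrχ' hlt, hrχ', h5, h5'⟩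
  have P_ex : ∀ {η n χ}, P η n η n → χ ∈ L → χ ≤ η → ∃ m, P η n χ m := by
    intro η n χ hn hχ hlt
    obtain ⟨h1, q, hq, hqη, h2⟩ := P_node.1 hn
    obtain ⟨r, hr, hrχ⟩ := tex hq (hlt.trans hqη.1)
    exact ⟨name χ r, h1, hχ, hlt, q, hq, hqη, r, hr, hrχ, h2, rfl⟩
  have P_trans : ∀ {η n ξ m χ k}, P η n ξ m → P ξ m χ k → P η n χ k := by
    intro η n ξ m χ k h1 h2
    obtain ⟨k', hk'⟩ := P_ex (P_left h1) h2.2.1 (h2.2.2.1.trans h1.2.2.1)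
    rwa [P_unique h2 (P_comp h1 hk' h2.2.2.1)]
  let F : V → K → V → (I → K) → Prop := fun ζ c γ w => ζ ∈ L ∧ γ ≤ ζ ∧
    ∃ η ∈ L, ∃ v, S.F η c γ v ∧ ∀ s, P η (v s) ζ (w s)
  have hγL : ∀ {η c γ w}, η ∈ L → S.F η c γ w → γ ∈ L := fun hη hF =>
    (hS.F_dom hF).elim (fun h => hxL _ hη h) (fun h => h ▸ hη)
  have hNO : ∀ {ζ n}, ζ ∈ L → P ζ n ζ n → ∃ q ∈ O, n = name ζ q := fun _ h =>
    let ⟨_, q, hq, _, h2⟩ := P_node.1 h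
    ⟨q, hq, h2⟩
  refine ⟨⟨P, F⟩, ?_, hPS, ?_, fun _ _ _ _ h => h.1, ?_, ?_, ?_, ?_⟩
  · refine ⟨fun h => h.2, ?_, P_left, P_right, fun hn hχ => P_ex hn hχ.1 hχ.2.le, P_unique,
      fun h h' hlt => P_comp h h' hlt.le, ?_, ?_, ?_, ?_, ?_⟩
    · rintro η n χ m h
      rcases h.2.2.1.lt_or_eq with hlt | rfl
      · exact Or.inl ⟨h.2.1, hlt⟩
      · exact Or.inr rfl
    · rintro ζ c γ w ⟨h1, h2, η, hη, v, hF, hw⟩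
      rcases h2.lt_or_eq with hlt | rfl
      · exact Or.inl ⟨hγL hη hF, hlt⟩
      · exact Or.inr rfl
    · rintro ζ c γ w ⟨h1, h2, η, hη, v, hF, hw⟩ s
      exact P_right (hw s)
    · rintro ζ c γ w ⟨h1, h2, η, hη, v, hF, hw⟩ s t hst
      -- The projection stays injective because projecting it further to the base level `γ` gives an
      -- injective sequence.
      obtain ⟨v0, hv0, hv0inj⟩ : ∃ v0 : I → K, (∀ s, P η (v s) γ (v0 s)) ∧
          Function.Injective v0 := by
        rcases hS.F_dom hF with hγ | rfl
        · obtain ⟨v0, h3, h4⟩ := hS.F_res hF hγ le_rfl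
          exact ⟨v0, fun s => hPS η hη _ _ _ (h4 s), hS.F_inj h3⟩
        · exact ⟨v, fun s => hPS γ hη _ _ _ (hS.F_node hF s), hS.F_inj hF⟩
      have h5 := fun s => P_comp (hw s) (hv0 s) h2
      have h6 := h5 s
      rw [hst] at h6
      exact hv0inj (P_unique h6 (h5 t))
    · rintro ζ c γ w χ ⟨h1, h2, η, hη, v, hF, hw⟩ hχ hγχ
      choose w' hw' using fun s => P_ex (P_right (hw s)) hχ.1 hχ.2.le
      exact ⟨w', ⟨hχ.1, hγχ, η, hη, v, hF, fun s => P_trans (hw s) (hw' s)⟩, hw'⟩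
    · have aux : ∀ {ζ c γ} {w w' : I → K} {η η' v v'}, η ∈ L → η' ∈ L → η ≤ η' → S.F η c γ v →
          S.F η' c γ v' → (∀ s, P η (v s) ζ (w s)) → (∀ s, P η' (v' s) ζ (w' s)) →
          Big {s | w s = w' s} := by
        intro ζ c γ w w' η η' v v' hη hη' hle hF hF' hw hw'
        rcases hle.lt_or_eq with hlt | rfl
        · refine ((hZ η' hη').meet hη hlt hF hF').mono (fun s hs => ?_)
          have hq : (η', v' s) ∈ O := ⟨hη', hS.F_node hF' s⟩
          have hr : (η, v s) ∈ thread Z (η', v' s) := Or.inr hs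
          have hP : P η' (v' s) η (v s) := ⟨hη', hη, hlt.le, (η', v' s), hq, stands_self hq,
            (η, v s), hr, stands_self (tO hq hr).1, (hname_self (η', v' s)).symm,
            (hname_self (η, v s)).symm⟩
          exact P_unique (P_trans hP (hw s)) (hw' s)
        · refine (hS.F_meet hF hF').mono (fun s hs => ?_)
          have hs' : v s = v' s := hs
          have h1 := hw s
          rw [hs'] at h1
          exact P_unique h1 (hw' s)
      rintro ζ c γ w w' ⟨h1, h2, η, hη, v, hF, hw⟩ ⟨h1', h2', η', hη', v', hF', hw'⟩
      rcases le_total η η' with h | h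
      · exact aux hη hη' h hF hF' hw hw'
      · refine (aux hη' hη h hF' hF hw' hw).mono (fun s hs => ?_)
        exact Eq.symm hs
  · intro η hη c γ w hF
    exact ⟨hη, hS.F_le hF, η, hη, w, hF, fun s => hPS η hη _ _ _ (hS.F_node hF s)⟩
  · rintro ζ c γ w ⟨h1, h2, η, hη, v, hF, hw⟩
    exact ⟨h1, η, hη, v, hF⟩
  · have : Sys.nodesOn ⟨P, F⟩ L ⊆ (fun t : V × (V × K) => (t.1, name t.1 t.2)) '' (L ×ˢ O) := by
      rintro ⟨ζ, n⟩ ⟨h1, h2⟩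
      obtain ⟨q, hq, h3⟩ := hNO h1 h2
      exact ⟨(ζ, q), ⟨h1, hq⟩, Prod.ext rfl h3.symm⟩
    refine (mk_le_mk_of_subset this).trans (mk_image_le.trans ?_)
    rw [mk_setProd]
    simpa using (mul_le_mul' hL hnodes).trans (mul_eq_self hI).le
  · have hsub : Sys.factsOn ⟨P, F⟩ L ⊆ range (fun t : L × S.factsOn L =>
        (t.1.1, t.2.1.2.1, t.2.1.2.2.1, fun s =>
          if h : ∃ m, P t.2.1.1 (t.2.1.2.2.2 s) t.1.1 m then h.choose else t.2.1.2.2.2 s)) := by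
      rintro ⟨ζ, c, γ, w⟩ ⟨h1, _, h2, η, hη, v, hF, hw⟩
      refine ⟨(⟨ζ, h1⟩, ⟨(η, c, γ, v), hη, hF⟩), ?_⟩
      have : ∀ s, (if h : ∃ m, P η (v s) ζ m then h.choose else v s) = w s := by
        intro s
        have h : ∃ m, P η (v s) ζ m := ⟨w s, hw s⟩
        rw [dif_pos h]
        exact P_unique h.choose_spec (hw s)
      simp only [this]
    refine (mk_le_mk_of_subset hsub).trans (mk_range_le.trans ?_)
    rw [← mul_def]
    exact (mul_le_mul' hL hfacts).trans (mul_eq_self hI).le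
  · rintro η hη n χ m ⟨h1, h2, h3, q, hq, hqη, r, hr, hrχ, h4, h5⟩ hn hm
    have hqo : (η, n) ∈ O := ⟨h1, hn⟩
    have hro : (χ, m) ∈ O := ⟨h2, hm⟩
    have e1 := hname_old hq hqo h4.symm
    have e2 := hname_old (tO hq hr).1 hro h5.symm
    subst e1 e2
    rcases hr with rfl | hr
    · exact Or.inl rfl
    · exact Or.inr ((hZ q.1 h1).fresh hη hq.2 hr)

end Fill

/-! ### Adding one node and one colour -/

section Stage

variable [LinearOrder V]

/-- The part of a system that lives on the levels in `L`. -/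
def Sys.restrict (S : Sys V K I) (L : Set V) : Sys V K I :=
  ⟨fun η n χ m => η ∈ L ∧ S.P η n χ m, fun η c γ w => η ∈ L ∧ S.F η c γ w⟩

theorem Sys.Inv.restrict {S : Sys V K I} {x y : V → Set V} {L : Set V} (h : S.Inv x)
    (hxL : ∀ η ∈ L, x η ⊆ L) (hy : ∀ {η χ}, χ ∈ y η → χ < η) (hxy : ∀ η ∈ L, y η = x η) :
    (S.restrict L).Inv y := by
  have hPL : ∀ {η n χ m}, η ∈ L → S.P η n χ m → χ ∈ L := fun hη hP =>
    (h.P_dom hP).elim (fun h' => hxL _ hη h') (fun h' => h' ▸ hη)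
  refine ⟨hy, ?_, ?_, ?_, ?_, ?_, ?_, ?_, ?_, ?_, ?_, ?_⟩
  · rintro η n χ m ⟨hη, hP⟩
    rw [hxy η hη]; exact h.P_dom hP
  · rintro η n χ m ⟨hη, hP⟩
    exact ⟨hη, h.P_left hP⟩
  · rintro η n χ m ⟨hη, hP⟩
    exact ⟨hPL hη hP, h.P_right hP⟩
  · rintro η n χ ⟨hη, hP⟩ hχ
    rw [hxy η hη] at hχ
    obtain ⟨m, hm⟩ := h.P_ex hP hχ
    exact ⟨m, hη, hm⟩
  · rintro η n χ m m' ⟨hη, hP⟩ ⟨_, hP'⟩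
    exact h.P_unique hP hP'
  · rintro η n χ m χ' m' ⟨hη, hP⟩ ⟨_, hP'⟩ hlt
    exact ⟨hPL hη hP, h.P_comp hP hP' hlt⟩
  · rintro η c γ w ⟨hη, hF⟩
    rw [hxy η hη]; exact h.F_dom hF
  · rintro η c γ w ⟨hη, hF⟩ s
    exact ⟨hη, h.F_node hF s⟩
  · rintro η c γ w ⟨hη, hF⟩
    exact h.F_inj hF
  · rintro η c γ w χ ⟨hη, hF⟩ hχ hle
    rw [hxy η hη] at hχ
    obtain ⟨w', h1, h2⟩ := h.F_res hF hχ hle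
    exact ⟨w', ⟨hxL η hη hχ, h1⟩, fun s => ⟨hη, h2 s⟩⟩
  · rintro η c γ w w' ⟨hη, hF⟩ ⟨_, hF'⟩
    exact h.F_meet hF hF'

/-- `U` is a chain of nodes of the system. -/
structure Sys.IsBranchPart (S : Sys V K I) (U : Set (V × K)) : Prop where
  node : ∀ p ∈ U, S.N p.1 p.2
  uniq : ∀ p ∈ U, ∀ q ∈ U, p.1 = q.1 → p = q
  comp : ∀ p ∈ U, ∀ q ∈ U, q.1 < p.1 → S.P p.1 p.2 q.1 q.2

/-- Add a single node `u` at the level `t` with predecessors `U`. -/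
def Sys.addNode (S : Sys V K I) (t : V) (u : K) (U : Set (V × K)) : Sys V K I :=
  ⟨fun η n χ m => S.P η n χ m ∨ (η = t ∧ n = u ∧ ((χ, m) ∈ U ∨ χ = t ∧ m = u)), S.F⟩

/-- The level `t` is empty and unknown to all others, so declaring the levels of the chain to be all
that is known at `t` disturbs nothing. -/
theorem Sys.Inv.addNode [Nonempty I] {S : Sys V K I} {x : V → Set V} {t : V} {u : K} {U : Set (V × K)}
    (h : S.Inv x) (ht : ∀ n, ¬ S.N t n) (hx : ∀ η, η ≠ t → t ∉ x η) (hU : S.IsBranchPart U)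
    (hUt : ∀ p ∈ U, p.1 < t) :
    (S.addNode t u U).Inv (Function.update x t (Prod.fst '' U)) := by
  have hne : ∀ {η n χ m}, S.P η n χ m → η ≠ t ∧ χ ≠ t := by
    intro η n χ m hP
    exact ⟨fun he => ht n (he ▸ h.P_left hP), fun he => ht m (he ▸ h.P_right hP)⟩
  have hneF : ∀ {η c γ w}, S.F η c γ w → η ≠ t := by
    intro η c γ w hF he
    exact ht _ (he ▸ h.F_node hF (Classical.arbitrary I))
  have hN : ∀ {η n}, S.N η n → (S.addNode t u U).N η n := fun hP => Or.inl hP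
  have hNu : (S.addNode t u U).N t u := Or.inr ⟨rfl, rfl, Or.inr ⟨rfl, rfl⟩⟩
  refine ⟨?_, ?_, ?_, ?_, ?_, ?_, ?_, ?_, ?_, ?_, ?_, ?_⟩
  · intro η χ hχ
    rcases eq_or_ne η t with rfl | hη
    · rw [Function.update_self] at hχ
      obtain ⟨p, hp, rfl⟩ := hχ
      exact hUt p hp
    · rw [Function.update_of_ne hη] at hχ
      exact h.lt hχ
  · rintro η n χ m (hP | ⟨rfl, rfl, hP | ⟨rfl, rfl⟩⟩)
    · rw [Function.update_of_ne (hne hP).1]; exact h.P_dom hP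
    · rw [Function.update_self]; exact Or.inl ⟨_, hP, rfl⟩
    · exact Or.inr rfl
  · rintro η n χ m (hP | ⟨rfl, rfl, hP⟩)
    · exact hN (h.P_left hP)
    · exact hNu
  · rintro η n χ m (hP | ⟨rfl, rfl, hP | ⟨rfl, rfl⟩⟩)
    · exact hN (h.P_right hP)
    · exact hN (hU.node _ hP)
    · exact hNu
  · rintro η n χ (hP | ⟨rfl, rfl, hP⟩) hχ
    · rw [Function.update_of_ne (hne hP).1] at hχ
      obtain ⟨m, hm⟩ := h.P_ex hP hχ
      exact ⟨m, Or.inl hm⟩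
    · rw [Function.update_self] at hχ
      obtain ⟨p, hp, rfl⟩ := hχ
      exact ⟨p.2, Or.inr ⟨rfl, rfl, Or.inl hp⟩⟩
  · rintro η n χ m m' (hP | ⟨rfl, rfl, hP⟩) (hP' | ⟨he, hn, hP'⟩)
    · exact h.P_unique hP hP'
    · exact absurd he (hne hP).1
    · exact absurd rfl (hne hP').1
    · rcases hP with hP | ⟨rfl, rfl⟩
      · rcases hP' with hP' | ⟨rfl, rfl⟩
        · exact congrArg Prod.snd (hU.uniq _ hP _ hP' rfl)
        · exact absurd (hUt _ hP) (lt_irrefl _)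
      · rcases hP' with hP' | ⟨_, rfl⟩
        · exact absurd (hUt _ hP') (lt_irrefl _)
        · rfl
  · rintro η n χ m χ' m' (hP | ⟨rfl, rfl, hP⟩) (hP' | ⟨he, hn, hP'⟩) hlt
    · exact Or.inl (h.P_comp hP hP' hlt)
    · exact absurd he (hne hP).1
    · exact absurd rfl (hne hP').1
    · rcases hP with hP | ⟨rfl, rfl⟩
      · rcases hP' with hP' | ⟨rfl, rfl⟩
        · exact Or.inl (hU.comp _ hP _ hP' hlt)
        · exact absurd (hUt _ hP) hlt.not_gt
      · exact Or.inr ⟨rfl, rfl, hP'⟩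
  · intro η c γ w hF
    rw [Function.update_of_ne (hneF hF)]; exact h.F_dom hF
  · intro η c γ w hF s
    exact hN (h.F_node hF s)
  · intro η c γ w hF
    exact h.F_inj hF
  · intro η c γ w χ hF hχ hle
    rw [Function.update_of_ne (hneF hF)] at hχ
    obtain ⟨w', h1, h2⟩ := h.F_res hF hχ hle
    exact ⟨w', h1, fun s => Or.inl (h2 s)⟩
  · intro η c γ w w' hF hF'
    exact h.F_meet hF hF'

/-- Give the new colour `c` to all restrictions of the sequence `y` of nodes of level `t`. -/
def Sys.addFact (S : Sys V K I) (t : V) (c : K) (γ : V) (y : I → K) : Sys V K I :=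
  ⟨S.P, fun ζ c' γ' w => S.F ζ c' γ' w ∨ (c' = c ∧ γ' = γ ∧ γ ≤ ζ ∧ ∀ s, S.P t (y s) ζ (w s))⟩

/-- The colour being unused, `F_meet` only has to compare projections of the one sequence `y` to a
common level, and these are equal. -/
theorem Sys.Inv.addFact {S : Sys V K I} {L : Set V} {t : V} {c : K} {γ : V} {y a : I → K}
    (h : S.Inv (fun η => L ∩ Iio η)) (hc : ∀ {η γ w}, ¬ S.F η c γ w)
    (ha : Function.Injective a) (hγ : γ ∈ L) (hya : ∀ s, S.P t (y s) γ (a s)) :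
    (S.addFact t c γ y).Inv (fun η => L ∩ Iio η) := by
  have hcomp : ∀ {n χ m χ' m'}, S.P t n χ m → S.P t n χ' m' → χ' ≤ χ → S.P χ m χ' m' := by
    intro n χ m χ' m' h1 h2 hle
    rcases hle.lt_or_eq with hlt | rfl
    · exact h.P_comp h1 h2 hlt
    · rw [h.P_unique h1 h2]
      exact h.P_right h2
  refine ⟨h.lt, h.P_dom, h.P_left, h.P_right, h.P_ex, h.P_unique, h.P_comp, ?_, ?_, ?_, ?_, ?_⟩
  · rintro η c' γ' w (hF | ⟨rfl, rfl, hle, hw⟩)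
    · exact h.F_dom hF
    · rcases hle.lt_or_eq with hlt | rfl
      · exact Or.inl ⟨hγ, hlt⟩
      · exact Or.inr rfl
  · rintro η c' γ' w (hF | ⟨rfl, rfl, hle, hw⟩) s
    · exact h.F_node hF s
    · exact h.P_right (hw s)
  · rintro η c' γ' w (hF | ⟨rfl, rfl, hle, hw⟩)
    · exact h.F_inj hF
    · intro s s' hss
      have h1 := hcomp (hw s) (hya s) hle
      rw [hss] at h1
      exact ha (h.P_unique h1 (hcomp (hw s') (hya s') hle))
  · rintro η c' γ' w χ (hF | ⟨rfl, rfl, hle, hw⟩) hχ hγχ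
    · obtain ⟨w', h1, h2⟩ := h.F_res hF hχ hγχ
      exact ⟨w', Or.inl h1, h2⟩
    · choose w' hw' using fun s => h.P_ex (h.P_right (hw s)) hχ
      exact ⟨w', Or.inr ⟨rfl, rfl, hγχ, fun s => h.trans (hw s) (hw' s)⟩, hw'⟩
  · rintro η c' γ' w w' (hF | ⟨rfl, rfl, hle, hw⟩) (hF' | ⟨hc', hγ', hle', hw'⟩)
    · exact h.F_meet hF hF'
    · exact absurd (hc' ▸ hF) hc
    · exact absurd hF' hc
    · exact big_univ.mono (fun s _ => h.P_unique (hw s) (hw' s))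

/-- `Q` extends the part of `S` on `L` to a system in which all the predecessors are known, which
has a new node of level `t` over the chain `U`, and in which `y` has the colour `(c₀, γ₀)`. -/
structure Sys.IsStage (S : Sys V K I) (L : Set V) (t : V) (c₀ : K) (U : Set (V × K)) (γ₀ : V)
    (y : I → K) (Q : Sys V K I) : Prop where
  inv : Q.Inv (fun η => L ∩ Iio η)
  le_P : ∀ η ∈ L, ∀ n χ m, S.P η n χ m → Q.P η n χ m
  le_F : ∀ η ∈ L, ∀ c γ w, S.F η c γ w → Q.F η c γ w
  colour : ∀ η c γ w, Q.F η c γ w → η ∈ L ∧ (c = c₀ ∨ ∃ η' ∈ L, ∃ w', S.F η' c γ w')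
  nodes : #(Q.nodesOn L) ≤ #I
  facts : #(Q.factsOn L) ≤ #I
  branch : S.IsBranchPart U → (∀ p ∈ U, p.1 ∈ L ∧ p.1 < t) →
    ∃ u, Q.N t u ∧ ¬ S.N t u ∧ ∀ p ∈ U, Q.P t u p.1 p.2
  fact : ∀ a : I → K, Function.Injective a → γ₀ < t → (∀ s, S.P t (y s) γ₀ (a s)) →
    Q.F t c₀ γ₀ y

variable [WellFoundedLT V]

/-- A node put at `t` would need predecessors at all of `x t`, not only along the chain. It is
therefore put at an auxiliary level `t'` above `t` that knows the chain alone. After completion its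
predecessor at `t` is the wanted node, and `t'` is discarded. As `t'` carries no colours, the
freshness clause of `exists_completion` shows that this predecessor is not an old node. -/
theorem exists_stage (hI : ℵ₀ ≤ #I) (hK : #I < #K) {S : Sys V K I} {x : V → Set V} {L : Set V}
    (hS : S.Inv x) (hxL : ∀ η ∈ L, x η ⊆ L) (hL : #L ≤ #I) (hnodes : #(S.nodesOn L) ≤ #I)
    (hfacts : #(S.factsOn L) ≤ #I) (hanch : ∀ η ∈ L, Anchored S x L η) {t t' : V}
    (ht : t ∈ L) (hLt : ∀ η ∈ L, η ≤ t) (htt' : t < t') (c₀ : K)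
    (hc₀ : ∀ η ∈ L, ∀ γ w, ¬ S.F η c₀ γ w) (U : Set (V × K)) (γ₀ : V) (y : I → K) :
    ∃ Q, S.IsStage L t c₀ U γ₀ y Q := by
  classical
  have hIne : Nonempty I := by
    rw [← mk_ne_zero_iff]; exact (lt_of_lt_of_le aleph0_pos hI).ne'
  have hKne : Nonempty K := by
    rw [← mk_ne_zero_iff]; exact (lt_of_lt_of_le aleph0_pos (hI.trans hK.le)).ne'
  have hL' : ∀ η ∈ L, η ≠ t' := fun η hη => ((hLt η hη).trans_lt htt').ne
  have ht'L : t' ∉ L := fun h => hL' _ h rfl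
  obtain ⟨u₀⟩ := hKne
  -- the chain, made trivial if it is not one
  obtain ⟨W, hW, hWt, hUW⟩ : ∃ W : Set (V × K), S.IsBranchPart W ∧ (∀ p ∈ W, p.1 ∈ L ∧ p.1 < t) ∧
      (S.IsBranchPart U → (∀ p ∈ U, p.1 ∈ L ∧ p.1 < t) → U = W) := by
    by_cases h : S.IsBranchPart U ∧ ∀ p ∈ U, p.1 ∈ L ∧ p.1 < t
    · exact ⟨U, h.1, h.2, fun _ _ => rfl⟩
    · exact ⟨∅, ⟨by simp, by simp, by simp⟩, by simp, fun h1 h2 => absurd ⟨h1, h2⟩ h⟩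
  let x₁ : V → Set V := fun η => if η ∈ L then x η else ∅
  have hx₁ : ∀ η ∈ L, x₁ η = x η := fun η hη => if_pos hη
  have hS₁ : (S.restrict L).Inv x₁ := hS.restrict hxL (fun {η χ} hχ => by
    by_cases hη : η ∈ L
    · rw [hx₁ η hη] at hχ; exact hS.lt hχ
    · simp [x₁, hη] at hχ) hx₁
  have hW₁ : (S.restrict L).IsBranchPart W := ⟨fun p hp => ⟨(hWt p hp).1, hW.node p hp⟩, hW.uniq,
    fun p hp q hq hlt => ⟨(hWt p hp).1, hW.comp p hp q hq hlt⟩⟩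
  have hS₂ := hS₁.addNode (t := t') (u := u₀) (U := W) (fun n hn => ht'L hn.1) (fun η _ hmem => by
      by_cases hη : η ∈ L
      · rw [hx₁ η hη] at hmem; exact ht'L (hxL η hη hmem)
      · simp [x₁, hη] at hmem) hW₁ (fun p hp => (hWt p hp).2.trans htt')
  set S₂ := (S.restrict L).addNode t' u₀ W with hS₂def
  set x₂ := Function.update x₁ t' (Prod.fst '' W) with hx₂def
  have hx₂ : ∀ η ∈ L, x₂ η = x η := fun η hη => by
    rw [hx₂def, Function.update_of_ne (hL' η hη), hx₁ η hη]
  have hx₂t : x₂ t' = Prod.fst '' W := Function.update_self ..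
  have hP₂ : ∀ {η n χ m}, η ∈ L → (S₂.P η n χ m ↔ S.P η n χ m) := by
    intro η n χ m hη
    constructor
    · rintro (h | ⟨rfl, _⟩)
      · exact h.2
      · exact absurd hη ht'L
    · exact fun h => Or.inl ⟨hη, h⟩
  have hF₂ : ∀ {η c γ w}, S₂.F η c γ w ↔ η ∈ L ∧ S.F η c γ w := Iff.rfl
  have hnoF : ∀ c γ w, S₂.F t' c γ w → γ = t' := fun c γ w h => absurd h.1 ht'L
  have hu₀ : S₂.N t' u₀ := Or.inr ⟨rfl, rfl, Or.inr ⟨rfl, rfl⟩⟩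
  obtain ⟨Q₂, hQ₂, hQP, hQF, hQsP, hQsF, hQn, hQf, hfresh⟩ :=
    exists_completion (L := insert t' L) hI hK hS₂ (by
      rintro η (rfl | hη)
      · rw [hx₂t]
        rintro _ ⟨p, hp, rfl⟩
        exact Or.inr (hWt p hp).1
      · rw [hx₂ η hη]
        exact fun χ hχ => Or.inr (hxL η hη hχ))
    (mk_insert_le.trans (add_le_of_le hI hL (one_le_aleph0.trans hI)))
    (by
      have : S₂.nodesOn (insert t' L) ⊆ insert (t', u₀) (S.nodesOn L) := by
        rintro ⟨η, n⟩ ⟨hη, hn⟩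
        rcases hn with hn | ⟨rfl, rfl, _⟩
        · exact Or.inr hn
        · exact Or.inl rfl
      exact (mk_le_mk_of_subset this).trans
        (mk_insert_le.trans (add_le_of_le hI hnodes (one_le_aleph0.trans hI))))
    (by
      have : S₂.factsOn (insert t' L) ⊆ S.factsOn L := fun f hf => hf.2
      exact (mk_le_mk_of_subset this).trans hfacts)
    (by
      rintro η (rfl | hη)
      · exact Or.inr (Or.inl hnoF)
      · rcases hanch η hη with h | h | ⟨η', hη'L, hη', h1, a, h2, h3, h4, h5⟩
        · left
          rw [hx₂ η hη]
          rintro ζ (rfl | hζ) hlt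
          · exact absurd hlt ((hLt η hη).trans htt'.le).not_gt
          · exact h ζ hζ hlt
        · right; left
          exact fun c γ w hF => h c γ w hF.2
        · right; right
          refine ⟨η', Or.inr hη'L, hη', by rwa [hx₂ η hη], a, ?_, ?_, ?_, ?_⟩
          · exact fun n hn => (hP₂ hη'L).2 (h2 n ((hP₂ hη).1 hn))
          · exact fun n χ m hP hlt => (hP₂ hη'L).2 (h3 n χ m ((hP₂ hη).1 hP) hlt)
          · exact fun n m hP => h4 n m ((hP₂ hη).1 hP)
          · exact fun c γ w hF hne =>
              ⟨(h5 c γ w hF.2 hne).1, hη'L, (h5 c γ w hF.2 hne).2⟩)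
  have hQ₁ : (Q₂.restrict L).Inv (fun η => L ∩ Iio η) := by
    refine hQ₂.restrict (fun η hη χ hχ => ?_) (fun h => h.2) (fun η hη => ?_)
    · exact hχ.1.resolve_left (fun he => by
        rw [he] at hχ
        exact absurd (hχ.2.trans_le (hLt η hη)) htt'.not_gt)
    · ext χ
      constructor
      · exact fun h => ⟨Or.inr h.1, h.2⟩
      · rintro ⟨rfl | h, hlt⟩
        · exact absurd (lt_of_lt_of_le hlt (hLt η hη)) htt'.not_gt
        · exact ⟨h, hlt⟩
  set Q₁ := Q₂.restrict L with hQ₁def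
  have hQ₁P : ∀ η ∈ L, ∀ n χ m, S.P η n χ m → Q₁.P η n χ m := fun η hη n χ m h =>
    ⟨hη, hQP η (Or.inr hη) _ _ _ ((hP₂ hη).2 h)⟩
  have hQ₁F : ∀ η ∈ L, ∀ c γ w, S.F η c γ w → Q₁.F η c γ w := fun η hη c γ w h =>
    ⟨hη, hQF η (Or.inr hη) _ _ _ ⟨hη, h⟩⟩
  have hQ₁col : ∀ {η c γ w}, Q₁.F η c γ w → η ∈ L ∧ ∃ η' ∈ L, ∃ w', S.F η' c γ w' := by
    rintro η c γ w ⟨hη, h⟩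
    obtain ⟨_, η', _, w', hw'⟩ := hQsF _ _ _ _ h
    exact ⟨hη, η', hw'.1, w', hw'.2⟩
  have hQ₁n : #(Q₁.nodesOn L) ≤ #I := by
    refine (mk_le_mk_of_subset ?_).trans hQn
    exact fun p hp => ⟨Or.inr hp.1, hp.2.2⟩
  have hQ₁f : #(Q₁.factsOn L) ≤ #I := by
    refine (mk_le_mk_of_subset ?_).trans hQf
    exact fun p hp => ⟨Or.inr hp.1, hp.2.2⟩
  have hQ₁U : S.IsBranchPart U → (∀ p ∈ U, p.1 ∈ L ∧ p.1 < t) →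
      ∃ u, Q₁.N t u ∧ ¬ S.N t u ∧ ∀ p ∈ U, Q₁.P t u p.1 p.2 := by
    intro hU hUt
    obtain rfl := hUW hU hUt
    have hu := hQP t' (Or.inl rfl) _ _ _ hu₀
    obtain ⟨u, hu1⟩ := hQ₂.P_ex hu (χ := t) ⟨Or.inr ht, htt'⟩
    refine ⟨u, ⟨ht, hQ₂.P_right hu1⟩, fun hold => ?_, fun p hp => ⟨ht, ?_⟩⟩
    · rcases hfresh t' hnoF u₀ t u hu1 hu₀ ((hP₂ ht).2 hold) with h | ⟨ζ, hζ, hle⟩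
      · exact htt'.ne h
      · rw [hx₂t] at hζ
        obtain ⟨p, hp, rfl⟩ := hζ
        exact absurd (hUt p hp).2 hle.not_gt
    · have h1 : Q₂.P t' u₀ p.1 p.2 := hQP t' (Or.inl rfl) _ _ _ (Or.inr ⟨rfl, rfl, Or.inl hp⟩)
      exact hQ₂.P_comp hu1 h1 (hUt p hp).2
  -- The colour comes after the completion, when the nodes of `y` have predecessors at every lower
  -- level in `L`, so that all the required projections exist.
  by_cases hy : ∃ a : I → K, Function.Injective a ∧ γ₀ < t ∧ ∀ s, S.P t (y s) γ₀ (a s)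
  · obtain ⟨a, ha, hγt, hya⟩ := hy
    have hγL : γ₀ ∈ L := by
      rcases hS.P_dom (hya hIne.some) with h | h
      · exact hxL t ht h
      · exact absurd h hγt.ne
    have hya' : ∀ s, Q₁.P t (y s) γ₀ (a s) := fun s => hQ₁P t ht _ _ _ (hya s)
    have hζL : ∀ {n ζ m}, Q₁.P t n ζ m → ζ ∈ L := fun h =>
      (hQ₁.P_dom h).elim (fun h' => h'.1) (fun h' => h' ▸ ht)
    refine ⟨Q₁.addFact t c₀ γ₀ y, hQ₁.addFact (fun {η γ w} hF => ?_) ha hγL hya', hQ₁P,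
      fun η hη c γ w h => Or.inl (hQ₁F η hη c γ w h), ?_, hQ₁n, ?_, hQ₁U, ?_⟩
    · obtain ⟨_, η', hη', w', hw'⟩ := hQ₁col hF
      exact hc₀ η' hη' γ w' hw'
    · rintro η c γ w (h | ⟨rfl, rfl, hle, hw⟩)
      · exact ⟨(hQ₁col h).1, Or.inr (hQ₁col h).2⟩
      · exact ⟨hζL (hw hIne.some), Or.inl rfl⟩
    · let A : Set (V × K × V × (I → K)) :=
        {f | f.1 ∈ L ∧ f.2.1 = c₀ ∧ f.2.2.1 = γ₀ ∧ ∀ s, Q₁.P t (y s) f.1 (f.2.2.2 s)}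
      have hA : #A ≤ #I := by
        have hinj : InjOn Prod.fst A := by
          rintro ⟨ζ, c, γ, w⟩ ⟨h1, h2, h3, h4⟩ ⟨ζ', c', γ', w'⟩ ⟨h1', h2', h3', h4'⟩ he
          simp only at h1 h2 h3 h4 h1' h2' h3' h4' he
          subst h2 h3 h2' h3' he
          rw [show w = w' from funext fun s => hQ₁.P_unique (h4 s) (h4' s)]
        rw [← mk_image_eq_of_injOn _ _ hinj]
        refine (mk_le_mk_of_subset ?_).trans hL
        rintro _ ⟨f, hf, rfl⟩
        exact hf.1
      have hsub : (Q₁.addFact t c₀ γ₀ y).factsOn L ⊆ Q₁.factsOn L ∪ A := by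
        rintro f ⟨h1, h | ⟨h2, h3, h4, h5⟩⟩
        · exact Or.inl ⟨h1, h⟩
        · exact Or.inr ⟨h1, h2, h3, h5⟩
      exact (mk_le_mk_of_subset hsub).trans ((mk_union_le _ _).trans (add_le_of_le hI hQ₁f hA))
    · exact fun b hb _ _ => Or.inr ⟨rfl, rfl, hγt.le, fun s => hQ₁.P_left (hya' s)⟩
  · exact ⟨Q₁, hQ₁, hQ₁P, hQ₁F,
      fun η c γ w h => ⟨(hQ₁col h).1, Or.inr (hQ₁col h).2⟩, hQ₁n, hQ₁f, hQ₁U,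
      fun a ha hγt hya => absurd ⟨a, ha, hγt, hya⟩ hy⟩

end Stage

/-! ### Copying an extension to all places that look alike -/

section Transport

/-- The system `S` looks the same at `η` and at `η'`. -/
structure Sys.Agree (S : Sys V K I) (η η' : V) : Prop where
  P_iff : ∀ {n χ m}, χ ≠ η → χ ≠ η' → (S.P η n χ m ↔ S.P η' n χ m)
  N_iff : ∀ {n m}, S.P η n η m ↔ S.P η' n η' m
  F_iff : ∀ {c γ w}, γ ≠ η → γ ≠ η' → (S.F η c γ w ↔ S.F η' c γ w)
  G_iff : ∀ {c w}, S.F η c η w ↔ S.F η' c η' w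

theorem Sys.Agree.symm {S : Sys V K I} {η η' : V} (h : S.Agree η η') : S.Agree η' η :=
  ⟨fun h1 h2 => (h.P_iff h2 h1).symm, h.N_iff.symm, fun h1 h2 => (h.F_iff h2 h1).symm,
    h.G_iff.symm⟩

variable [LinearOrder V]

/-- A coherent assignment of sets of smaller elements. -/
structure IsCoherent (D : V → Set V) : Prop where
  lt : ∀ {η χ}, χ ∈ D η → χ < η
  coh : ∀ {η χ}, χ ∈ D η → D χ = D η ∩ Iio χ

/-- The elements of `D η` together with `η` itself. -/
def lower (D : V → Set V) (η : V) : Set V := insert η (D η)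

theorem IsCoherent.le {D : V → Set V} (h : IsCoherent D) {η χ} (hχ : χ ∈ lower D η) : χ ≤ η :=
  hχ.elim (fun e => e.le) (fun h' => (h.lt h').le)

theorem IsCoherent.mem {D : V → Set V} (h : IsCoherent D) {η χ ξ} (hχ : χ ∈ lower D η)
    (hξ : ξ ∈ lower D η) (hlt : ξ < χ) : ξ ∈ D χ := by
  rcases hχ with rfl | hχ
  · exact hξ.resolve_left hlt.ne
  · rw [h.coh hχ]
    exact ⟨hξ.resolve_left (hlt.trans (h.lt hχ)).ne, hlt⟩

theorem IsCoherent.mem_lower {D : V → Set V} (h : IsCoherent D) {η χ ξ} (hχ : χ ∈ lower D η)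
    (hξ : ξ ∈ lower D η) (hle : ξ ≤ χ) : ξ ∈ lower D χ :=
  hle.lt_or_eq.elim (fun hlt => Or.inr (h.mem hχ hξ hlt)) Or.inl

theorem IsCoherent.trans {D : V → Set V} (h : IsCoherent D) {η χ ξ} (hχ : χ ∈ D η) (hξ : ξ ∈ D χ) :
    ξ ∈ D η := by
  rw [h.coh hχ] at hξ; exact hξ.1

theorem IsCoherent.lower_subset {D : V → Set V} (h : IsCoherent D) {η χ} (hχ : χ ∈ lower D η) :
    lower D χ ⊆ lower D η := by
  rcases hχ with rfl | hχ
  · exact Subset.rfl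
  · rintro ξ (rfl | hξ)
    · exact Or.inr hχ
    · exact Or.inr (h.trans hχ hξ)

variable [WellFoundedLT V]

theorem acc_mem (D : V → Set V) (χ : V) : Acc (fun a b => a ∈ D b ∧ a < b) χ :=
  (Subrelation.wf (fun {_ _} h => h.2) (wellFounded_lt (α := V))).apply χ

/-- The rank of `χ` with respect to membership in the values of `D`. -/
noncomputable def rk (D : V → Set V) (χ : V) : Ordinal.{u} := (acc_mem D χ).rank

theorem IsCoherent.rk_lt {D : V → Set V} (h : IsCoherent D) {η χ} (hχ : χ ∈ D η) :
    rk D χ < rk D η :=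
  Acc.rank_lt_of_rel (acc_mem D η) ⟨hχ, h.lt hχ⟩

theorem lt_rk_iff {D : V → Set V} (h : IsCoherent D) {η : V} {o : Ordinal.{u}} :
    o < rk D η ↔ ∃ χ ∈ D η, o ≤ rk D χ := by
  rw [rk, Acc.rank_eq, Ordinal.lt_iSup_iff]
  constructor
  · rintro ⟨⟨χ, hχ⟩, ho⟩
    exact ⟨χ, hχ.1, lt_succ_iff.1 ho⟩
  · rintro ⟨χ, hχ, ho⟩
    exact ⟨⟨χ, hχ, h.lt hχ⟩, lt_succ_iff.2 ho⟩

/-- Coherence makes membership in the values of `D` transitive, so no rank is skipped and the rank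
measures the order type of `D η`. -/
theorem IsCoherent.exists_rk_eq {D : V → Set V} (h : IsCoherent D) {η : V} {o : Ordinal.{u}}
    (ho : o < rk D η) : ∃ χ ∈ D η, rk D χ = o := by
  induction η using WellFoundedLT.induction with
  | ind η ih =>
    obtain ⟨χ, hχ, hle⟩ := (lt_rk_iff h).1 ho
    rcases hle.lt_or_eq with hlt | he
    · obtain ⟨ξ, hξ, he⟩ := ih χ (h.lt hχ) hlt
      exact ⟨ξ, h.trans hχ hξ, he⟩
    · exact ⟨χ, hχ, he.symm⟩

theorem rk_congr {D : V → Set V} (h : IsCoherent D) {η η' : V} (he : D η = D η') :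
    rk D η = rk D η' :=
  eq_of_forall_lt_iff (fun o => by rw [lt_rk_iff h, lt_rk_iff h, he])

theorem IsCoherent.rk_inj {D : V → Set V} (h : IsCoherent D) {t ξ ξ' : V} (hξ : ξ ∈ lower D t)
    (hξ' : ξ' ∈ lower D t) (he : rk D ξ = rk D ξ') : ξ = ξ' := by
  rcases lt_trichotomy ξ ξ' with hlt | rfl | hlt
  · exact absurd he (h.rk_lt (h.mem hξ' hξ hlt)).ne
  · rfl
  · exact absurd he (h.rk_lt (h.mem hξ hξ' hlt)).ne'

theorem IsCoherent.lt_of_rk_lt {D : V → Set V} (h : IsCoherent D) {t ξ ξ' : V} (hξ : ξ ∈ lower D t)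
    (hξ' : ξ' ∈ lower D t) (he : rk D ξ < rk D ξ') : ξ < ξ' := by
  by_contra hcon
  rcases (not_lt.1 hcon).lt_or_eq with hlt | rfl
  · exact absurd he (h.rk_lt (h.mem hξ hξ' hlt)).not_gt
  · exact absurd he (lt_irrefl _)

open Classical in
/-- The element of `lower D t` of the same rank as `χ`, if there is one. -/
noncomputable def twin (D : V → Set V) (t χ : V) : V :=
  if h : ∃ ξ ∈ lower D t, rk D ξ = rk D χ then h.choose else t

theorem twin_spec {D : V → Set V} {t χ : V} (h : ∃ ξ ∈ lower D t, rk D ξ = rk D χ) :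
    twin D t χ ∈ lower D t ∧ rk D (twin D t χ) = rk D χ := by
  rw [twin, dif_pos h]; exact h.choose_spec

theorem twin_eq {D : V → Set V} (hD : IsCoherent D) {t χ ξ : V} (hξ : ξ ∈ lower D t)
    (h : rk D ξ = rk D χ) : twin D t χ = ξ :=
  have hs := twin_spec ⟨ξ, hξ, h⟩
  hD.rk_inj hs.1 hξ (hs.2.trans h.symm)

/-- The part of the system `S` below `ζ` looks like a part of `S` below `t`. -/
def Good (D : V → Set V) (t : V) (S : Sys V K I) (ζ : V) : Prop :=
  ∀ χ ∈ lower D ζ, (∃ ξ ∈ lower D t, rk D ξ = rk D χ) ∧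
    (∀ χ' ∈ lower D χ, ∀ n m, S.P χ n χ' m ↔ S.P (twin D t χ) n (twin D t χ') m) ∧
    (∀ γ ∈ lower D χ, ∀ c w, S.F χ c γ w ↔ S.F (twin D t χ) c (twin D t γ) w)

/-- Copy the part of `Q` below `t` to all the good places. -/
def Sys.pull (S : Sys V K I) (D : V → Set V) (t : V) (Q : Sys V K I) : Sys V K I :=
  ⟨fun ζ n χ m => Good D t S ζ ∧ χ ∈ lower D ζ ∧ Q.P (twin D t ζ) n (twin D t χ) m,
   fun ζ c γ w => Good D t S ζ ∧ γ ∈ lower D ζ ∧ Q.F (twin D t ζ) c (twin D t γ) w⟩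

/-- The union of two systems. -/
def Sys.sup (S Q : Sys V K I) : Sys V K I :=
  ⟨fun ζ n χ m => S.P ζ n χ m ∨ Q.P ζ n χ m, fun ζ c γ w => S.F ζ c γ w ∨ Q.F ζ c γ w⟩

section Good

variable {D : V → Set V} {t : V} {S Q : Sys V K I}

theorem Good.down (hD : IsCoherent D) {ζ χ} (h : Good D t S ζ) (hχ : χ ∈ lower D ζ) :
    Good D t S χ :=
  fun ξ hξ => h ξ (hD.lower_subset hχ hξ)

theorem Good.twin_mem {ζ χ} (h : Good D t S ζ) (hχ : χ ∈ lower D ζ) :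
    twin D t χ ∈ lower D t :=
  (twin_spec (h χ hχ).1).1

theorem Good.twin_lt (hD : IsCoherent D) {ζ χ χ'} (h : Good D t S ζ) (hχ : χ ∈ lower D ζ)
    (hχ' : χ' ∈ lower D ζ) (hlt : χ' < χ) : twin D t χ' < twin D t χ := by
  have h1 := twin_spec (h χ hχ).1
  have h2 := twin_spec (h χ' hχ').1
  refine hD.lt_of_rk_lt h2.1 h1.1 ?_
  rw [h1.2, h2.2]
  exact hD.rk_lt (hD.mem hχ hχ' hlt)

theorem Good.twin_le (hD : IsCoherent D) {ζ χ χ'} (h : Good D t S ζ) (hχ : χ ∈ lower D ζ)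
    (hχ' : χ' ∈ lower D ζ) (hle : χ' ≤ χ) : twin D t χ' ≤ twin D t χ := by
  rcases hle.lt_or_eq with hlt | rfl
  · exact (h.twin_lt hD hχ hχ' hlt).le
  · rfl

theorem Good.twin_inj (hD : IsCoherent D) {ζ χ χ'} (h : Good D t S ζ) (hχ : χ ∈ lower D ζ)
    (hχ' : χ' ∈ lower D ζ) (he : twin D t χ = twin D t χ') : χ = χ' := by
  rcases lt_trichotomy χ χ' with hlt | rfl | hlt
  · exact absurd he (h.twin_lt hD hχ' hχ hlt).ne
  · rfl
  · exact absurd he (h.twin_lt hD hχ hχ' hlt).ne'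

variable {x : V → Set V} {c₀ : K} {U : Set (V × K)} {γ₀ : V} {y : I → K}

/-- At a good place the old relations copy those of `S` at the twin, which `Q` extends; so the union
there is exactly the copy of `Q`. -/
theorem sup_pull_P (hS : S.Inv x) (hx : ∀ η, x η ⊆ D η)
    (hQ : S.IsStage (lower D t) t c₀ U γ₀ y Q) {η n χ m} (hg : Good D t S η) :
    (S.sup (S.pull D t Q)).P η n χ m ↔ χ ∈ lower D η ∧ Q.P (twin D t η) n (twin D t χ) m := by
  constructor
  · rintro (h | h)
    · have hχ : χ ∈ lower D η := (hS.P_dom h).elim (fun h' => Or.inr (hx η h')) Or.inl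
      refine ⟨hχ, hQ.le_P _ (hg.twin_mem (Or.inl rfl)) _ _ _ ?_⟩
      exact ((hg η (Or.inl rfl)).2.1 χ hχ n m).1 h
    · exact h.2
  · exact fun h => Or.inr ⟨hg, h⟩

theorem sup_pull_F (hS : S.Inv x) (hx : ∀ η, x η ⊆ D η)
    (hQ : S.IsStage (lower D t) t c₀ U γ₀ y Q) {η c γ w} (hg : Good D t S η) :
    (S.sup (S.pull D t Q)).F η c γ w ↔ γ ∈ lower D η ∧ Q.F (twin D t η) c (twin D t γ) w := by
  constructor
  · rintro (h | h)
    · have hχ : γ ∈ lower D η := (hS.F_dom h).elim (fun h' => Or.inr (hx η h')) Or.inl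
      refine ⟨hχ, hQ.le_F _ (hg.twin_mem (Or.inl rfl)) _ _ _ ?_⟩
      exact ((hg η (Or.inl rfl)).2.2 γ hχ c w).1 h
    · exact h.2
  · exact fun h => Or.inr ⟨hg, h⟩

theorem sup_pull_P_not {η n χ m} (hg : ¬ Good D t S η) :
    (S.sup (S.pull D t Q)).P η n χ m ↔ S.P η n χ m :=
  ⟨fun h => h.resolve_right (fun h' => hg h'.1), Or.inl⟩

theorem sup_pull_F_not {η c γ w} (hg : ¬ Good D t S η) :
    (S.sup (S.pull D t Q)).F η c γ w ↔ S.F η c γ w :=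
  ⟨fun h => h.resolve_right (fun h' => hg h'.1), Or.inl⟩

/-- Goodness passes down along `lower D`. At a good place each clause is that of `Q` read through
the order-preserving twin map. At any other place it is that of `S`, whose relations survive even
when they lead to a good place. -/
theorem Sys.Inv.sup_pull (hD : IsCoherent D) (hS : S.Inv x) (hx : ∀ η, x η ⊆ D η)
    (hQ : S.IsStage (lower D t) t c₀ U γ₀ y Q) {x' : V → Set V}
    (hx' : ∀ η, Good D t S η → x' η = D η) (hx'' : ∀ η, ¬ Good D t S η → x' η = x η) :
    (S.sup (S.pull D t Q)).Inv x' := by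
  set R := S.sup (S.pull D t Q) with hR
  have gP : ∀ {η n χ m}, Good D t S η →
      (R.P η n χ m ↔ χ ∈ lower D η ∧ Q.P (twin D t η) n (twin D t χ) m) :=
    fun hg => sup_pull_P hS hx hQ hg
  have gF : ∀ {η c γ w}, Good D t S η →
      (R.F η c γ w ↔ γ ∈ lower D η ∧ Q.F (twin D t η) c (twin D t γ) w) :=
    fun hg => sup_pull_F hS hx hQ hg
  have nP : ∀ {η n χ m}, ¬ Good D t S η → (R.P η n χ m ↔ S.P η n χ m) := sup_pull_P_not
  have nF : ∀ {η c γ w}, ¬ Good D t S η → (R.F η c γ w ↔ S.F η c γ w) := sup_pull_F_not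
  have gN : ∀ {η n}, Good D t S η → (R.N η n ↔ Q.N (twin D t η) n) := fun hg =>
    (gP hg).trans ⟨fun h => h.2, fun h => ⟨Or.inl rfl, h⟩⟩
  have low : ∀ {η}, η ∈ lower D η := Or.inl rfl
  have up : ∀ {η χ}, χ ∈ D η → χ ∈ lower D η := Or.inr
  have lP : ∀ {η n χ m}, S.P η n χ m → R.P η n χ m := Or.inl
  have lF : ∀ {η c γ w}, S.F η c γ w → R.F η c γ w := Or.inl
  refine ⟨?_, ?_, ?_, ?_, ?_, ?_, ?_, ?_, ?_, ?_, ?_, ?_⟩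
  · intro η χ hχ
    by_cases hg : Good D t S η
    · rw [hx' η hg] at hχ; exact hD.lt hχ
    · rw [hx'' η hg] at hχ; exact hS.lt hχ
  · intro η n χ m h
    by_cases hg : Good D t S η
    · rw [hx' η hg]; exact ((gP hg).1 h).1.symm
    · rw [hx'' η hg]; exact hS.P_dom ((nP hg).1 h)
  · intro η n χ m h
    by_cases hg : Good D t S η
    · exact (gN hg).2 (hQ.inv.P_left ((gP hg).1 h).2)
    · exact lP (hS.P_left ((nP hg).1 h))
  · intro η n χ m h
    by_cases hg : Good D t S η
    · obtain ⟨h1, h2⟩ := (gP hg).1 h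
      exact (gN (hg.down hD h1)).2 (hQ.inv.P_right h2)
    · exact lP (hS.P_right ((nP hg).1 h))
  · intro η n χ h hχ
    by_cases hg : Good D t S η
    · rw [hx' η hg] at hχ
      obtain ⟨m, hm⟩ := hQ.inv.P_ex ((gN hg).1 h) (χ := twin D t χ)
        ⟨hg.twin_mem (up hχ), hg.twin_lt hD low (up hχ) (hD.lt hχ)⟩
      exact ⟨m, (gP hg).2 ⟨up hχ, hm⟩⟩
    · rw [hx'' η hg] at hχ
      obtain ⟨m, hm⟩ := hS.P_ex ((nP hg).1 h) hχ
      exact ⟨m, lP hm⟩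
  · intro η n χ m m' h h'
    by_cases hg : Good D t S η
    · exact hQ.inv.P_unique ((gP hg).1 h).2 ((gP hg).1 h').2
    · exact hS.P_unique ((nP hg).1 h) ((nP hg).1 h')
  · intro η n χ m χ' m' h h' hlt
    by_cases hg : Good D t S η
    · obtain ⟨h1, h2⟩ := (gP hg).1 h
      obtain ⟨h1', h2'⟩ := (gP hg).1 h'
      exact (gP (hg.down hD h1)).2 ⟨up (hD.mem h1 h1' hlt),
        hQ.inv.P_comp h2 h2' (hg.twin_lt hD h1 h1' hlt)⟩
    · exact lP (hS.P_comp ((nP hg).1 h) ((nP hg).1 h') hlt)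
  · intro η c γ w h
    by_cases hg : Good D t S η
    · rw [hx' η hg]; exact ((gF hg).1 h).1.symm
    · rw [hx'' η hg]; exact hS.F_dom ((nF hg).1 h)
  · intro η c γ w h s
    by_cases hg : Good D t S η
    · exact (gN hg).2 (hQ.inv.F_node ((gF hg).1 h).2 s)
    · exact lP (hS.F_node ((nF hg).1 h) s)
  · intro η c γ w h
    by_cases hg : Good D t S η
    · exact hQ.inv.F_inj ((gF hg).1 h).2
    · exact hS.F_inj ((nF hg).1 h)
  · intro η c γ w χ h hχ hle
    by_cases hg : Good D t S η
    · rw [hx' η hg] at hχ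
      obtain ⟨h1, h2⟩ := (gF hg).1 h
      obtain ⟨w', h3, h4⟩ := hQ.inv.F_res h2 (χ := twin D t χ)
        ⟨hg.twin_mem (up hχ), hg.twin_lt hD low (up hχ) (hD.lt hχ)⟩
        (hg.twin_le hD (up hχ) h1 hle)
      exact ⟨w', (gF (hg.down hD (up hχ))).2 ⟨hD.mem_lower (up hχ) h1 hle, h3⟩,
        fun s => (gP hg).2 ⟨up hχ, h4 s⟩⟩
    · rw [hx'' η hg] at hχ
      obtain ⟨w', h3, h4⟩ := hS.F_res ((nF hg).1 h) hχ hle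
      exact ⟨w', lF h3, fun s => lP (h4 s)⟩
  · intro η c γ w w' h h'
    by_cases hg : Good D t S η
    · exact hQ.inv.F_meet ((gF hg).1 h).2 ((gF hg).1 h').2
    · exact hS.F_meet ((nF hg).1 h) ((nF hg).1 h')

/-- The nodes of level `η`. -/
def Sys.nodesAt (S : Sys V K I) (η : V) : Set K := {n | S.N η n}

/-- The facts at level `η`. -/
def Sys.factsAt (S : Sys V K I) (η : V) : Set (K × V × (I → K)) := {f | S.F η f.1 f.2.1 f.2.2}

theorem mk_nodesAt_pull (hQ : S.IsStage (lower D t) t c₀ U γ₀ y Q) (η : V) :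
    #((S.pull D t Q).nodesAt η) ≤ #I := by
  refine le_trans ?_ hQ.nodes
  refine mk_le_of_injective (f := fun n : (S.pull D t Q).nodesAt η =>
    (⟨(twin D t η, n.1), n.2.1.twin_mem (Or.inl rfl), n.2.2.2⟩ : Q.nodesOn (lower D t))) ?_
  intro n n' h
  exact Subtype.ext (Prod.ext_iff.1 (congrArg Subtype.val h)).2

theorem mk_factsAt_pull (hD : IsCoherent D) (hQ : S.IsStage (lower D t) t c₀ U γ₀ y Q) (η : V) :
    #((S.pull D t Q).factsAt η) ≤ #I := by
  refine le_trans ?_ hQ.facts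
  refine mk_le_of_injective (f := fun f : (S.pull D t Q).factsAt η =>
    (⟨(twin D t η, f.1.1, twin D t f.1.2.1, f.1.2.2), f.2.1.twin_mem (Or.inl rfl), f.2.2.2⟩ :
      Q.factsOn (lower D t))) ?_
  rintro ⟨⟨c, γ, w⟩, hf⟩ ⟨⟨c', γ', w'⟩, hf'⟩ h
  have h1 := congrArg Subtype.val h
  simp only [Prod.mk.injEq, true_and] at h1
  obtain ⟨rfl, h2, rfl⟩ := h1
  obtain rfl := hf.1.twin_inj hD hf.2.1 hf'.2.1 h2
  rfl

theorem colour_pull (hQ : S.IsStage (lower D t) t c₀ U γ₀ y Q) {η c γ w}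
    (h : (S.pull D t Q).F η c γ w) : c = c₀ ∨ ∃ η' γ' w', S.F η' c γ' w' := by
  rcases (hQ.colour _ _ _ _ h.2.2).2 with h | ⟨η', _, w', h⟩
  · exact Or.inl h
  · exact Or.inr ⟨η', _, w', h⟩

theorem twin_congr (hD : IsCoherent D) {η η' : V} (he : D η = D η') :
    twin D t η = twin D t η' := by
  unfold twin
  rw [rk_congr hD he]

theorem Sys.Agree.good (hD : IsCoherent D) {η η' : V} (he : D η = D η') (h : S.Agree η η')
    (hg : Good D t S η) : Good D t S η' := by
  have hne : ∀ {χ}, χ ∈ D η' → χ ≠ η ∧ χ ≠ η' := fun {χ} hχ =>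
    ⟨(hD.lt (he ▸ hχ : χ ∈ D η)).ne, (hD.lt hχ).ne⟩
  rintro χ (rfl | hχ)
  · obtain ⟨h1, h2, h3⟩ := hg η (Or.inl rfl)
    refine ⟨by rwa [← rk_congr hD he], ?_, ?_⟩
    · rintro χ' (rfl | hχ') n m
      · rw [← h.N_iff, h2 η (Or.inl rfl), twin_congr hD he]
      · rw [← h.P_iff (hne hχ').1 (hne hχ').2, h2 χ' (Or.inr (he ▸ hχ')), twin_congr hD he]
    · rintro γ (rfl | hγ) c w
      · rw [← h.G_iff, h3 η (Or.inl rfl), twin_congr hD he]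
      · rw [← h.F_iff (hne hγ).1 (hne hγ).2, h3 γ (Or.inr (he ▸ hγ)), twin_congr hD he]
  · exact hg χ (Or.inr (he ▸ hχ))

/-- Places with the same row which `S` cannot tell apart are good together and have the same twin,
so the copying cannot tell them apart either. -/
theorem Sys.Agree.pull (hD : IsCoherent D) {η η' : V} (he : D η = D η') (h : S.Agree η η') :
    (S.pull D t Q).Agree η η' := by
  have hg : Good D t S η ↔ Good D t S η' := ⟨h.good hD he, h.symm.good hD he.symm⟩
  have hl : ∀ {χ}, χ ≠ η → χ ≠ η' → (χ ∈ lower D η ↔ χ ∈ lower D η') := by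
    intro χ h1 h2
    simp [lower, h1, h2, he]
  have low : ∀ {η}, η ∈ lower D η := Or.inl rfl
  refine ⟨fun h1 h2 => ?_, ?_, fun h1 h2 => ?_, ?_⟩
  · simp only [Sys.pull]
    rw [hg, hl h1 h2, twin_congr hD he]
  · simp only [Sys.pull]
    rw [hg, twin_congr hD he]
    simp only [low, implies_true]
  · simp only [Sys.pull]
    rw [hg, hl h1 h2, twin_congr hD he]
  · simp only [Sys.pull, hg, twin_congr hD he, low, implies_true]

end Good

end Transport

/-! ### Unions of increasing systems -/

theorem mk_iUnion_le_of_le {ι α : Type u} {c : Cardinal.{u}} (hc : ℵ₀ ≤ c) (hι : #ι ≤ c)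
    {f : ι → Set α} (hf : ∀ i, #(f i) ≤ c) : #(⋃ i, f i) ≤ c :=
  (mk_iUnion_le_sum_mk).trans (((sum_le_sum _ _ hf).trans (by simp)).trans
    ((mul_le_mul' hι le_rfl).trans (mul_eq_self hc).le))

/-- The union of a family of systems. -/
def Sys.iUnion {ι : Type u} (R : ι → Sys V K I) : Sys V K I :=
  ⟨fun η n χ m => ∃ i, (R i).P η n χ m, fun η c γ w => ∃ i, (R i).F η c γ w⟩

theorem Sys.Inv.iUnion [LinearOrder V] {ι : Type u} [LinearOrder ι] {R : ι → Sys V K I}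
    {x : ι → V → Set V} (h : ∀ i, (R i).Inv (x i))
    (hP : ∀ {i i'}, i ≤ i' → ∀ {η n χ m}, (R i).P η n χ m → (R i').P η n χ m)
    (hF : ∀ {i i'}, i ≤ i' → ∀ {η c γ w}, (R i).F η c γ w → (R i').F η c γ w)
    (hx : ∀ {i i'}, i ≤ i' → ∀ {η}, x i η ⊆ x i' η) :
    (Sys.iUnion R).Inv (fun η => ⋃ i, x i η) := by
  refine ⟨?_, ?_, ?_, ?_, ?_, ?_, ?_, ?_, ?_, ?_, ?_, ?_⟩
  · intro η χ hχ
    obtain ⟨i, hi⟩ := mem_iUnion.1 hχ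
    exact (h i).lt hi
  · rintro η n χ m ⟨i, hi⟩
    exact ((h i).P_dom hi).imp_left (fun h' => mem_iUnion.2 ⟨i, h'⟩)
  · rintro η n χ m ⟨i, hi⟩
    exact ⟨i, (h i).P_left hi⟩
  · rintro η n χ m ⟨i, hi⟩
    exact ⟨i, (h i).P_right hi⟩
  · rintro η n χ ⟨i, hi⟩ hχ
    obtain ⟨i', hi'⟩ := mem_iUnion.1 hχ
    obtain ⟨m, hm⟩ := (h (max i i')).P_ex (hP (le_max_left _ _) hi) (hx (le_max_right _ _) hi')
    exact ⟨m, _, hm⟩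
  · rintro η n χ m m' ⟨i, hi⟩ ⟨i', hi'⟩
    exact (h (max i i')).P_unique (hP (le_max_left _ _) hi) (hP (le_max_right _ _) hi')
  · rintro η n χ m χ' m' ⟨i, hi⟩ ⟨i', hi'⟩ hlt
    exact ⟨max i i', (h _).P_comp (hP (le_max_left _ _) hi) (hP (le_max_right _ _) hi') hlt⟩
  · rintro η c γ w ⟨i, hi⟩
    exact ((h i).F_dom hi).imp_left (fun h' => mem_iUnion.2 ⟨i, h'⟩)
  · rintro η c γ w ⟨i, hi⟩ s
    exact ⟨i, (h i).F_node hi s⟩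
  · rintro η c γ w ⟨i, hi⟩
    exact (h i).F_inj hi
  · rintro η c γ w χ ⟨i, hi⟩ hχ hle
    obtain ⟨i', hi'⟩ := mem_iUnion.1 hχ
    obtain ⟨w', h1, h2⟩ :=
      (h (max i i')).F_res (hF (le_max_left _ _) hi) (hx (le_max_right _ _) hi') hle
    exact ⟨w', ⟨_, h1⟩, fun s => ⟨_, h2 s⟩⟩
  · rintro η c γ w w' ⟨i, hi⟩ ⟨i', hi'⟩
    exact (h (max i i')).F_meet (hF (le_max_left _ _) hi) (hF (le_max_right _ _) hi')

/-! ### The recursion along the rows of a matrix -/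

section Recursion

variable [LinearOrder K]

/-- The union of the first `j` rows of a matrix of sets. -/
def rowsBelow (B : K → V → Set V) (j : K) (η : V) : Set V := {χ | ∃ i < j, χ ∈ B i η}

theorem rowsBelow_mono {B : K → V → Set V} {i j : K} (hij : i ≤ j) (η : V) : rowsBelow B i η ⊆ rowsBelow B j η :=
  fun _ ⟨i', hi', h⟩ => ⟨i', hi'.trans_le hij, h⟩

variable [LinearOrder V]

/-- A coherent matrix of small sets, exhausting the initial segments of `V`. -/
structure IsMatrix (B : K → V → Set V) (c : Cardinal.{u}) : Prop where
  lt : ∀ {i η χ}, χ ∈ B i η → χ < η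
  mono : ∀ {i i' η}, i ≤ i' → B i η ⊆ B i' η
  cover : ∀ {η χ}, χ < η → ∃ i, χ ∈ B i η
  coh : ∀ {i η χ}, χ ∈ B i η → B i χ = B i η ∩ Iio χ
  card : ∀ i η, #(B i η) ≤ c
  anchor : ∀ i η, (∀ χ, χ ∉ rowsBelow B i η) ∨ (∀ ζ < η, ∃ ζ' ∈ rowsBelow B i η, ζ ≤ ζ') ∨
    (∃ ζ ∈ rowsBelow B i η, ∀ χ ∈ rowsBelow B i η, χ ≤ ζ) ∨
    ∃ η' ∈ B i η, (∀ χ ∈ rowsBelow B i η, χ < η') ∧ ∀ i' < i, B i' η' = B i' η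

variable {B : K → V → Set V} {c : Cardinal.{u}}

theorem IsMatrix.isCoherent (hB : IsMatrix B c) (j : K) : IsCoherent (rowsBelow B j) := by
  refine ⟨fun ⟨i, _, h⟩ => hB.lt h, ?_⟩
  rintro η χ ⟨i, hi, h⟩
  ext ξ
  constructor
  · rintro ⟨i', hi', hξ⟩
    have h1 := hB.mono (le_max_left i i') h
    have h2 := hB.mono (le_max_right i i') hξ
    rw [hB.coh h1] at h2
    exact ⟨⟨_, max_lt hi hi', h2.1⟩, h2.2⟩
  · rintro ⟨⟨i', hi', hξ⟩, hlt⟩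
    have h1 := hB.mono (le_max_left i i') h
    refine ⟨_, max_lt hi hi', ?_⟩
    rw [hB.coh h1]
    exact ⟨hB.mono (le_max_right i i') hξ, hlt⟩

theorem IsMatrix.mk_rowsBelow_le (hB : IsMatrix B c) (hc : ℵ₀ ≤ c) {j : K} (hj : #(Iio j) ≤ c)
    (η : V) : #(rowsBelow B j η) ≤ c := by
  have : rowsBelow B j η = ⋃ i : Iio j, B i.1 η := by
    ext χ; simp [rowsBelow]
  rw [this]
  exact mk_iUnion_le_of_le hc hj (fun i => hB.card _ _)

theorem IsMatrix.mk_lower_le (hB : IsMatrix B c) (hc : ℵ₀ ≤ c) {j : K} (hj : #(Iio j) ≤ c)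
    (η : V) : #(lower (rowsBelow B j) η) ≤ c :=
  mk_insert_le.trans (add_le_of_le hc (hB.mk_rowsBelow_le hc hj η) (one_le_aleph0.trans hc))

open Classical in
/-- A stage extension, if there is one. -/
noncomputable def Sys.stage (S : Sys V K I) (L : Set V) (t : V) (c₀ : K) (U : Set (V × K)) (γ₀ : V)
    (y : I → K) : Sys V K I :=
  if h : ∃ Q, S.IsStage L t c₀ U γ₀ y Q then h.choose else ⟨fun _ _ _ _ => False, fun _ _ _ _ => False⟩

variable [WellFoundedLT V] [WellFoundedLT K]

/-- What is added at stage `j`. -/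
noncomputable def addition (B : K → V → Set V)
    (pick : K → Sys V K I → Option (V × Set (V × K) × V × (I → K))) (j : K) (S : Sys V K I) :
    Sys V K I :=
  (pick j S).elim ⟨fun _ _ _ _ => False, fun _ _ _ _ => False⟩ (fun e =>
    S.pull (rowsBelow B j) e.1
      (S.stage (lower (rowsBelow B j) e.1) e.1 j e.2.1 e.2.2.1 e.2.2.2))

/-- The system obtained before stage `j`. -/
noncomputable def build (B : K → V → Set V)
    (pick : K → Sys V K I → Option (V × Set (V × K) × V × (I → K))) : K → Sys V K I :=
  (wellFounded_lt (α := K)).fix (fun j rec =>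
    Sys.iUnion (fun i : Iio j => addition B pick i.1 (rec i.1 i.2)))

variable {pick : K → Sys V K I → Option (V × Set (V × K) × V × (I → K))}

theorem build_eq (j : K) : build B pick j =
    Sys.iUnion (fun i : Iio j => addition B pick i.1 (build B pick i.1)) := by
  rw [build, WellFounded.fix_eq]

/-- The place `η` is extended at stage `j`. -/
def GoodAt (B : K → V → Set V)
    (pick : K → Sys V K I → Option (V × Set (V × K) × V × (I → K))) (j : K) (η : V) : Prop :=
  ∃ e, pick j (build B pick j) = some e ∧ Good (rowsBelow B j) e.1 (build B pick j) η

/-- The levels at which the predecessors of nodes of level `η` are known before stage `j`. -/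
def known (B : K → V → Set V)
    (pick : K → Sys V K I → Option (V × Set (V × K) × V × (I → K))) (j : K) (η : V) : Set V :=
  {χ | ∃ i < j, GoodAt B pick i η ∧ χ ∈ rowsBelow B i η}

theorem addition_P_goodAt {j η n χ m} (h : (addition B pick j (build B pick j)).P η n χ m) :
    GoodAt B pick j η := by
  rw [addition] at h
  rcases hp : pick j (build B pick j) with _ | e
  · rw [hp] at h; exact h.elim
  · rw [hp] at h; exact ⟨e, hp, h.1⟩

theorem addition_F_goodAt {j η c γ w} (h : (addition B pick j (build B pick j)).F η c γ w) :
    GoodAt B pick j η := by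
  rw [addition] at h
  rcases hp : pick j (build B pick j) with _ | e
  · rw [hp] at h; exact h.elim
  · rw [hp] at h; exact ⟨e, hp, h.1⟩

theorem build_P_iff {j η n χ m} : (build B pick j).P η n χ m ↔
    ∃ i < j, (addition B pick i (build B pick i)).P η n χ m := by
  rw [build_eq]
  exact ⟨fun ⟨i, h⟩ => ⟨i.1, i.2, h⟩, fun ⟨i, hi, h⟩ => ⟨⟨i, hi⟩, h⟩⟩

theorem build_F_iff {j η c γ w} : (build B pick j).F η c γ w ↔
    ∃ i < j, (addition B pick i (build B pick i)).F η c γ w := by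
  rw [build_eq]
  exact ⟨fun ⟨i, h⟩ => ⟨i.1, i.2, h⟩, fun ⟨i, hi, h⟩ => ⟨⟨i, hi⟩, h⟩⟩

theorem build_P_mono {i j η n χ m} (hij : i ≤ j) (h : (build B pick i).P η n χ m) :
    (build B pick j).P η n χ m := by
  rw [build_P_iff] at h ⊢
  obtain ⟨i', hi', h⟩ := h
  exact ⟨i', hi'.trans_le hij, h⟩

theorem build_F_mono {i j η c γ w} (hij : i ≤ j) (h : (build B pick i).F η c γ w) :
    (build B pick j).F η c γ w := by
  rw [build_F_iff] at h ⊢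
  obtain ⟨i', hi', h⟩ := h
  exact ⟨i', hi'.trans_le hij, h⟩

theorem known_mono {i j η} (hij : i ≤ j) : known B pick i η ⊆ known B pick j η :=
  fun _ ⟨i', hi', h⟩ => ⟨i', hi'.trans_le hij, h⟩

theorem known_subset {j η} : known B pick j η ⊆ rowsBelow B j η :=
  fun _ ⟨_, hi', _, h⟩ => rowsBelow_mono hi'.le η h

theorem agree_addition (hB : IsMatrix B c) {j : K} {η η' : V}
    (he : rowsBelow B j η = rowsBelow B j η') (h : (build B pick j).Agree η η') :
    (addition B pick j (build B pick j)).Agree η η' := by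
  rw [addition]
  rcases pick j (build B pick j) with _ | e
  · exact ⟨fun _ _ => Iff.rfl, Iff.rfl, fun _ _ => Iff.rfl, Iff.rfl⟩
  · exact h.pull (hB.isCoherent j) he

/-- Places with the same rows below `j` are treated in the same way before stage `j`. -/
theorem agree_build (hB : IsMatrix B c) {j : K} {η η' : V}
    (he : ∀ i < j, rowsBelow B i η = rowsBelow B i η') : (build B pick j).Agree η η' := by
  induction j using WellFoundedLT.induction with
  | ind j ih =>
    have key : ∀ i < j, (addition B pick i (build B pick i)).Agree η η' := fun i hi =>
      agree_addition hB (he i hi) (ih i hi (fun i' hi' => he i' (hi'.trans hi)))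
    refine ⟨?_, ?_, ?_, ?_⟩
    · intro n χ m h1 h2
      simp only [build_P_iff]
      exact ⟨fun ⟨i, hi, h⟩ => ⟨i, hi, ((key i hi).P_iff h1 h2).1 h⟩,
        fun ⟨i, hi, h⟩ => ⟨i, hi, ((key i hi).P_iff h1 h2).2 h⟩⟩
    · intro n m
      simp only [build_P_iff]
      exact ⟨fun ⟨i, hi, h⟩ => ⟨i, hi, (key i hi).N_iff.1 h⟩,
        fun ⟨i, hi, h⟩ => ⟨i, hi, (key i hi).N_iff.2 h⟩⟩
    · intro c γ w h1 h2
      simp only [build_F_iff]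
      exact ⟨fun ⟨i, hi, h⟩ => ⟨i, hi, ((key i hi).F_iff h1 h2).1 h⟩,
        fun ⟨i, hi, h⟩ => ⟨i, hi, ((key i hi).F_iff h1 h2).2 h⟩⟩
    · intro c w
      simp only [build_F_iff]
      exact ⟨fun ⟨i, hi, h⟩ => ⟨i, hi, (key i hi).G_iff.1 h⟩,
        fun ⟨i, hi, h⟩ => ⟨i, hi, (key i hi).G_iff.2 h⟩⟩

/-- The properties of the system before stage `j` that are proved by induction. -/
structure Fine (B : K → V → Set V)
    (pick : K → Sys V K I → Option (V × Set (V × K) × V × (I → K))) (j : K) : Prop where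
  inv : (build B pick j).Inv (known B pick j)
  nodes : ∀ η, #((build B pick j).nodesAt η) ≤ #I
  facts : ∀ η, #((build B pick j).factsAt η) ≤ #I
  colour : ∀ {η c γ w}, (build B pick j).F η c γ w → c < j

/-- If the stages that extended `η` are unbounded in `j`, all of its row below `j` is known.
Otherwise the known levels form exactly the union of the rows below some `i < j`, and the anchoring
clause of the matrix at `(i, η)` provides one of the required kinds of control. -/
theorem Fine.anchored (hB : IsMatrix B c) {j : K} (hf : Fine B pick j) (t η : V)
    (hη : η ∈ lower (rowsBelow B j) t) :
    Anchored (build B pick j) (known B pick j) (lower (rowsBelow B j) t) η := by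
  classical
  have hD := hB.isCoherent j
  set S := build B pick j with hS
  by_cases hunb : ∀ i < j, ∃ g, i < g ∧ g < j ∧ GoodAt B pick g η
  · left
    intro ζ hζ hlt
    obtain ⟨i, hi, h⟩ := hD.mem hη hζ hlt
    obtain ⟨g, hig, hgj, hg⟩ := hunb i hi
    exact ⟨ζ, ⟨g, hgj, hg, i, hig, h⟩, le_rfl⟩
  push Not at hunb
  obtain ⟨i₀, hi₀, hbd⟩ := hunb
  have hne : {i | ∀ g < j, GoodAt B pick g η → g ≤ i}.Nonempty :=
    ⟨i₀, fun g hg hgood => not_lt.1 (fun h => hbd g h hg hgood)⟩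
  -- The least bound of the stages that extended `η`, whether attained or not.
  obtain ⟨i, hi, hmin⟩ := WellFounded.has_min (wellFounded_lt (α := K)) _ hne
  have hij : i < j := lt_of_le_of_lt (not_lt.1 (fun h => hmin i₀
    (fun g hg hgood => not_lt.1 (fun h => hbd g h hg hgood)) h)) hi₀
  have hx : ∀ {χ}, χ ∈ known B pick j η ↔ χ ∈ rowsBelow B i η := by
    intro χ
    constructor
    · rintro ⟨g, hg, hgood, h⟩
      exact rowsBelow_mono (hi g hg hgood) η h
    · rintro ⟨i', hi', h⟩
      have : ¬ ∀ g < j, GoodAt B pick g η → g ≤ i' := fun h' => hmin i' h' hi'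
      push Not at this
      obtain ⟨g, hg, hgood, hlt⟩ := this
      exact ⟨g, hg, hgood, i', hlt, h⟩
  rcases hB.anchor i η with h | h | ⟨ζ, hζ, h⟩ | ⟨η', hη', h, heq⟩
  · right; left
    intro c γ w hF
    exact (hf.inv.F_dom hF).resolve_left (fun h' => h γ (hx.1 h'))
  · left
    intro ζ _ hlt
    obtain ⟨ζ', h1, h2⟩ := h ζ hlt
    exact ⟨ζ', hx.2 h1, h2⟩
  · right; right
    have hζx := hx.2 hζ
    -- With a greatest known level `ζ` the anchor is `ζ`, and `a` maps a node to its predecessor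
    -- there.
    obtain ⟨a, ha⟩ : ∃ a : K → K, ∀ n m, S.P η n ζ m → m = a n := by
      refine ⟨fun n => if hn : ∃ m, S.P η n ζ m then hn.choose else n, fun n m hP => ?_⟩
      have hn : ∃ m, S.P η n ζ m := ⟨m, hP⟩
      beta_reduce
      rw [dif_pos hn]
      exact hf.inv.P_unique hP hn.choose_spec
    refine ⟨ζ, hD.lower_subset hη (Or.inr (known_subset hζx)), hf.inv.lt hζx,
      fun χ hχ => h χ (hx.1 hχ), a, ?_⟩
    refine ⟨?_, ?_, ha, ?_⟩
    · intro n hn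
      obtain ⟨m, hm⟩ := hf.inv.P_ex hn hζx
      rw [← ha n m hm]
      exact hf.inv.P_right hm
    · intro n χ m hP hlt
      obtain ⟨k, hk⟩ := hf.inv.P_ex (hf.inv.P_left hP) hζx
      rw [← ha n k hk]
      exact hf.inv.P_comp hk hP hlt
    · intro c γ w hF hne
      have hγ : γ ≤ ζ := h γ (hx.1 ((hf.inv.F_dom hF).resolve_right hne))
      obtain ⟨w', h1, h2⟩ := hf.inv.F_res hF hζx hγ
      refine ⟨hγ, ?_⟩
      have : w' = a ∘ w := funext fun s => ha _ _ (h2 s)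
      rwa [← this]
  · right; right
    have hη'D : η' ∈ rowsBelow B j η := ⟨i, hij, hη'⟩
    have hη'lt := hB.lt hη'
    -- Only stages up to `i` acted at `η`, and the rows below `i` agree at `η` and `η'`. These
    -- stages did the same at both places, so the identity serves as the anchor map.
    have hag : ∀ i' ≤ i, (addition B pick i' (build B pick i')).Agree η η' := by
      intro i' hi'
      have he : ∀ i'' ≤ i, rowsBelow B i'' η = rowsBelow B i'' η' := by
        intro i'' hi''
        ext χ
        constructor
        · rintro ⟨k, hk, h⟩
          exact ⟨k, hk, by rwa [heq k (hk.trans_le hi'')]⟩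
        · rintro ⟨k, hk, h⟩
          exact ⟨k, hk, by rwa [heq k (hk.trans_le hi'')] at h⟩
      exact agree_addition hB (he i' hi') (agree_build hB (fun k hk => he k (hk.le.trans hi')))
    have hxlt : ∀ {χ}, χ ∈ known B pick j η → χ < η' := fun hχ => h _ (hx.1 hχ)
    refine ⟨η', hD.lower_subset hη (Or.inr hη'D), hη'lt, fun χ hχ => (hxlt hχ).le, id, ?_, ?_, ?_, ?_⟩
    · intro n hn
      obtain ⟨g, hg, hP⟩ := build_P_iff.1 hn
      exact build_P_iff.2 ⟨g, hg, (hag g (hi g hg (addition_P_goodAt hP))).N_iff.1 hP⟩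
    · intro n χ m hP hlt
      obtain ⟨g, hg, hP⟩ := build_P_iff.1 hP
      exact build_P_iff.2 ⟨g, hg, ((hag g (hi g hg (addition_P_goodAt hP))).P_iff
        (hlt.trans hη'lt).ne hlt.ne).1 hP⟩
    · intro n m hP
      rcases hf.inv.P_dom hP with h' | h'
      · exact absurd (hxlt h') (lt_irrefl _)
      · exact absurd h' hη'lt.ne
    · intro c γ w hF hne
      have hlt := hxlt ((hf.inv.F_dom hF).resolve_right hne)
      obtain ⟨g, hg, hF⟩ := build_F_iff.1 hF
      exact ⟨hlt.le, build_F_iff.2 ⟨g, hg, ((hag g (hi g hg (addition_F_goodAt hF))).F_iff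
        hne hlt.ne).1 hF⟩⟩

theorem Fine.mk_nodesOn_le (hI : ℵ₀ ≤ #I) {j : K} (hf : Fine B pick j) {L : Set V}
    (hL : #L ≤ #I) : #((build B pick j).nodesOn L) ≤ #I := by
  have : (build B pick j).nodesOn L =
      ⋃ η : L, (fun n => (η.1, n)) '' (build B pick j).nodesAt η.1 := by
    ext ⟨η, n⟩
    simp [Sys.nodesOn, Sys.nodesAt, and_comm]
  rw [this]
  exact mk_iUnion_le_of_le hI hL (fun η => mk_image_le.trans (hf.nodes _))

theorem Fine.mk_factsOn_le (hI : ℵ₀ ≤ #I) {j : K} (hf : Fine B pick j) {L : Set V}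
    (hL : #L ≤ #I) : #((build B pick j).factsOn L) ≤ #I := by
  have : (build B pick j).factsOn L =
      ⋃ η : L, (fun n => (η.1, n)) '' (build B pick j).factsAt η.1 := by
    ext ⟨η, n⟩
    simp [Sys.factsOn, Sys.factsAt, and_comm]
  rw [this]
  exact mk_iUnion_le_of_le hI hL (fun η => mk_image_le.trans (hf.facts _))

variable [NoMaxOrder V]

/-- The stage `j` itself serves as the new colour: all colours used before are smaller. -/
theorem Fine.isStage (hI : ℵ₀ ≤ #I) (hK : #I < #K) (hKI : ∀ j : K, #(Iio j) ≤ #I)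
    (hB : IsMatrix B #I) {j : K} (hf : Fine B pick j) (t : V) (U : Set (V × K)) (γ : V)
    (y : I → K) : (build B pick j).IsStage (lower (rowsBelow B j) t) t j U γ y
      ((build B pick j).stage (lower (rowsBelow B j) t) t j U γ y) := by
  have hL := hB.mk_lower_le hI (hKI j) t
  have : ∃ Q, (build B pick j).IsStage (lower (rowsBelow B j) t) t j U γ y Q := by
    obtain ⟨t', ht'⟩ := exists_gt t
    refine exists_stage hI hK hf.inv (fun η hη χ hχ => ?_) hL (hf.mk_nodesOn_le hI hL)
      (hf.mk_factsOn_le hI hL) (hf.anchored hB t)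
      (Or.inl rfl) (fun η hη => (hB.isCoherent j).le hη) ht' j (fun η _ γ w hF => ?_) U γ y
    · exact (hB.isCoherent j).lower_subset hη (Or.inr (known_subset hχ))
    · exact absurd (hf.colour hF) (lt_irrefl _)
  rw [Sys.stage, dif_pos this]
  exact this.choose_spec

/-- The levels known after stage `j`. -/
def known' (B : K → V → Set V)
    (pick : K → Sys V K I → Option (V × Set (V × K) × V × (I → K))) (j : K) (η : V) : Set V :=
  {χ | ∃ i ≤ j, GoodAt B pick i η ∧ χ ∈ rowsBelow B i η}

theorem Fine.inv_sup (hI : ℵ₀ ≤ #I) (hK : #I < #K) (hKI : ∀ j : K, #(Iio j) ≤ #I)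
    (hB : IsMatrix B #I) {j : K} (hf : Fine B pick j) :
    ((build B pick j).sup (addition B pick j (build B pick j))).Inv (known' B pick j) := by
  have hnot : ∀ η, ¬ GoodAt B pick j η → known' B pick j η = known B pick j η := by
    intro η hg
    ext χ
    constructor
    · rintro ⟨i, hi, hgi, h⟩
      exact ⟨i, hi.lt_of_ne (fun e => hg (e ▸ hgi)), hgi, h⟩
    · rintro ⟨i, hi, hgi, h⟩
      exact ⟨i, hi.le, hgi, h⟩
  rcases hp : pick j (build B pick j) with _ | e
  · have h1 : (build B pick j).sup (addition B pick j (build B pick j)) = build B pick j := by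
      simp [addition, hp, Sys.sup]
    have h2 : known' B pick j = known B pick j := funext fun η => hnot η (fun ⟨e, he, _⟩ => by
      rw [hp] at he; cases he)
    rw [h1, h2]
    exact hf.inv
  · have hst := hf.isStage hI hK hKI hB e.1 e.2.1 e.2.2.1 e.2.2.2
    have h1 : addition B pick j (build B pick j) = (build B pick j).pull (rowsBelow B j) e.1
        ((build B pick j).stage (lower (rowsBelow B j) e.1) e.1 j e.2.1 e.2.2.1 e.2.2.2) := by
      simp [addition, hp]
    have hgood : ∀ η, Good (rowsBelow B j) e.1 (build B pick j) η ↔ GoodAt B pick j η := by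
      intro η
      constructor
      · exact fun h => ⟨e, hp, h⟩
      · rintro ⟨e', he', h⟩
        rw [hp] at he'
        cases he'
        exact h
    rw [h1]
    refine hf.inv.sup_pull (hB.isCoherent j) (fun η => known_subset) hst (fun η hg => ?_)
      (fun η hg => hnot η (fun h => hg ((hgood η).2 h)))
    ext χ
    constructor
    · rintro ⟨i, hi, hgi, h⟩
      exact rowsBelow_mono hi η h
    · exact fun h => ⟨j, le_rfl, (hgood η).1 hg, h⟩

/-- The system before `j` is the union of the systems after the earlier stages, so successors and
limits need no separate treatment. The size bounds persist because at most `#I` stages precede `j`,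
each adding at most `#I` nodes and facts to a level. -/
theorem fine (hI : ℵ₀ ≤ #I) (hK : #I < #K) (hKI : ∀ j : K, #(Iio j) ≤ #I)
    (hB : IsMatrix B #I) (j : K) : Fine B pick j := by
  induction j using WellFoundedLT.induction with
  | ind j ih =>
    have hadd : ∀ i < j, ∀ η, #((addition B pick i (build B pick i)).nodesAt η) ≤ #I ∧
        #((addition B pick i (build B pick i)).factsAt η) ≤ #I ∧
        ∀ c γ w, (addition B pick i (build B pick i)).F η c γ w → c < j := by
      intro i hi η
      rcases hp : pick i (build B pick i) with _ | e
      · simp [addition, hp, Sys.nodesAt, Sys.factsAt, Sys.N]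
      · have hst := (ih i hi).isStage hI hK hKI hB e.1 e.2.1 e.2.2.1 e.2.2.2
        have h1 : addition B pick i (build B pick i) = (build B pick i).pull (rowsBelow B i) e.1
            ((build B pick i).stage (lower (rowsBelow B i) e.1) e.1 i e.2.1 e.2.2.1 e.2.2.2) := by
          simp [addition, hp]
        rw [h1]
        refine ⟨mk_nodesAt_pull hst η, mk_factsAt_pull (hB.isCoherent i) hst η, ?_⟩
        intro c γ w hF
        rcases colour_pull hst hF with rfl | ⟨η', γ', w', h⟩
        · exact hi
        · exact ((ih i hi).colour h).trans hi
    refine ⟨?_, fun η => ?_, fun η => ?_, ?_⟩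
    · have h1 := Sys.Inv.iUnion (ι := Iio j)
        (R := fun i => (build B pick i.1).sup (addition B pick i.1 (build B pick i.1)))
        (x := fun i => known' B pick i.1) (fun i => (ih i.1 i.2).inv_sup hI hK hKI hB)
        (fun {i i'} hle {η n χ m} h => by
          rcases hle.lt_or_eq with hlt | rfl
          · refine Or.inl ?_
            rcases h with h | h
            · exact build_P_mono hle h
            · exact build_P_iff.2 ⟨i.1, hlt, h⟩
          · exact h)
        (fun {i i'} hle {η c γ w} h => by
          rcases hle.lt_or_eq with hlt | rfl
          · refine Or.inl ?_
            rcases h with h | h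
            · exact build_F_mono hle h
            · exact build_F_iff.2 ⟨i.1, hlt, h⟩
          · exact h)
        (fun {i i'} hle {η} χ ⟨k, hk, h⟩ => ⟨k, hk.trans hle, h⟩)
      have h2 : Sys.iUnion (fun i : Iio j => (build B pick i.1).sup
          (addition B pick i.1 (build B pick i.1))) = build B pick j := by
        refine Sys.ext ?_ ?_
        · funext η n χ m
          refine propext ⟨?_, ?_⟩
          · rintro ⟨i, h | h⟩
            · exact build_P_mono i.2.le h
            · exact build_P_iff.2 ⟨i.1, i.2, h⟩
          · intro h
            obtain ⟨i, hi, h⟩ := build_P_iff.1 h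
            exact ⟨⟨i, hi⟩, Or.inr h⟩
        · funext η c γ w
          refine propext ⟨?_, ?_⟩
          · rintro ⟨i, h | h⟩
            · exact build_F_mono i.2.le h
            · exact build_F_iff.2 ⟨i.1, i.2, h⟩
          · intro h
            obtain ⟨i, hi, h⟩ := build_F_iff.1 h
            exact ⟨⟨i, hi⟩, Or.inr h⟩
      have h3 : (fun η => ⋃ i : Iio j, known' B pick i.1 η) = known B pick j := by
        funext η
        ext χ
        constructor
        · intro h
          obtain ⟨i, k, hk, h⟩ := mem_iUnion.1 h
          exact ⟨k, hk.trans_lt i.2, h⟩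
        · rintro ⟨i, hi, h⟩
          exact mem_iUnion.2 ⟨⟨i, hi⟩, i, le_rfl, h⟩
      rwa [h2, h3] at h1
    · have : (build B pick j).nodesAt η ⊆
          ⋃ i : Iio j, (addition B pick i.1 (build B pick i.1)).nodesAt η := by
        intro n hn
        obtain ⟨i, hi, h⟩ := build_P_iff.1 hn
        exact mem_iUnion.2 ⟨⟨i, hi⟩, h⟩
      exact (mk_le_mk_of_subset this).trans
        (mk_iUnion_le_of_le hI (hKI j) (fun i => (hadd i.1 i.2 η).1))
    · have : (build B pick j).factsAt η ⊆
          ⋃ i : Iio j, (addition B pick i.1 (build B pick i.1)).factsAt η := by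
        intro n hn
        obtain ⟨i, hi, h⟩ := build_F_iff.1 hn
        exact mem_iUnion.2 ⟨⟨i, hi⟩, h⟩
      exact (mk_le_mk_of_subset this).trans
        (mk_iUnion_le_of_le hI (hKI j) (fun i => (hadd i.1 i.2 η).2.1))
    · intro η c γ w h
      obtain ⟨i, hi, h⟩ := build_F_iff.1 h
      exact (hadd i hi η).2.2 c γ w h

end Recursion

/-! ### Coding small structures by subsets of a fixed set -/

/-- Codes for the pieces of information that are guessed. -/
inductive Code (K I : Type u) : Type u
  | lev (a : K)
  | ord (a b : K)
  | pred (a n b m : K)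
  | fact (a c b : K) (w : I → K)
  | chain (a n : K)
  | goal (a : K) (y : I → K)

section Codes

variable [LinearOrder V]

/-- The coded form of the system `S` on `lower D t`, together with the data `U`, `γ`, `y`. -/
def codeSet (ψ : V → V → K) (D : V → Set V) (S : Sys V K I)
    (e : V × Set (V × K) × V × (I → K)) : Set (Code K I) := fun z => match z with
  | .lev a => ∃ χ ∈ lower D e.1, ψ e.1 χ = a
  | .ord a b => ∃ χ ∈ lower D e.1, ∃ χ' ∈ lower D e.1, χ < χ' ∧ ψ e.1 χ = a ∧ ψ e.1 χ' = b
  | .pred a n b m => ∃ χ ∈ lower D e.1, ∃ χ' ∈ lower D e.1, S.P χ n χ' m ∧ ψ e.1 χ = a ∧ ψ e.1 χ' = b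
  | .fact a c b w => ∃ χ ∈ lower D e.1, ∃ χ' ∈ lower D e.1, S.F χ c χ' w ∧ ψ e.1 χ = a ∧ ψ e.1 χ' = b
  | .chain a n => ∃ p ∈ e.2.1, ψ e.1 p.1 = a ∧ p.2 = n
  | .goal a y => ψ e.1 e.2.2.1 = a ∧ e.2.2.2 = y

/-- The data refer to elements below the top. -/
def ValidData (e : V × Set (V × K) × V × (I → K)) : Prop :=
  (∀ p ∈ e.2.1, p.1 < e.1) ∧ e.2.2.1 ≤ e.1

variable {ψ : V → V → K} {D : V → Set V} {S : Sys V K I}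

/-- Each kind of code transfers one relation; injectivity of `ψ t` on `Iic t` recovers the elements
from their codes. -/
theorem codeSet_match (hψ : ∀ t, InjOn (ψ t) (Iic t)) (hD : IsCoherent D)
    {e e₀ : V × Set (V × K) × V × (I → K)} (h : codeSet ψ D S e = codeSet ψ D S e₀) :
    (∀ χ ∈ lower D e.1, ∃ ξ ∈ lower D e₀.1, ψ e₀.1 ξ = ψ e.1 χ) ∧
    (∀ χ ∈ lower D e.1, ∀ χ' ∈ lower D e.1, ∀ ξ ∈ lower D e₀.1, ∀ ξ' ∈ lower D e₀.1,
      ψ e₀.1 ξ = ψ e.1 χ → ψ e₀.1 ξ' = ψ e.1 χ' →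
      (χ < χ' → ξ < ξ') ∧ (∀ n m, S.P χ n χ' m → S.P ξ n ξ' m) ∧
      (∀ c w, S.F χ c χ' w → S.F ξ c ξ' w)) := by
  have inj : ∀ {ξ ξ'}, ξ ∈ lower D e₀.1 → ξ' ∈ lower D e₀.1 → ψ e₀.1 ξ = ψ e₀.1 ξ' → ξ = ξ' :=
    fun h1 h2 h3 => hψ _ (hD.le h1) (hD.le h2) h3
  constructor
  · intro χ hχ
    have h1 : Code.lev (ψ e.1 χ) ∈ codeSet ψ D S e := ⟨χ, hχ, rfl⟩
    rw [h] at h1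
    exact h1
  · intro χ hχ χ' hχ' ξ hξ ξ' hξ' he he'
    refine ⟨fun hlt => ?_, fun n m hP => ?_, fun c w hF => ?_⟩
    · have h1 : Code.ord (ψ e.1 χ) (ψ e.1 χ') ∈ codeSet ψ D S e := ⟨χ, hχ, χ', hχ', hlt, rfl, rfl⟩
      rw [h] at h1
      obtain ⟨ζ, hζ, ζ', hζ', h2, h3, h4⟩ := h1
      rwa [inj hξ hζ (he.trans h3.symm), inj hξ' hζ' (he'.trans h4.symm)]
    · have h1 : Code.pred (ψ e.1 χ) n (ψ e.1 χ') m ∈ codeSet ψ D S e :=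
        ⟨χ, hχ, χ', hχ', hP, rfl, rfl⟩
      rw [h] at h1
      obtain ⟨ζ, hζ, ζ', hζ', h2, h3, h4⟩ := h1
      rwa [inj hξ hζ (he.trans h3.symm), inj hξ' hζ' (he'.trans h4.symm)]
    · have h1 : Code.fact (ψ e.1 χ) c (ψ e.1 χ') w ∈ codeSet ψ D S e :=
        ⟨χ, hχ, χ', hχ', hF, rfl, rfl⟩
      rw [h] at h1
      obtain ⟨ζ, hζ, ζ', hζ', h2, h3, h4⟩ := h1
      rwa [inj hξ hζ (he.trans h3.symm), inj hξ' hζ' (he'.trans h4.symm)]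

variable [WellFoundedLT V]

/-- The codes record the order, and the rank of an element depends only on the ranks of the members
of the row below it. Hence matching by codes is the same as taking twins. -/
theorem rk_eq_of_codeSet_eq (hψ : ∀ t, InjOn (ψ t) (Iic t)) (hD : IsCoherent D)
    {e e₀ : V × Set (V × K) × V × (I → K)} (h : codeSet ψ D S e = codeSet ψ D S e₀) :
    ∀ χ ∈ lower D e.1, ∀ ξ ∈ lower D e₀.1, ψ e₀.1 ξ = ψ e.1 χ → rk D ξ = rk D χ := by
  obtain ⟨h1, h2⟩ := codeSet_match hψ hD h
  obtain ⟨h3, h4⟩ := codeSet_match hψ hD h.symm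
  intro χ
  induction χ using WellFoundedLT.induction with
  | ind χ ih =>
    intro hχ ξ hξ he
    refine eq_of_forall_lt_iff (fun o => ?_)
    rw [lt_rk_iff hD, lt_rk_iff hD]
    constructor
    · rintro ⟨ξ', hξ', ho⟩
      have hξ'L := hD.lower_subset hξ (Or.inr hξ')
      obtain ⟨χ', hχ', he'⟩ := h3 ξ' hξ'L
      have hlt := (h4 ξ' hξ'L ξ hξ χ' hχ' χ hχ he' he.symm).1 (hD.lt hξ')
      exact ⟨χ', hD.mem hχ hχ' hlt, by rwa [← ih χ' hlt hχ' ξ' hξ'L he'.symm]⟩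
    · rintro ⟨χ', hχ', ho⟩
      have hχ'L := hD.lower_subset hχ (Or.inr hχ')
      obtain ⟨ξ', hξ', he'⟩ := h1 χ' hχ'L
      have hlt := (h2 χ' hχ'L χ hχ ξ' hξ' ξ hξ he' he).1 (hD.lt hχ')
      exact ⟨ξ', hD.mem hξ hξ' hlt, by rwa [ih χ' (hD.lt hχ') hχ'L ξ' hξ' he']⟩

/-- Two tops with the same codes carry isomorphic structures. -/
theorem twin_of_codeSet_eq (hψ : ∀ t, InjOn (ψ t) (Iic t)) (hD : IsCoherent D)
    {e e₀ : V × Set (V × K) × V × (I → K)} (h : codeSet ψ D S e = codeSet ψ D S e₀) :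
    ∀ χ ∈ lower D e.1, twin D e₀.1 χ ∈ lower D e₀.1 ∧ ψ e₀.1 (twin D e₀.1 χ) = ψ e.1 χ ∧
      rk D (twin D e₀.1 χ) = rk D χ := by
  intro χ hχ
  obtain ⟨ξ, hξ, he⟩ := (codeSet_match hψ hD h).1 χ hχ
  have hr := rk_eq_of_codeSet_eq hψ hD h χ hχ ξ hξ he
  rw [twin_eq hD hξ hr]
  exact ⟨hξ, he, hr⟩

theorem good_of_codeSet_eq (hψ : ∀ t, InjOn (ψ t) (Iic t)) (hD : IsCoherent D)
    {e e₀ : V × Set (V × K) × V × (I → K)} (h : codeSet ψ D S e = codeSet ψ D S e₀) :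
    Good D e₀.1 S e.1 := by
  have ht := twin_of_codeSet_eq hψ hD h
  have h1 := (codeSet_match hψ hD h).2
  have h2 := (codeSet_match hψ hD h.symm).2
  intro χ hχ
  obtain ⟨a1, a2, a3⟩ := ht χ hχ
  refine ⟨⟨_, a1, a3⟩, fun χ' hχ' n m => ?_, fun γ hγ c w => ?_⟩
  · have hχ'L := hD.lower_subset hχ hχ'
    obtain ⟨b1, b2, b3⟩ := ht χ' hχ'L
    exact ⟨(h1 χ hχ χ' hχ'L _ a1 _ b1 a2 b2).2.1 n m,
      (h2 _ a1 _ b1 χ hχ χ' hχ'L a2.symm b2.symm).2.1 n m⟩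
  · have hγL := hD.lower_subset hχ hγ
    obtain ⟨b1, b2, b3⟩ := ht γ hγL
    exact ⟨(h1 χ hχ γ hγL _ a1 _ b1 a2 b2).2.2 c w,
      (h2 _ a1 _ b1 χ hχ γ hγL a2.symm b2.symm).2.2 c w⟩

/-- The top `e₀.1` is the twin of some element of `lower D e.1`; twins preserve order, so the twin
of the top `e.1` cannot be lower. -/
theorem twin_top_of_codeSet_eq (hψ : ∀ t, InjOn (ψ t) (Iic t)) (hD : IsCoherent D)
    {e e₀ : V × Set (V × K) × V × (I → K)} (h : codeSet ψ D S e = codeSet ψ D S e₀) :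
    twin D e₀.1 e.1 = e₀.1 := by
  have hg := good_of_codeSet_eq hψ hD h
  have ht := twin_of_codeSet_eq hψ hD h
  obtain ⟨χ, hχ, he⟩ := (codeSet_match hψ hD h.symm).1 e₀.1 (Or.inl rfl)
  have h1 : e₀.1 = twin D e₀.1 χ :=
    hψ _ le_rfl (hD.le (ht χ hχ).1) (he.symm.trans (ht χ hχ).2.1.symm)
  refine le_antisymm (hD.le (ht e.1 (Or.inl rfl)).1) ?_
  conv_lhs => rw [h1]
  exact hg.twin_le hD (Or.inl rfl) hχ (hD.le hχ)

theorem data_of_codeSet_eq (hψ : ∀ t, InjOn (ψ t) (Iic t)) (hD : IsCoherent D)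
    {e e₀ : V × Set (V × K) × V × (I → K)} (h : codeSet ψ D S e = codeSet ψ D S e₀)
    (hv₀ : ValidData e₀) :
    e₀.2.2.2 = e.2.2.2 ∧ (e.2.2.1 ∈ lower D e.1 → twin D e₀.1 e.2.2.1 = e₀.2.2.1) ∧
    ((∀ p ∈ e.2.1, p.1 ∈ lower D e.1) →
      e₀.2.1 = (fun p => (twin D e₀.1 p.1, p.2)) '' e.2.1) := by
  have ht := twin_of_codeSet_eq hψ hD h
  have h1 : Code.goal (ψ e.1 e.2.2.1) e.2.2.2 ∈ codeSet ψ D S e := ⟨rfl, rfl⟩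
  rw [h] at h1
  refine ⟨h1.2, fun hγ => ?_, fun hU => ?_⟩
  · exact hψ _ (hD.le (ht _ hγ).1) hv₀.2 ((ht _ hγ).2.1.trans h1.1.symm)
  · ext ⟨ξ, n⟩
    constructor
    · intro hp
      have h2 : Code.chain (ψ e₀.1 ξ) n ∈ codeSet ψ D S e₀ := ⟨(ξ, n), hp, rfl, rfl⟩
      rw [← h] at h2
      obtain ⟨p, hpU, h3, h4⟩ := h2
      obtain ⟨b1, b2, b3⟩ := ht p.1 (hU p hpU)
      exact ⟨p, hpU, Prod.ext (hψ _ (hD.le b1) (hv₀.1 _ hp).le (b2.trans h3)) h4⟩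
    · rintro ⟨p, hp, heq⟩
      have h2 : Code.chain (ψ e.1 p.1) p.2 ∈ codeSet ψ D S e := ⟨p, hp, rfl, rfl⟩
      rw [h] at h2
      obtain ⟨q, hqU, h3, h4⟩ := h2
      obtain ⟨b1, b2, b3⟩ := ht p.1 (hU p hp)
      rw [← heq]
      beta_reduce
      have : q = (twin D e₀.1 p.1, p.2) :=
        Prod.ext (hψ _ (hv₀.1 _ hqU).le (hD.le b1) (h3.trans b2.symm)) h4
      rwa [← this]

end Codes

/-! ### Guessing every task -/

section Final

variable [LinearOrder V] [LinearOrder K] [WellFoundedLT V] [WellFoundedLT K]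

/-- `A` guesses every continuous increasing chain of small sets cofinally often. -/
def Guesses {H : Type u} (A : K → Set H) (c : Cardinal.{u}) : Prop :=
  ∀ D : K → Set H, Monotone D → (∀ j, #(D j) ≤ c) →
    (∀ j, (∃ i, i < j) → (∀ i < j, ∃ i', i < i' ∧ i' < j) → ∀ z ∈ D j, ∃ i < j, z ∈ D i) →
    ∀ j₀, ∃ j, j₀ < j ∧ A j = D j

open Classical in
/-- The data that are guessed by `A` at stage `j`. -/
noncomputable def guess (B : K → V → Set V) (ψ : V → V → K) (A : K → Set (Code K I)) (j : K)
    (S : Sys V K I) : Option (V × Set (V × K) × V × (I → K)) :=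
  if h : ∃ e, ValidData e ∧ codeSet ψ (rowsBelow B j) S e = A j then some h.choose else none

variable {B : K → V → Set V} {ψ : V → V → K} {A : K → Set (Code K I)}

/-- For fixed data the code sets grow continuously with the rows and the system, and stay small, so
they are guessed at some late stage. The data actually chosen there may differ from `e`, but they
have the same code set, hence carry an isomorphic structure. -/
theorem exists_guess [NoMaxOrder V] (hI : ℵ₀ ≤ #I) (hK : #I < #K) (hKI : ∀ j : K, #(Iio j) ≤ #I)
    (hB : IsMatrix B #I) (hA : Guesses A #I)
    {e : V × Set (V × K) × V × (I → K)} (he : ValidData e) (hU : #e.2.1 ≤ #I) (j₀ : K) :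
    ∃ j, j₀ < j ∧ ∃ e₀, ValidData e₀ ∧
      guess B ψ A j (build B (guess B ψ A) j) = some e₀ ∧
      codeSet ψ (rowsBelow B j) (build B (guess B ψ A) j) e =
        codeSet ψ (rowsBelow B j) (build B (guess B ψ A) j) e₀ := by
  have hfine := fine (pick := guess B ψ A) hI hK hKI hB
  set T := build B (guess B ψ A) with hT
  have hlow : ∀ {i j : K}, i ≤ j → ∀ {χ}, χ ∈ lower (rowsBelow B i) e.1 →
      χ ∈ lower (rowsBelow B j) e.1 := fun hij χ hχ =>
    hχ.imp_right (fun h => rowsBelow_mono hij _ h)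
  refine Exists.elim (hA (fun j => codeSet ψ (rowsBelow B j) (T j) e) ?_ ?_ ?_ j₀) ?_
  · intro i j hij z hz
    cases z with
    | lev a =>
      obtain ⟨χ, hχ, h⟩ := hz
      exact ⟨χ, hlow hij hχ, h⟩
    | ord a b =>
      obtain ⟨χ, hχ, χ', hχ', h⟩ := hz
      exact ⟨χ, hlow hij hχ, χ', hlow hij hχ', h⟩
    | pred a n b m =>
      obtain ⟨χ, hχ, χ', hχ', h, h'⟩ := hz
      exact ⟨χ, hlow hij hχ, χ', hlow hij hχ', build_P_mono hij h, h'⟩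
    | fact a c b w =>
      obtain ⟨χ, hχ, χ', hχ', h, h'⟩ := hz
      exact ⟨χ, hlow hij hχ, χ', hlow hij hχ', build_F_mono hij h, h'⟩
    | chain a n => exact hz
    | goal a y => exact hz
  · intro j
    set L := lower (rowsBelow B j) e.1 with hL
    have hLc : #L ≤ #I := hB.mk_lower_le hI (hKI j) e.1
    have hn := (hfine j).mk_nodesOn_le hI hLc
    have hf := (hfine j).mk_factsOn_le hI hLc
    have hsub : codeSet ψ (rowsBelow B j) (T j) e ⊆
        (((fun χ => Code.lev (ψ e.1 χ)) '' L ∪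
        (fun p : V × V => Code.ord (ψ e.1 p.1) (ψ e.1 p.2)) '' (L ×ˢ L)) ∪
        ((fun p : (V × K) × (V × K) => Code.pred (ψ e.1 p.1.1) p.1.2 (ψ e.1 p.2.1) p.2.2) ''
          ((T j).nodesOn L ×ˢ (T j).nodesOn L) ∪
        (fun f : V × K × V × (I → K) => Code.fact (ψ e.1 f.1) f.2.1 (ψ e.1 f.2.2.1) f.2.2.2) ''
          (T j).factsOn L)) ∪
        ((fun p : V × K => Code.chain (ψ e.1 p.1) p.2) '' e.2.1 ∪
        {Code.goal (ψ e.1 e.2.2.1) e.2.2.2}) := by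
      intro z hz
      cases z with
      | lev a =>
        obtain ⟨χ, hχ, rfl⟩ := hz
        exact Or.inl (Or.inl (Or.inl ⟨χ, hχ, rfl⟩))
      | ord a b =>
        obtain ⟨χ, hχ, χ', hχ', h, rfl, rfl⟩ := hz
        exact Or.inl (Or.inl (Or.inr ⟨(χ, χ'), ⟨hχ, hχ'⟩, rfl⟩))
      | pred a n b m =>
        obtain ⟨χ, hχ, χ', hχ', h, rfl, rfl⟩ := hz
        exact Or.inl (Or.inr (Or.inl ⟨((χ, n), (χ', m)), ⟨⟨hχ, (hfine j).inv.P_left h⟩,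
          ⟨hχ', (hfine j).inv.P_right h⟩⟩, rfl⟩))
      | fact a c b w =>
        obtain ⟨χ, hχ, χ', hχ', h, rfl, rfl⟩ := hz
        exact Or.inl (Or.inr (Or.inr ⟨(χ, c, χ', w), ⟨hχ, h⟩, rfl⟩))
      | chain a n =>
        obtain ⟨p, hp, rfl, rfl⟩ := hz
        exact Or.inr (Or.inl ⟨p, hp, rfl⟩)
      | goal a y =>
        obtain ⟨rfl, rfl⟩ := hz
        exact Or.inr (Or.inr rfl)
    have hun : ∀ {s t : Set (Code K I)}, #s ≤ #I → #t ≤ #I → #(s ∪ t : Set (Code K I)) ≤ #I :=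
      fun hs ht => (mk_union_le _ _).trans (add_le_of_le hI hs ht)
    have hsq : ∀ {α : Type u} {s : Set α}, #s ≤ #I → #(s ×ˢ s : Set (α × α)) ≤ #I := by
      intro α s hs
      rw [mk_setProd]
      simpa using (mul_le_mul' hs hs).trans (mul_eq_self hI).le
    refine (mk_le_mk_of_subset hsub).trans (hun (hun (hun ?_ ?_) (hun ?_ ?_)) (hun ?_ ?_))
    · exact mk_image_le.trans hLc
    · exact mk_image_le.trans (hsq hLc)
    · exact mk_image_le.trans (hsq hn)
    · exact mk_image_le.trans hf
    · exact mk_image_le.trans hU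
    · rw [mk_singleton]; exact one_le_aleph0.trans hI
  · rintro j ⟨i₁, hi₁⟩ hlim z hz
    have lowlim : ∀ {χ}, χ ∈ lower (rowsBelow B j) e.1 →
        ∃ i < j, χ ∈ lower (rowsBelow B i) e.1 := by
      rintro χ (rfl | ⟨i, hi, h⟩)
      · exact ⟨i₁, hi₁, Or.inl rfl⟩
      · obtain ⟨i', h1, h2⟩ := hlim i hi
        exact ⟨i', h2, Or.inr ⟨i, h1, h⟩⟩
    cases z with
    | lev a =>
      obtain ⟨χ, hχ, h⟩ := hz
      obtain ⟨i, hi, hχ⟩ := lowlim hχ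
      exact ⟨i, hi, χ, hχ, h⟩
    | ord a b =>
      obtain ⟨χ, hχ, χ', hχ', h⟩ := hz
      obtain ⟨i, hi, hχ⟩ := lowlim hχ
      obtain ⟨i', hi', hχ'⟩ := lowlim hχ'
      exact ⟨max i i', max_lt hi hi', χ, hlow (le_max_left _ _) hχ, χ',
        hlow (le_max_right _ _) hχ', h⟩
    | pred a n b m =>
      obtain ⟨χ, hχ, χ', hχ', h, h'⟩ := hz
      obtain ⟨i, hi, hχ⟩ := lowlim hχ
      obtain ⟨i', hi', hχ'⟩ := lowlim hχ'
      obtain ⟨k, hk, hP⟩ := build_P_iff.1 h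
      obtain ⟨k', h1, h2⟩ := hlim k hk
      exact ⟨max (max i i') k', max_lt (max_lt hi hi') h2, χ,
        hlow ((le_max_left _ _).trans (le_max_left _ _)) hχ, χ',
        hlow ((le_max_right _ _).trans (le_max_left _ _)) hχ',
        build_P_iff.2 ⟨k, h1.trans_le (le_max_right _ _), hP⟩, h'⟩
    | fact a c b w =>
      obtain ⟨χ, hχ, χ', hχ', h, h'⟩ := hz
      obtain ⟨i, hi, hχ⟩ := lowlim hχ
      obtain ⟨i', hi', hχ'⟩ := lowlim hχ'
      obtain ⟨k, hk, hP⟩ := build_F_iff.1 h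
      obtain ⟨k', h1, h2⟩ := hlim k hk
      exact ⟨max (max i i') k', max_lt (max_lt hi hi') h2, χ,
        hlow ((le_max_left _ _).trans (le_max_left _ _)) hχ, χ',
        hlow ((le_max_right _ _).trans (le_max_left _ _)) hχ',
        build_F_iff.2 ⟨k, h1.trans_le (le_max_right _ _), hP⟩, h'⟩
    | chain a n => exact ⟨i₁, hi₁, hz⟩
    | goal a y => exact ⟨i₁, hi₁, hz⟩
  · rintro j ⟨hj, hAj⟩
    refine ⟨j, hj, ?_⟩
    have hex : ∃ e, ValidData e ∧ codeSet ψ (rowsBelow B j) (T j) e = A j := ⟨e, he, hAj.symm⟩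
    refine ⟨hex.choose, hex.choose_spec.1, ?_, ?_⟩
    · rw [guess, dif_pos hex]
    · rw [hex.choose_spec.2, hAj]

/-- A system in which all the predecessors are known, with many nodes over every small chain and
a colour for every relevant sequence. -/
structure Sys.IsRich (T : Sys V K I) : Prop where
  inv : T.Inv Iio
  node : ∀ (β : V) (U : Set (V × K)) (W : Set K), #U ≤ #I → #W ≤ #I → T.IsBranchPart U →
    (∀ p ∈ U, p.1 < β) → ∃ u, u ∉ W ∧ T.N β u ∧ ∀ p ∈ U, T.P β u p.1 p.2
  fact : ∀ (γ β : V) (y a : I → K), γ < β → Function.Injective a → (∀ s, T.P β (y s) γ (a s)) →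
    ∃ c, T.F β c γ y

/-- A task involves at most `#I` elements, relations and names to be avoided. By regularity all of
them are decided before some stage; a correct guess beyond it performs the task at the twin top, and
the copy performs it at the intended level. -/
theorem exists_isRich [NoMaxOrder V] (hI : ℵ₀ ≤ #I) (hK : #I < #K) (hKI : ∀ j : K, #(Iio j) ≤ #I)
    (hreg : ∀ s : Set K, #s ≤ #I → ∃ j, ∀ i ∈ s, i < j)
    (hB : IsMatrix B #I) (hA : Guesses A #I) (hψ : ∀ t, InjOn (ψ t) (Iic t)) :
    ∃ T : Sys V K I, T.IsRich := by
  classical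
  have hfine := fine (pick := guess B ψ A) hI hK hKI hB
  have hguess := fun {e} => exists_guess (e := e) (ψ := ψ) hI hK hKI hB hA
  set G := guess B ψ A with hG
  have hKne : Nonempty K := by
    rw [← mk_ne_zero_iff]; exact (lt_of_lt_of_le aleph0_pos (hI.trans hK.le)).ne'
  obtain ⟨k₀⟩ := hKne
  have hIne : Nonempty I := by
    rw [← mk_ne_zero_iff]; exact (lt_of_lt_of_le aleph0_pos hI).ne'
  have hreg' : ∀ {ι : Type u} (f : ι → K), #ι ≤ #I → ∃ j, ∀ i, f i < j := by
    intro ι f hι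
    obtain ⟨j, hj⟩ := hreg (range f) (mk_range_le.trans hι)
    exact ⟨j, fun i => hj _ ⟨i, rfl⟩⟩
  have hknown : ∀ η, (⋃ j, known B G j η) = Iio η := by
    intro η
    ext χ
    constructor
    · intro h
      obtain ⟨j, h⟩ := mem_iUnion.1 h
      exact (hB.isCoherent j).lt (known_subset h)
    · intro h
      obtain ⟨i, hi⟩ := hB.cover h
      -- The task is empty here: the guess serves only to have `η` extended at a stage later than
      -- the row containing `χ`.
      obtain ⟨j, hij, e₀, hv, hp, hc⟩ := hguess (e := (η, ∅, η, fun _ => k₀))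
        ⟨by simp, le_rfl⟩ (by simp) i
      obtain ⟨k, hjk⟩ := hreg {j} (by simpa using one_le_aleph0.trans hI)
      exact mem_iUnion.2 ⟨k, j, hjk j rfl,
        ⟨e₀, hp, good_of_codeSet_eq hψ (hB.isCoherent j) hc⟩, i, hij, hi⟩
  have hmono : ∀ {i j : K}, i ≤ j → ∀ {η n χ m}, (build B G i).P η n χ m →
    (build B G j).P η n χ m := fun hij => build_P_mono hij
  have hadd : ∀ {j e₀}, G j (build B G j) = some e₀ → addition B G j (build B G j) =
      (build B G j).pull (rowsBelow B j) e₀.1 ((build B G j).stage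
        (lower (rowsBelow B j) e₀.1) e₀.1 j e₀.2.1 e₀.2.2.1 e₀.2.2.2) := by
    intro j e₀ hp
    simp [addition, hp]
  have hnext : ∀ j : K, ∃ k, j < k := fun j => by
    obtain ⟨k, hk⟩ := hreg {j} (by simpa using one_le_aleph0.trans hI)
    exact ⟨k, hk j rfl⟩
  refine ⟨Sys.iUnion (build B G), ?_, ?_, ?_⟩
  · have h := Sys.Inv.iUnion (fun j => (hfine j).inv) hmono (fun hij => build_F_mono hij)
      (fun hij η => known_mono hij)
    have h2 : (fun η => ⋃ j, known B G j η) = Iio := funext hknown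
    rwa [h2] at h
  · intro β U W hU hW hUb hUβ
    have h1 : ∀ p : U, ∃ i, p.1.1 ∈ B i β := fun p => hB.cover (hUβ p.1 p.2)
    choose f1 hf1 using h1
    have h2 : ∀ p : U, ∃ i, (build B G i).N p.1.1 p.1.2 := fun p => hUb.node p.1 p.2
    choose f2 hf2 using h2
    have h3 : ∀ p : U × U, ∃ i, p.2.1.1 < p.1.1.1 →
        (build B G i).P p.1.1.1 p.1.1.2 p.2.1.1 p.2.1.2 := by
      intro p
      by_cases hlt : p.2.1.1 < p.1.1.1
      · obtain ⟨i, hi⟩ := hUb.comp _ p.1.2 _ p.2.2 hlt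
        exact ⟨i, fun _ => hi⟩
      · exact ⟨k₀, fun h => absurd h hlt⟩
    choose f3 hf3 using h3
    have h4 : ∀ n : W, ∃ i, (Sys.iUnion (build B G)).N β n.1 → (build B G i).N β n.1 := by
      intro n
      by_cases hn : (Sys.iUnion (build B G)).N β n.1
      · obtain ⟨i, hi⟩ := hn
        exact ⟨i, fun _ => hi⟩
      · exact ⟨k₀, fun h => absurd h hn⟩
    choose f4 hf4 using h4
    have hUU : #(U × U) ≤ #I := by
      rw [← mul_def]
      exact (mul_le_mul' hU hU).trans (mul_eq_self hI).le
    -- Beyond these stages the rows at `β` contain the levels of `U`, the nodes and the order of `U`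
    -- are decided, and every name in `W` that ever becomes a node of level `β` already is one.
    obtain ⟨j1, hj1⟩ := hreg' f1 hU
    obtain ⟨j2, hj2⟩ := hreg' f2 hU
    obtain ⟨j3, hj3⟩ := hreg' f3 hUU
    obtain ⟨j4, hj4⟩ := hreg' f4 hW
    obtain ⟨j, hj, e₀, hv, hp, hc⟩ := hguess (e := (β, U, β, fun _ => k₀)) ⟨hUβ, le_rfl⟩ hU
      (max (max j1 j2) (max j3 j4))
    obtain ⟨⟨hlt1, hlt2⟩, hlt3, hlt4⟩ : (j1 < j ∧ j2 < j) ∧ j3 < j ∧ j4 < j := by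
      simpa [max_lt_iff] using hj
    have hD := hB.isCoherent j
    have hg := good_of_codeSet_eq hψ hD hc
    have htop := twin_top_of_codeSet_eq hψ hD hc
    have hdata := data_of_codeSet_eq hψ hD hc hv
    simp only at hg htop hdata
    have hUD : ∀ p ∈ U, p.1 ∈ rowsBelow B j β := fun p hp =>
      ⟨_, (hj1 ⟨p, hp⟩).trans hlt1, hf1 ⟨p, hp⟩⟩
    have hUL : ∀ p ∈ U, p.1 ∈ lower (rowsBelow B j) β := fun p hp => Or.inr (hUD p hp)
    have hU₀ := hdata.2.2 hUL
    have hst := (hfine j).isStage hI hK hKI hB e₀.1 e₀.2.1 e₀.2.2.1 e₀.2.2.2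
    have hP : ∀ {χ χ' n m}, χ ∈ lower (rowsBelow B j) β → χ' ∈ lower (rowsBelow B j) χ →
        ((build B G j).P χ n χ' m ↔ (build B G j).P (twin (rowsBelow B j) e₀.1 χ) n
          (twin (rowsBelow B j) e₀.1 χ') m) := fun hχ hχ' => (hg _ hχ).2.1 _ hχ' _ _
    obtain ⟨u, hu1, hu2, hu3⟩ := hst.branch (by
        rw [hU₀]
        refine ⟨?_, ?_, ?_⟩
        · rintro _ ⟨p, hp, rfl⟩
          exact (hP (hUL p hp) (Or.inl rfl)).1
            (hmono ((hj2 ⟨p, hp⟩).trans hlt2).le (hf2 ⟨p, hp⟩))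
        · rintro _ ⟨p, hp, rfl⟩ _ ⟨q, hq, rfl⟩ he
          obtain rfl := hUb.uniq p hp q hq (hg.twin_inj hD (hUL p hp) (hUL q hq) he)
          rfl
        · rintro _ ⟨p, hp, rfl⟩ _ ⟨q, hq, rfl⟩ hlt
          have hlt' : q.1 < p.1 := by
            by_contra hcon
            exact absurd hlt (hg.twin_le hD (hUL q hq) (hUL p hp) (not_lt.1 hcon)).not_gt
          exact (hP (hUL p hp) (Or.inr (hD.mem (hUL p hp) (hUL q hq) hlt'))).1
            (hmono ((hj3 (⟨p, hp⟩, ⟨q, hq⟩)).trans hlt3).le (hf3 (⟨p, hp⟩, ⟨q, hq⟩) hlt')))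
      (by
        rw [hU₀]
        rintro _ ⟨p, hp, rfl⟩
        refine ⟨hg.twin_mem (hUL p hp), ?_⟩
        have := hg.twin_lt hD (Or.inl rfl) (hUL p hp) (hUβ p hp)
        rwa [htop] at this)
    obtain ⟨k, hk⟩ := hnext j
    have hnew : ∀ {χ m}, χ ∈ lower (rowsBelow B j) β →
        ((build B G j).stage (lower (rowsBelow B j) e₀.1) e₀.1 j e₀.2.1 e₀.2.2.1 e₀.2.2.2).P
          e₀.1 u (twin (rowsBelow B j) e₀.1 χ) m → (Sys.iUnion (build B G)).P β u χ m := by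
      intro χ m hχ h
      refine ⟨k, build_P_iff.2 ⟨j, hk, ?_⟩⟩
      rw [hadd hp]
      refine ⟨hg, hχ, ?_⟩
      rw [htop]; exact h
    have huN : (Sys.iUnion (build B G)).N β u :=
      hnew (Or.inl rfl) (by rw [htop]; exact hu1)
    refine ⟨u, fun huW => ?_, huN, fun p hp => ?_⟩
    -- A name in `W` would be a node of level `β` before stage `j`, whereas `u` is not one at the
    -- twin level.
    · have h5 := hmono ((hj4 ⟨u, huW⟩).trans hlt4).le (hf4 ⟨u, huW⟩ huN)
      have h6 := (hP (Or.inl rfl) (Or.inl rfl)).1 h5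
      rw [htop] at h6
      exact hu2 h6
    · exact hnew (hUL p hp) (hu3 (twin (rowsBelow B j) e₀.1 p.1, p.2) (by
        rw [hU₀]; exact ⟨p, hp, rfl⟩))
  · intro γ β y a hγβ ha hya
    obtain ⟨i₁, hi₁⟩ := hB.cover hγβ
    choose f hf using hya
    obtain ⟨j1, hj1⟩ := hreg' f le_rfl
    obtain ⟨j, hj, e₀, hv, hp, hc⟩ := hguess (e := (β, ∅, γ, y)) ⟨by simp, hγβ.le⟩ (by simp)
      (max i₁ j1)
    obtain ⟨hlt1, hlt2⟩ : i₁ < j ∧ j1 < j := by simpa [max_lt_iff] using hj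
    have hD := hB.isCoherent j
    have hg := good_of_codeSet_eq hψ hD hc
    have htop := twin_top_of_codeSet_eq hψ hD hc
    have hdata := data_of_codeSet_eq hψ hD hc hv
    simp only at hg htop hdata
    have hγL : γ ∈ lower (rowsBelow B j) β := Or.inr ⟨i₁, hlt1, hi₁⟩
    have hγ := hdata.2.1 hγL
    have hst := (hfine j).isStage hI hK hKI hB e₀.1 e₀.2.1 e₀.2.2.1 e₀.2.2.2
    have hF := hst.fact a ha (by
        have := hg.twin_lt hD (Or.inl rfl) hγL hγβ
        rwa [htop, hγ] at this)
      (fun s => by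
        have h1 := ((hg β (Or.inl rfl)).2.1 γ hγL (y s) (a s)).1
          (hmono ((hj1 s).trans hlt2).le (hf s))
        rwa [htop, hγ, ← hdata.1] at h1)
    obtain ⟨k, hk⟩ := hnext j
    refine ⟨j, k, build_F_iff.2 ⟨j, hk, ?_⟩⟩
    rw [hadd hp]
    refine ⟨hg, hγL, ?_⟩
    rw [htop, hγ, ← hdata.1]
    exact hF

end Final

/-! ### The matrix obtained from the square -/

section Matrix

variable [LinearOrder V]

/-- A square sequence on a well-ordered set: short cofinal sets `C β`, which are closed and coherent
for `β ∈ Γ`. -/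
structure IsShortSquare (Γ : Set V) (C : V → Set V) (c : Cardinal.{u}) : Prop where
  lt : ∀ {β ζ}, ζ ∈ C β → ζ < β
  cofinal : ∀ {β ζ}, ζ < β → ∃ ζ' ∈ C β, ζ ≤ ζ'
  small : ∀ {β ζ}, β ∈ Γ → ζ ∈ C β → #(C β ∩ Iio ζ : Set V) ≤ c
  small' : ∀ {β}, β ∉ Γ → #(C β) ≤ c
  closed : ∀ {β α}, β ∈ Γ → α < β → (∃ ζ ∈ C β, ζ < α) →
    (∀ ζ < α, ∃ ζ' ∈ C β, ζ < ζ' ∧ ζ' < α) → α ∈ C β ∧ α ∈ Γ ∧ C α = C β ∩ Iio α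

theorem isCoherent_Iio {K : Type u} [LinearOrder K] : IsCoherent (fun k : K => Iio k) :=
  ⟨fun h => h, fun {η χ} h => by
    ext ξ
    exact ⟨fun hξ => ⟨lt_trans hξ h, hξ⟩, fun hξ => hξ.2⟩⟩

theorem isCoherent_inter (s : Set V) : IsCoherent (fun ζ => s ∩ Iio ζ) :=
  ⟨fun h => h.2, fun {η χ} h => by
    ext ξ
    exact ⟨fun hξ => ⟨⟨hξ.1, hξ.2.trans h.2⟩, hξ.2⟩, fun hξ => ⟨hξ.1.1, hξ.2⟩⟩⟩

variable [WellFoundedLT V]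

theorem rk_inter_congr {s s' : Set V} {ζ : V} (h : s ∩ Iio ζ = s' ∩ Iio ζ) :
    rk (fun ζ => s ∩ Iio ζ) ζ = rk (fun ζ => s' ∩ Iio ζ) ζ := by
  induction ζ using WellFoundedLT.induction with
  | ind ζ ih =>
    have key : ∀ χ < ζ, rk (fun ζ => s ∩ Iio ζ) χ = rk (fun ζ => s' ∩ Iio ζ) χ := by
      intro χ hχ
      refine ih χ hχ ?_
      ext ξ
      have := Set.ext_iff.1 h ξ
      constructor
      · exact fun hξ => ⟨(this.1 ⟨hξ.1, hξ.2.trans hχ⟩).1, hξ.2⟩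
      · exact fun hξ => ⟨(this.2 ⟨hξ.1, hξ.2.trans hχ⟩).1, hξ.2⟩
    refine eq_of_forall_lt_iff (fun o => ?_)
    rw [lt_rk_iff (isCoherent_inter s), lt_rk_iff (isCoherent_inter s')]
    rw [h]
    exact exists_congr fun χ => and_congr_right fun hχ => by rw [key χ hχ.2]

theorem IsCoherent.card_rk_le {D : V → Set V} (hD : IsCoherent D) (η : V) :
    (rk D η).card ≤ #(D η) := by
  have h1 : Iio (rk D η) ⊆ rk D '' D η := fun o ho =>
    let ⟨χ, hχ, he⟩ := hD.exists_rk_eq ho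
    ⟨χ, hχ, he⟩
  have h2 : #(rk D '' D η) ≤ lift.{u + 1} #(D η) := by
    have h := mk_image_le_lift (f := rk D) (s := D η)
    rwa [lift_id'.{u, u + 1}] at h
  have h3 := (mk_le_mk_of_subset h1).trans h2
  rw [mk_Iio_ordinal, lift_le] at h3
  exact h3

variable [LinearOrder K] [WellFoundedLT K]

/-- The position of `j` in `K`. -/
noncomputable def pos (j : K) : Ordinal.{u} := rk (fun k : K => Iio k) j

theorem pos_lt {i j : K} (h : i < j) : pos i < pos j :=
  isCoherent_Iio.rk_lt (χ := i) (η := j) h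

theorem exists_le_pos (hK : #I < #K) {o : Ordinal.{u}} (ho : o.card ≤ #I) : ∃ j : K, o ≤ pos j := by
  by_contra! hcon
  have hinj : Function.Injective (pos : K → Ordinal.{u}) := by
    intro i j h
    rcases lt_trichotomy i j with h1 | h1 | h1
    · exact absurd h (pos_lt h1).ne
    · exact h1
    · exact absurd h (pos_lt h1).ne'
  have h1 : range (pos : K → Ordinal.{u}) ⊆ Iio o := by
    rintro _ ⟨j, rfl⟩; exact hcon j
  have h2 := mk_le_mk_of_subset h1
  have h3 := mk_range_eq_of_injective hinj
  rw [mk_Iio_ordinal] at h2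
  rw [lift_id'.{u, u + 1}] at h3
  rw [h3, lift_le] at h2
  exact absurd (h2.trans ho) hK.not_ge

/-- The first elements of `C β`. -/
def front (C : V → Set V) (j : K) (β : V) : Set V :=
  {ζ | ζ ∈ C β ∧ rk (fun ξ => C β ∩ Iio ξ) ζ ≤ pos j}

/-- The part of `C β` that is used in the `j`-th row at `β`. -/
def useful (Γ : Set V) (C : V → Set V) (b : V → K → Set V) (j : K) (β : V) : Set V :=
  {ζ | ζ ∈ C β ∧ (β ∈ Γ → ζ ∈ front C j β) ∧
    ∀ ζ₁ ∈ C β, ∀ ζ₂ ∈ C β, ζ₁ < ζ₂ → (β ∈ Γ → ζ₂ ≤ ζ) → ζ₁ ∈ b ζ₂ j}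

variable {Γ : Set V} {C : V → Set V} {c : Cardinal.{u}}

theorem exists_rows (hC : IsShortSquare Γ C c) : ∃ b : V → K → Set V, ∀ β j,
    b β j = {χ | ∃ ζ ∈ useful Γ C b j β, χ ∈ insert ζ (b ζ j)} := by
  have hcongr : ∀ β (f g : V → K → Set V), (∀ ζ < β, f ζ = g ζ) → ∀ j,
      {χ | ∃ ζ ∈ useful Γ C f j β, χ ∈ insert ζ (f ζ j)} =
      {χ | ∃ ζ ∈ useful Γ C g j β, χ ∈ insert ζ (g ζ j)} := by
    intro β f g h j
    have h1 : useful Γ C f j β = useful Γ C g j β := by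
      ext ζ
      refine and_congr_right fun _ => and_congr_right fun _ => ?_
      refine forall₂_congr fun ζ₁ _ => forall₂_congr fun ζ₂ h2 => ?_
      rw [h ζ₂ (hC.lt h2)]
    ext χ
    simp only [h1, mem_ofPred_eq]
    refine exists_congr fun ζ => and_congr_right fun hζ => ?_
    rw [h ζ (hC.lt hζ.1)]
  obtain ⟨b, hb⟩ := exists_wf_rec (V := V) (A := K → Set V)
    (fun β b => ∀ j, b β j = {χ | ∃ ζ ∈ useful Γ C b j β, χ ∈ insert ζ (b ζ j)})
    (fun β f g h hf j => by
      rw [← h β le_rfl, hf j]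
      exact hcongr β f g (fun ζ hζ => h ζ hζ.le) j)
    (fun β f _ => by
      refine ⟨Function.update f β (fun j => {χ | ∃ ζ ∈ useful Γ C f j β, χ ∈ insert ζ (f ζ j)}),
        fun ζ hζ => Function.update_of_ne hζ.ne _ _, fun j => ?_⟩
      rw [Function.update_self]
      exact hcongr β _ _ (fun ζ hζ => (Function.update_of_ne hζ.ne _ _).symm) j)
  exact ⟨b, hb⟩

section Rows

variable {b : V → K → Set V}

theorem useful_pair {β : V} {j : K} {ζ₁ ζ₂ : V} (h₁ : ζ₁ ∈ useful Γ C b j β)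
    (h₂ : ζ₂ ∈ useful Γ C b j β) (hlt : ζ₁ < ζ₂) : ζ₁ ∈ b ζ₂ j :=
  h₂.2.2 ζ₁ h₁.1 ζ₂ h₂.1 hlt (fun _ => le_rfl)

theorem row_lt (hC : IsShortSquare Γ C c)
    (hb : ∀ β j, b β j = {χ | ∃ ζ ∈ useful Γ C b j β, χ ∈ insert ζ (b ζ j)}) {j : K} {β χ : V}
    (h : χ ∈ b β j) : χ < β := by
  induction β using WellFoundedLT.induction generalizing χ with
  | ind β ih =>
    rw [hb] at h
    obtain ⟨ζ, hζ, rfl | h⟩ := h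
    · exact hC.lt hζ.1
    · exact (ih ζ (hC.lt hζ.1) h).trans (hC.lt hζ.1)

/-- Of two useful elements at `β`, the smaller belongs to the `j`-th row at the larger. The row at
`β` is therefore an increasing union of pieces `lower D ζ`, which cohere by induction. -/
theorem row_coh (hC : IsShortSquare Γ C c)
    (hb : ∀ β j, b β j = {χ | ∃ ζ ∈ useful Γ C b j β, χ ∈ insert ζ (b ζ j)}) {j : K} {β χ : V}
    (h : χ ∈ b β j) : b χ j = b β j ∩ Iio χ := by
  induction β using WellFoundedLT.induction generalizing χ with
  | ind β ih =>
    -- The rows are cut off at `β`, since coherence is so far known only below `β`.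
    have hD : IsCoherent (fun ζ => {χ | ζ < β ∧ χ ∈ b ζ j}) := by
      refine ⟨fun h => row_lt hC hb h.2, ?_⟩
      rintro η χ ⟨hη, hχ⟩
      have h1 := ih η hη hχ
      have h2 := (row_lt hC hb hχ).trans hη
      ext ξ
      have := Set.ext_iff.1 h1 ξ
      exact ⟨fun hξ => ⟨⟨hη, (this.1 hξ.2).1⟩, (this.1 hξ.2).2⟩,
        fun hξ => ⟨h2, this.2 ⟨hξ.1.2, hξ.2⟩⟩⟩
    set D := fun ζ => {χ | ζ < β ∧ χ ∈ b ζ j} with hDdef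
    have hmem : ∀ {χ}, χ ∈ b β j ↔ ∃ ζ ∈ useful Γ C b j β, χ ∈ lower D ζ := by
      intro χ
      rw [hb β j]
      refine exists_congr fun ζ => and_congr_right fun hζ => or_congr_right ?_
      exact ⟨fun h => ⟨hC.lt hζ.1, h⟩, fun h => h.2⟩
    have hup : ∀ {ζ ζ'}, ζ ∈ useful Γ C b j β → ζ' ∈ useful Γ C b j β → ζ ≤ ζ' →
        lower D ζ ⊆ lower D ζ' := by
      intro ζ ζ' hζ hζ' hle
      rcases hle.lt_or_eq with hlt | rfl
      · exact hD.lower_subset (Or.inr ⟨hC.lt hζ'.1, useful_pair hζ hζ' hlt⟩)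
      · exact Subset.rfl
    obtain ⟨ζ, hζ, hχ⟩ := hmem.1 h
    have hχβ := row_lt hC hb h
    ext ξ
    constructor
    · intro hξ
      refine ⟨hmem.2 ⟨ζ, hζ, hD.lower_subset hχ (Or.inr ⟨hχβ, hξ⟩)⟩, row_lt hC hb hξ⟩
    · rintro ⟨hξ, hlt⟩
      obtain ⟨ζ', hζ', hξ'⟩ := hmem.1 hξ
      rcases le_total ζ ζ' with hle | hle
      · exact (hD.mem (hup hζ hζ' hle hχ) hξ' hlt).2
      · exact (hD.mem hχ (hup hζ' hζ hle hξ') hlt).2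

theorem useful_mono (hbm : ∀ {i j : K}, i ≤ j → ∀ {β}, b β i ⊆ b β j) {i j : K} (hij : i ≤ j)
    {β : V} : useful Γ C b i β ⊆ useful Γ C b j β := by
  rintro ζ ⟨h1, h2, h3⟩
  refine ⟨h1, fun hβ => ⟨(h2 hβ).1, (h2 hβ).2.trans ?_⟩,
    fun ζ₁ hζ₁ ζ₂ hζ₂ hlt hle => hbm hij (h3 ζ₁ hζ₁ ζ₂ hζ₂ hlt hle)⟩
  rcases hij.lt_or_eq with h | rfl
  · exact (pos_lt h).le
  · exact le_rfl

theorem row_mono (hC : IsShortSquare Γ C c)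
    (hb : ∀ β j, b β j = {χ | ∃ ζ ∈ useful Γ C b j β, χ ∈ insert ζ (b ζ j)}) {i j : K}
    (hij : i ≤ j) {β : V} : b β i ⊆ b β j := by
  induction β using WellFoundedLT.induction with
  | ind β ih =>
    intro χ hχ
    rw [hb] at hχ ⊢
    obtain ⟨ζ, ⟨h1, h2, h3⟩, hχ⟩ := hχ
    refine ⟨ζ, ⟨h1, fun hβ => ⟨(h2 hβ).1, (h2 hβ).2.trans ?_⟩,
      fun ζ₁ hζ₁ ζ₂ hζ₂ hlt hle => ih ζ₂ (hC.lt hζ₂) (h3 ζ₁ hζ₁ ζ₂ hζ₂ hlt hle)⟩,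
      hχ.imp_right (fun h => ih ζ (hC.lt h1) h)⟩
    rcases hij.lt_or_eq with h | rfl
    · exact (pos_lt h).le
    · exact le_rfl

end Rows

theorem mk_front_le (hc : ℵ₀ ≤ c) (hKI : ∀ j : K, #(Iio j) ≤ c) (j : K) (β : V) :
    #(front C j β) ≤ c := by
  have hD := isCoherent_inter (C β)
  have hinj : InjOn (rk (fun ξ => C β ∩ Iio ξ)) (front C j β) := by
    intro ζ hζ ζ' hζ' h
    rcases lt_trichotomy ζ ζ' with h1 | h1 | h1
    · exact absurd h (hD.rk_lt (χ := ζ) (η := ζ') ⟨hζ.1, h1⟩).ne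
    · exact h1
    · exact absurd h (hD.rk_lt (χ := ζ') (η := ζ) ⟨hζ'.1, h1⟩).ne'
  have h1 := mk_image_eq_of_injOn_lift _ _ hinj
  rw [lift_id'.{u, u + 1}] at h1
  have h2 : rk (fun ξ => C β ∩ Iio ξ) '' front C j β ⊆ Iio (succ (pos j)) := by
    rintro _ ⟨ζ, hζ, rfl⟩
    exact lt_succ_iff.2 hζ.2
  have h3 := mk_le_mk_of_subset h2
  rw [h1, mk_Iio_ordinal, lift_le, Order.succ_eq_add_one, Ordinal.card_add, Ordinal.card_one]
    at h3
  exact h3.trans (add_le_of_le hc ((isCoherent_Iio.card_rk_le j).trans (hKI j))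
    (one_le_aleph0.trans hc))

/-- Regularity of `K` gives exhaustion: the conditions on a useful element concern at most `#I`
pairs. For anchors with `η ∈ Γ`, the elements useful before row `i` form an initial segment of `C
η`. If it is nonempty and bounded with no maximum, its supremum lies in `C η` by closure and has the
same rows below `i` by coherence of the square. -/
theorem exists_isMatrix (hI : ℵ₀ ≤ #I) (hK : #I < #K) (hKI : ∀ j : K, #(Iio j) ≤ #I)
    (hreg : ∀ s : Set K, #s ≤ #I → ∃ j, ∀ i ∈ s, i < j) (hC : IsShortSquare Γ C #I) :
    ∃ B : K → V → Set V, IsMatrix B #I := by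
  classical
  obtain ⟨b, hb⟩ := exists_rows (K := K) hC
  have hmono : ∀ {i j : K}, i ≤ j → ∀ {β}, b β i ⊆ b β j := fun hij _ => row_mono hC hb hij
  have hmem : ∀ {β j χ}, χ ∈ b β j ↔ ∃ ζ ∈ useful Γ C b j β, χ = ζ ∨ χ ∈ b ζ j := by
    intro β j χ
    rw [hb]; rfl
  have hbelow : ∀ {i β χ}, χ ∈ rowsBelow (fun j β => b β j) i β ↔
      ∃ i' < i, ∃ ζ ∈ useful Γ C b i' β, χ = ζ ∨ χ ∈ b ζ i' := by
    intro i β χ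
    exact exists_congr fun i' => and_congr_right fun _ => hmem
  have hreg' : ∀ {ι : Type u} (f : ι → K), #ι ≤ #I → ∃ j, ∀ i, f i < j := by
    intro ι f hι
    obtain ⟨j, hj⟩ := hreg (range f) (mk_range_le.trans hι)
    exact ⟨j, fun i => hj _ ⟨i, rfl⟩⟩
  have hfrontmono : ∀ {i j : K} {β}, i ≤ j → front C i β ⊆ front C j β := by
    rintro i j β hij ζ ⟨h1, h2⟩
    refine ⟨h1, h2.trans ?_⟩
    rcases hij.lt_or_eq with h | rfl
    · exact (pos_lt h).le
    · exact le_rfl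
  refine ⟨fun j β => b β j, fun h => row_lt hC hb h, fun hij => hmono hij, ?_,
    fun h => row_coh hC hb h, ?_, ?_⟩
  · -- exhaustion
    intro β
    induction β using WellFoundedLT.induction with
    | ind β ih =>
      have huse : ∀ ζ ∈ C β, ∃ j, ζ ∈ useful Γ C b j β := by
        intro ζ hζ
        -- The elements that matter for `ζ` to be useful: an initial part of `C β` if `β ∈ Γ`, and
        -- otherwise all of it, which is then small.
        let X : Set V := {ξ | ξ ∈ C β ∧ (β ∈ Γ → ξ ≤ ζ)}
        have hX : #X ≤ #I := by
          by_cases hβ : β ∈ Γ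
          · have : X ⊆ insert ζ (C β ∩ Iio ζ) := fun ξ hξ =>
              (hξ.2 hβ).lt_or_eq.elim (fun h => Or.inr ⟨hξ.1, h⟩) Or.inl
            exact (mk_le_mk_of_subset this).trans (mk_insert_le.trans
              (add_le_of_le hI (hC.small hβ hζ) (one_le_aleph0.trans hI)))
          · exact (mk_le_mk_of_subset (fun ξ hξ => hξ.1)).trans (hC.small' hβ)
        have h1 : ∀ p : X × X, ∃ i, p.1.1 < p.2.1 → p.1.1 ∈ b p.2.1 i := by
          intro p
          by_cases hlt : p.1.1 < p.2.1
          · obtain ⟨i, hi⟩ := ih p.2.1 (hC.lt p.2.2.1) hlt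
            exact ⟨i, fun _ => hi⟩
          · obtain ⟨j, _⟩ := hreg ∅ (by simp)
            exact ⟨j, fun h => absurd h hlt⟩
        choose f hf using h1
        obtain ⟨j1, hj1⟩ := hreg' f (by
          rw [← mul_def]
          exact (mul_le_mul' hX hX).trans (mul_eq_self hI).le)
        obtain ⟨j2, hj2⟩ : ∃ j : K, β ∈ Γ → ζ ∈ front C j β := by
          by_cases hβ : β ∈ Γ
          · obtain ⟨j, hj⟩ := exists_le_pos hK
              (((isCoherent_inter (C β)).card_rk_le ζ).trans (hC.small hβ hζ))
            exact ⟨j, fun _ => ⟨hζ, hj⟩⟩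
          · exact ⟨j1, fun h => absurd h hβ⟩
        refine ⟨max j1 j2, hζ, fun hβ => hfrontmono (le_max_right _ _) (hj2 hβ), ?_⟩
        intro ζ₁ hζ₁ ζ₂ hζ₂ hlt hle
        exact hmono ((hj1 (⟨ζ₁, hζ₁, fun h => hlt.le.trans (hle h)⟩, ⟨ζ₂, hζ₂, hle⟩)).le.trans
          (le_max_left _ _)) (hf (⟨ζ₁, hζ₁, fun h => hlt.le.trans (hle h)⟩, ⟨ζ₂, hζ₂, hle⟩) hlt)
      intro χ hχ
      obtain ⟨ζ, hζ, hle⟩ := hC.cofinal hχ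
      obtain ⟨j, hj⟩ := huse ζ hζ
      rcases hle.lt_or_eq with hlt | rfl
      · obtain ⟨i, hi⟩ := ih ζ (hC.lt hζ) hlt
        exact ⟨max i j, hmem.2 ⟨ζ, useful_mono hmono (le_max_right _ _) hj,
          Or.inr (hmono (le_max_left _ _) hi)⟩⟩
      · exact ⟨j, hmem.2 ⟨χ, hj, Or.inl rfl⟩⟩
  · -- smallness
    intro j β
    induction β using WellFoundedLT.induction with
    | ind β ih =>
      have hu : #(useful Γ C b j β) ≤ #I := by
        by_cases hβ : β ∈ Γ
        · exact (mk_le_mk_of_subset (fun ζ hζ => hζ.2.1 hβ)).trans (mk_front_le hI hKI j β)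
        · exact (mk_le_mk_of_subset (fun ζ hζ => hζ.1)).trans (hC.small' hβ)
      have : b β j = ⋃ ζ : useful Γ C b j β, insert ζ.1 (b ζ.1 j) := by
        ext χ
        rw [hmem]
        simp
      beta_reduce at ih ⊢
      rw [this]
      exact mk_iUnion_le_of_le hI hu (fun ζ => mk_insert_le.trans
        (add_le_of_le hI (ih ζ.1 (hC.lt ζ.2.1)) (one_le_aleph0.trans hI)))
  · -- anchors
    intro i η
    by_cases hη : η ∈ Γ
    swap
    -- Outside `Γ` the conditions do not depend on the element: either nothing in `C η` is useful in
    -- a row, or all of it is, and `C η` is cofinal.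
    · by_cases hex : ∃ i' < i, ∃ ζ, ζ ∈ useful Γ C b i' η
      · obtain ⟨i', hi', ζ, hζ⟩ := hex
        right; left
        intro ξ hξ
        obtain ⟨ζ', hζ', hle⟩ := hC.cofinal hξ
        refine ⟨ζ', hbelow.2 ⟨i', hi', ζ', ⟨hζ', fun h => absurd h hη, ?_⟩, Or.inl rfl⟩, hle⟩
        exact fun ζ₁ h1 ζ₂ h2 hlt _ => hζ.2.2 ζ₁ h1 ζ₂ h2 hlt (fun h => absurd h hη)
      · left
        intro χ hχ
        obtain ⟨i', hi', ζ, hζ, _⟩ := hbelow.1 hχ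
        exact hex ⟨i', hi', ζ, hζ⟩
    let X : Set V := {ζ | ∃ i' < i, ζ ∈ useful Γ C b i' η}
    have hXD : ∀ {ζ}, ζ ∈ X → ζ ∈ rowsBelow (fun j β => b β j) i η := fun ⟨i', hi', h⟩ =>
      hbelow.2 ⟨i', hi', _, h, Or.inl rfl⟩
    have hDX : ∀ {χ}, χ ∈ rowsBelow (fun j β => b β j) i η → ∃ ζ ∈ X, χ ≤ ζ := by
      intro χ hχ
      obtain ⟨i', hi', ζ, hζ, h⟩ := hbelow.1 hχ
      exact ⟨ζ, ⟨i', hi', hζ⟩, h.elim (fun h => h.le) (fun h => (row_lt hC hb h).le)⟩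
    have hXC : ∀ {ζ}, ζ ∈ X → ζ ∈ C η := fun ⟨_, _, h⟩ => h.1
    by_cases hemp : ∀ ζ, ζ ∉ X
    · left
      intro χ hχ
      obtain ⟨ζ, hζ, _⟩ := hDX hχ
      exact hemp ζ hζ
    right
    by_cases hcof : ∀ ζ < η, ∃ ζ' ∈ X, ζ ≤ ζ'
    · left
      intro ζ hζ
      obtain ⟨ζ', h1, h2⟩ := hcof ζ hζ
      exact ⟨ζ', hXD h1, h2⟩
    right
    by_cases hmax : ∃ ζ ∈ X, ∀ χ ∈ X, χ ≤ ζ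
    · left
      obtain ⟨ζ, hζ, hle⟩ := hmax
      refine ⟨ζ, hXD hζ, fun χ hχ => ?_⟩
      obtain ⟨ζ', h1, h2⟩ := hDX hχ
      exact h2.trans (hle ζ' h1)
    right
    push Not at hemp hcof hmax
    obtain ⟨ζ₀, hζ₀⟩ := hemp
    obtain ⟨ξ₀, hξ₀, hbd⟩ := hcof
    -- The supremum of the useful elements; as there is no greatest one, it is a limit of `C η` and
    -- the square applies to it.
    obtain ⟨α, hα, hmin⟩ := WellFounded.has_min (wellFounded_lt (α := V))
      {α | ∀ ζ ∈ X, ζ < α} ⟨ξ₀, hbd⟩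
    have hαη : α < η := lt_of_le_of_lt (not_lt.1 (hmin ξ₀ hbd)) hξ₀
    have hlim : ∀ ζ < α, ∃ ζ' ∈ X, ζ < ζ' := by
      intro ζ hζ
      have : ¬ ∀ ζ' ∈ X, ζ' < ζ := fun h => hmin ζ h hζ
      push Not at this
      obtain ⟨ζ', h1, h2⟩ := this
      obtain ⟨ζ'', h3, h4⟩ := hmax ζ' h1
      exact ⟨ζ'', h3, h2.trans_lt h4⟩
    obtain ⟨hαC, hαΓ, hCα⟩ := hC.closed hη hαη ⟨ζ₀, hXC hζ₀, hα ζ₀ hζ₀⟩ (fun ζ hζ => by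
      obtain ⟨ζ', h1, h2⟩ := hlim ζ hζ
      exact ⟨ζ', hXC h1, h2, hα ζ' h1⟩)
    have hrk : ∀ {ζ}, ζ < α → rk (fun ξ => C α ∩ Iio ξ) ζ = rk (fun ξ => C η ∩ Iio ξ) ζ := by
      intro ζ hζ
      refine rk_inter_congr ?_
      rw [hCα]
      ext ξ
      exact ⟨fun h => ⟨h.1.1, h.2⟩, fun h => ⟨⟨h.1, lt_trans h.2 hζ⟩, h.2⟩⟩
    -- the useful parts at `α` and at `η` are the same below `α`
    have huse : ∀ {i' ζ}, ζ < α → (ζ ∈ useful Γ C b i' α ↔ ζ ∈ useful Γ C b i' η) := by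
      intro i' ζ hζ
      constructor
      · rintro ⟨h1, h2, h3⟩
        rw [hCα] at h1
        refine ⟨h1.1, fun _ => ⟨h1.1, ?_⟩, fun ζ₁ h4 ζ₂ h5 hlt hle => ?_⟩
        · rw [← hrk hζ]; exact (h2 hαΓ).2
        · have h6 := (hle hη).trans_lt hζ
          exact h3 ζ₁ (by rw [hCα]; exact ⟨h4, hlt.trans h6⟩) ζ₂ (by rw [hCα]; exact ⟨h5, h6⟩) hlt
            (fun _ => hle hη)
      · rintro ⟨h1, h2, h3⟩
        have h1' : ζ ∈ C α := by rw [hCα]; exact ⟨h1, hζ⟩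
        refine ⟨h1', fun _ => ⟨h1', ?_⟩, fun ζ₁ h4 ζ₂ h5 hlt hle => ?_⟩
        · rw [hrk hζ]; exact (h2 hη).2
        · rw [hCα] at h4 h5
          exact h3 ζ₁ h4.1 ζ₂ h5.1 hlt (fun _ => hle hαΓ)
    have hinit : ∀ {ζ}, ζ ∈ C η → ζ < α → ∃ i' < i, ζ ∈ useful Γ C b i' η := by
      intro ζ hζ hζα
      obtain ⟨ζ', ⟨i', hi', h1, h2, h3⟩, hlt⟩ := hlim ζ hζα
      refine ⟨i', hi', hζ, fun _ => ⟨hζ, ?_⟩, fun ζ₁ h4 ζ₂ h5 hlt' hle =>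
        h3 ζ₁ h4 ζ₂ h5 hlt' (fun _ => (hle hη).trans hlt.le)⟩
      exact ((isCoherent_inter (C η)).rk_lt (χ := ζ) (η := ζ') ⟨hζ, hlt⟩).le.trans (h2 hη).2
    have hrow : ∀ i' < i, b α i' = b η i' := by
      intro i' hi'
      ext χ
      rw [hmem, hmem]
      refine exists_congr fun ζ => and_congr_left fun _ => ?_
      constructor
      · exact fun h => (huse (hC.lt h.1)).1 h
      · exact fun h => (huse (hα ζ ⟨i', hi', h⟩)).2 h
    -- The anchor itself enters at row `i`: elements of `C η` below `α` are useful in rows before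
    -- `i`, so their ranks are below `pos i` and that of `α` is at most `pos i`.
    refine ⟨α, hmem.2 ⟨α, ⟨hαC, fun _ => ⟨hαC, ?_⟩, ?_⟩, Or.inl rfl⟩, ?_, hrow⟩
    · refine le_of_not_gt (fun hlt => ?_)
      obtain ⟨ζ, hζ, hle⟩ := (lt_rk_iff (isCoherent_inter (C η))).1 hlt
      obtain ⟨i', hi', h⟩ := hinit hζ.1 hζ.2
      exact absurd (hle.trans (h.2.1 hη).2) (pos_lt hi').not_ge
    · intro ζ₁ h1 ζ₂ h2 hlt hle
      rcases (hle hη).lt_or_eq with h3 | rfl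
      · obtain ⟨i', hi', h⟩ := hinit h2 h3
        exact hmono hi'.le (h.2.2 ζ₁ h1 ζ₂ h2 hlt (fun _ => le_rfl))
      · obtain ⟨i', hi', h⟩ := hinit h1 hlt
        exact hmem.2 ⟨ζ₁, useful_mono hmono hi'.le ((huse hlt).2 h), Or.inl rfl⟩
    · intro χ hχ
      obtain ⟨ζ, hζ, hle⟩ := hDX hχ
      exact hle.trans_lt (hα ζ hζ)

end Matrix

/-! ### From a rich system to a rich tree -/

section Tree

variable [LinearOrder V]

/-- A tree with levels in `V` such that each small chain has many upper bounds, and such that one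
cannot run through the tree along many incomparable combs. -/
structure IsRichTree (K I : Type u) {N : Type u} [PartialOrder N] (lvl : N → V) : Prop where
  lt : ∀ {p q}, p < q → lvl p < lvl q
  restr : ∀ {q χ}, χ ≤ lvl q → ∃ p ≤ q, lvl p = χ
  comp : ∀ {p p' q}, p ≤ q → p' ≤ q → lvl p ≤ lvl p' → p ≤ p'
  card : ∀ η, #{p | lvl p = η} ≤ #K
  node : ∀ (β : V) (U W : Set N), #U ≤ #I → #W ≤ #I → (∀ p ∈ U, ∀ q ∈ U, p ≤ q ∨ q ≤ p) →
    (∀ p ∈ U, lvl p < β) → ∃ u, u ∉ W ∧ lvl u = β ∧ ∀ p ∈ U, p ≤ u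
  star : ∀ (γ : V) (a : I → N), Function.Injective a → (∀ s, lvl (a s) = γ) →
    ∀ (f : V → V) (y : V → I → N), (∀ β, β < f β) → (∀ β, γ < f β) → (∀ β s, lvl (y β s) = f β) →
    (∀ β s, a s ≤ y β s) → ∃ β β' s, f β ≤ β' ∧ y β s ≤ y β' s

theorem Sys.Inv.trans' {T : Sys V K I} (h : T.Inv Iio) {η n ξ m χ k} (h1 : T.P η n ξ m)
    (h2 : T.P ξ m χ k) : T.P η n χ k := by
  have h' : T.Inv (fun η => Set.univ ∩ Iio η) := by
    have : (fun η : V => Set.univ ∩ Iio η) = Iio := funext fun η => Set.univ_inter _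
    rwa [this]
  exact h'.trans h1 h2

/-- The nodes of a system. -/
def Sys.Node (T : Sys V K I) : Type u := {p : V × K // T.N p.1 p.2}

/-- The level of a node. -/
def Sys.Node.lvl {T : Sys V K I} (p : T.Node) : V := p.1.1

/-- The tree order on the nodes of a system. -/
@[reducible]
def Sys.Inv.partialOrder {T : Sys V K I} (h : T.Inv Iio) : PartialOrder T.Node where
  le p q := T.P q.1.1 q.1.2 p.1.1 p.1.2
  le_refl p := p.2
  le_trans _ _ _ h1 h2 := h.trans' h2 h1
  le_antisymm p q h1 h2 := by
    have he : p.1.1 = q.1.1 := le_antisymm (h.P_le h1) (h.P_le h2)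
    refine Subtype.ext (Prod.ext he ?_)
    rw [he] at h1
    exact h.P_unique h1 q.2

/-- The clause `star` is a pigeonhole: `V` is not a union of `#K` bounded sets, so some colour
occurs at two levels far enough apart, and projecting the higher sequence to the level of the lower
one makes them agree at some index. -/
theorem Sys.IsRich.isRichTree [Nonempty V] (hI : ℵ₀ ≤ #I)
    (hV : ∀ s : Set V, #s ≤ #K → ∃ b, ∀ η ∈ s, η < b) {T : Sys V K I} (hT : T.IsRich) :
    letI := hT.inv.partialOrder
    IsRichTree K I (Sys.Node.lvl : T.Node → V) := by
  let := hT.inv.partialOrder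
  have hle : ∀ {p q : T.Node}, p ≤ q ↔ T.P q.1.1 q.1.2 p.1.1 p.1.2 := Iff.rfl
  refine ⟨?_, ?_, ?_, ?_, ?_, ?_⟩
  · intro p q hlt
    refine lt_of_le_of_ne (hT.inv.P_le (hle.1 hlt.le)) (fun he => hlt.ne ?_)
    refine Subtype.ext (Prod.ext he ?_)
    have h1 := hle.1 hlt.le
    rw [show p.1.1 = q.1.1 from he] at h1
    exact (hT.inv.P_unique q.2 h1).symm
  · intro q χ hχ
    rcases hχ.lt_or_eq with hlt | rfl
    · obtain ⟨m, hm⟩ := hT.inv.P_ex q.2 hlt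
      exact ⟨⟨(χ, m), hT.inv.P_right hm⟩, hm, rfl⟩
    · exact ⟨q, le_rfl, rfl⟩
  · intro p p' q h1 h2 hl
    rcases hl.lt_or_eq with hlt | he
    · exact hT.inv.P_comp h2 h1 hlt
    · have : p = p' := by
        refine Subtype.ext (Prod.ext he ?_)
        have h1' := hle.1 h1
        rw [show p.1.1 = p'.1.1 from he] at h1'
        exact hT.inv.P_unique h1' h2
      exact this.le
  · intro η
    refine mk_le_of_injective (f := fun p : {p : T.Node | p.lvl = η} => p.1.1.2) ?_
    intro p q h
    exact Subtype.ext (Subtype.ext (Prod.ext (p.2.trans q.2.symm) h))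
  · intro β U W hU hW hch hlt
    have hU' : T.IsBranchPart (Subtype.val '' U) := by
      refine ⟨?_, ?_, ?_⟩
      · rintro _ ⟨p, hp, rfl⟩; exact p.2
      · rintro _ ⟨p, hp, rfl⟩ _ ⟨q, hq, rfl⟩ he
        rcases hch p hp q hq with h | h
        · refine Prod.ext he ?_
          have h' := hle.1 h
          rw [he] at h'
          exact (hT.inv.P_unique q.2 h').symm
        · refine Prod.ext he ?_
          have h' := hle.1 h
          rw [← he] at h'
          exact hT.inv.P_unique p.2 h'
      · rintro _ ⟨p, hp, rfl⟩ _ ⟨q, hq, rfl⟩ hlt'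
        rcases hch p hp q hq with h | h
        · exact absurd hlt' (hT.inv.P_le (hle.1 h)).not_gt
        · exact h
    obtain ⟨u, hu, huN, hP⟩ := hT.node β (Subtype.val '' U) ((fun p : T.Node => p.1.2) '' W)
      (mk_image_le.trans hU) (mk_image_le.trans hW) hU'
      (by rintro _ ⟨p, hp, rfl⟩; exact hlt p hp)
    exact ⟨⟨(β, u), huN⟩, fun hmem => hu ⟨_, hmem, rfl⟩, rfl, fun p hp => hP p.1 ⟨p, hp, rfl⟩⟩
  · intro γ a ha haγ f y hf hγf hy hay
    have hcol : ∀ β, ∃ c, T.F (f β) c γ (fun s => (y β s).1.2) := by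
      intro β
      refine hT.fact γ (f β) _ (fun s => (a s).1.2) (hγf β) ?_ (fun s => ?_)
      · intro s t hst
        exact ha (Subtype.ext (Prod.ext ((haγ s).trans (haγ t).symm) hst))
      · have h1 := hle.1 (hay β s)
        rw [show (y β s).1.1 = f β from hy β s, show (a s).1.1 = γ from haγ s] at h1
        exact h1
    choose c hc using hcol
    by_contra hcon
    push Not at hcon
    -- If `star` fails, all the `β'` whose colour is that of `β` lie below `f β`.
    have hcl : ∀ k : K, ∃ b, ∀ β, c β = k → β < b := by
      intro k
      by_cases hk : ∃ β, c β = k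
      · obtain ⟨β, rfl⟩ := hk
        refine ⟨f β, fun β' hβ' => lt_of_not_ge (fun hle' => ?_)⟩
        have hlt := hle'.trans_lt (hf β')
        have hF := hc β'
        rw [hβ'] at hF
        obtain ⟨w', h1, h2⟩ := hT.inv.F_res hF (χ := f β) hlt (hγf β).le
        obtain ⟨s, hs⟩ := (hT.inv.F_meet (hc β) h1).nonempty hI
        refine hcon β β' s hle' ?_
        rw [hle, show (y β' s).1.1 = f β' from hy β' s, show (y β s).1.1 = f β from hy β s,
          show (y β s).1.2 = w' s from hs]
        exact h2 s
      · exact ⟨Classical.arbitrary V, fun β h => absurd ⟨β, h⟩ hk⟩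
    choose g hg using hcl
    obtain ⟨b, hb⟩ := hV (range g) mk_range_le
    exact absurd ((hg (c b) b rfl).trans (hb _ ⟨_, rfl⟩)) (lt_irrefl _)

end Tree

/-! ### Branches and antichains -/

section Souslin

variable [LinearOrder V] {N : Type u} [PartialOrder N] {lvl : N → V}

theorem IsRichTree.eq_of_le (h : IsRichTree K I lvl) {p p' q : N} (hp : p ≤ q) (hp' : p' ≤ q)
    (he : lvl p = lvl p') : p = p' :=
  le_antisymm (h.comp hp hp' he.le) (h.comp hp' hp he.ge)

/-- A branch through all the levels. -/
def IsBranch (lvl : N → V) (b : V → N) : Prop := (∀ η, lvl (b η) = η) ∧ Monotone b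

/-- Few nodes of a level are on branches through all the levels. -/
theorem IsRichTree.mk_branch_lt (h : IsRichTree K I lvl) (hI : ℵ₀ ≤ #I)
    [NoMaxOrder V] (γ : V) : #{x | lvl x = γ ∧ ∃ b, IsBranch lvl b ∧ b γ = x} < #I := by
  by_contra hcon
  obtain ⟨a⟩ := not_lt.1 hcon
  choose b hb hbγ using fun s => (a s).2.2
  choose f hf using fun β : V => exists_gt (max β γ)
  -- The node `y β s` leaves the branch `b s` between the levels `max β γ` and `f β`. By `star` some
  -- `y β s` lies below a later `y β' s`, which follows the branch beyond level `f β`; hence `y β s`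
  -- is on the branch, a contradiction.
  have h1 : ∀ β s, ∃ u, u ∉ ({b s (f β)} : Set N) ∧ lvl u = f β ∧
      ∀ p ∈ ({b s (max β γ)} : Set N), p ≤ u := by
    intro β s
    refine h.node (f β) _ _ (by simpa using one_le_aleph0.trans hI)
      (by simpa using one_le_aleph0.trans hI) ?_ ?_
    · rintro p rfl q rfl; exact Or.inl le_rfl
    · rintro p rfl; rw [(hb s).1]; exact hf β
  choose y hy1 hy2 hy3 using h1
  obtain ⟨β, β', s, hle, hys⟩ := h.star γ (fun s => (a s).1) (fun s t hst => a.injective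
    (Subtype.ext hst)) (fun s => (a s).2.1) f y (fun β => (le_max_left _ _).trans_lt (hf β))
    (fun β => (le_max_right _ _).trans_lt (hf β)) hy2 (fun β s => by
      rw [← hbγ s]
      exact ((hb s).2 (le_max_right _ _)).trans (hy3 β s _ rfl))
  refine hy1 β s (h.eq_of_le hys (((hb s).2 ?_).trans (hy3 β' s _ rfl)) ?_)
  · exact hle.trans (le_max_left _ _)
  · rw [hy2, (hb s).1]

theorem IsRichTree.exists_root (h : IsRichTree K I lvl) (hI : ℵ₀ ≤ #I) [NoMaxOrder V] (γ : V) :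
    ∃ x, lvl x = γ ∧ ∀ b, IsBranch lvl b → b γ ≠ x := by
  obtain ⟨u, hu, hl, _⟩ := h.node γ ∅ _ (by simp) (h.mk_branch_lt hI γ).le (by simp) (by simp)
  exact ⟨u, hl, fun b hb he => hu ⟨hl, b, hb, he⟩⟩

/-- A linearly ordered family of nodes at unboundedly many levels yields a branch. -/
theorem IsRichTree.exists_branch (h : IsRichTree K I lvl) {C : Set N}
    (hC : ∀ p ∈ C, ∀ q ∈ C, p ≤ q ∨ q ≤ p) (hunb : ∀ η, ∃ p ∈ C, η ≤ lvl p) :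
    ∃ b, IsBranch lvl b ∧ ∀ η, ∀ x, lvl x = η → (∀ p ∈ C, x ≤ p) → b η = x := by
  choose p hpC hp using hunb
  choose b hbp hb using fun η => h.restr (hp η)
  have key : ∀ η η', η ≤ η' → b η ≤ b η' := by
    intro η η' hle
    rcases hC _ (hpC η) _ (hpC η') with h1 | h1
    · exact h.comp ((hbp η).trans h1) (hbp η') (by rw [hb, hb]; exact hle)
    · exact h.comp (hbp η) ((hbp η').trans h1) (by rw [hb, hb]; exact hle)
  refine ⟨b, ⟨hb, fun η η' => key η η'⟩, fun η x hx hxp => ?_⟩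
  exact h.eq_of_le (hbp η) (hxp _ (hpC η)) ((hb η).trans hx.symm)

theorem IsRichTree.mk_lvl_lt (h : IsRichTree K I lvl) (hK : ℵ₀ ≤ #K)
    (hVI : ∀ β : V, #(Iic β) ≤ #K) (β : V) : #{p | lvl p ≤ β} ≤ #K := by
  have : {p | lvl p ≤ β} = ⋃ η : Iic β, {p | lvl p = η.1} := by
    ext p; simp
  rw [this]
  exact mk_iUnion_le_of_le hK (hVI β) (fun η => h.card _)

/-- There are no antichains of the size of the tree above a node which is not on a branch. -/
theorem IsRichTree.mk_antichain_le (h : IsRichTree K I lvl) (hI : ℵ₀ ≤ #I) (hK : #I ≤ #K)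
    [NoMaxOrder V] [Nonempty V] (hVI : ∀ β : V, #(Iic β) ≤ #K)
    (hV : ∀ s : Set V, #s ≤ #K → ∃ b, ∀ η ∈ s, η < b) {x₀ : N}
    (hx₀ : ∀ b, IsBranch lvl b → b (lvl x₀) ≠ x₀) {A : Set N} (hA : IsAntichain (· ≤ ·) A)
    (hAx : ∀ p ∈ A, x₀ ≤ p) : #A ≤ #K := by
  classical
  by_contra hcon
  have hKi : ℵ₀ ≤ #K := hI.trans hK
  -- Big nodes extend to big nodes of every higher level, because levels and initial parts of the
  -- tree have size at most `#K`.
  let big : N → Prop := fun x => x₀ ≤ x ∧ #K < #{p | p ∈ A ∧ x ≤ p}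
  have hun : ∀ {s t : Set N}, #s ≤ #K → #t ≤ #K → #(s ∪ t : Set N) ≤ #K :=
    fun hs ht => (mk_union_le _ _).trans (add_le_of_le hKi hs ht)
  have hbig₀ : big x₀ := by
    refine ⟨le_rfl, lt_of_lt_of_le (not_le.1 hcon) (mk_le_mk_of_subset fun p hp => ?_)⟩
    exact ⟨hp, hAx p hp⟩
  have hhigh : ∀ {x}, big x → ∀ β, ∃ p ∈ A, x ≤ p ∧ β < lvl p := by
    intro x hx β
    by_contra! hno
    refine absurd hx.2 ((mk_le_mk_of_subset ?_).trans (h.mk_lvl_lt hKi hVI β)).not_gt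
    exact fun p hp => hno p hp.1 hp.2
  have hprune : ∀ {x}, big x → ∀ η, lvl x ≤ η → ∃ x', x ≤ x' ∧ lvl x' = η ∧ big x' := by
    intro x hx η hη
    by_contra! hno
    have hsub : {p | p ∈ A ∧ x ≤ p} ⊆ {p | lvl p ≤ η} ∪
        ⋃ q : {q | lvl q = η}, {p | (p ∈ A ∧ x ≤ p) ∧ q.1 ≤ p} := by
      intro p hp
      rcases le_total (lvl p) η with hle | hle
      · exact Or.inl hle
      · obtain ⟨q, hq, hqη⟩ := h.restr hle
        exact Or.inr (mem_iUnion.2 ⟨⟨q, hqη⟩, hp, hq⟩)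
    refine absurd hx.2 ((mk_le_mk_of_subset hsub).trans (hun (h.mk_lvl_lt hKi hVI η)
      (mk_iUnion_le_of_le hKi (h.card η) (fun q => ?_)))).not_gt
    by_contra hq
    have hqne : {p | (p ∈ A ∧ x ≤ p) ∧ q.1 ≤ p}.Nonempty := by
      rw [nonempty_iff_ne_empty]
      intro he
      rw [he] at hq
      simp at hq
    obtain ⟨p, ⟨hpA, hxp⟩, hqp⟩ := hqne
    have hxq : x ≤ q.1 := h.comp hxp hqp (hη.trans q.2.ge)
    refine hno q.1 hxq q.2 ⟨hx.1.trans hxq, lt_of_lt_of_le (not_le.1 hq)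
      (mk_le_mk_of_subset fun p hp => ⟨hp.1.1, hp.2⟩)⟩
  -- Otherwise the big nodes above `x` would be linearly ordered and give a branch through `x₀`.
  have hsplit : ∀ {x}, big x → ∃ y z, big y ∧ big z ∧ x ≤ y ∧ x ≤ z ∧ ¬ y ≤ z ∧ ¬ z ≤ y := by
    intro x hx
    by_contra! hno
    obtain ⟨b, hb, hbx⟩ := h.exists_branch (C := {y | big y ∧ x ≤ y}) (fun y hy z hz => by
      by_cases hyz : y ≤ z
      · exact Or.inl hyz
      · exact Or.inr (hno y z hy.1 hz.1 hy.2 hz.2 hyz))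
      (fun η => by
        obtain ⟨x', h1, h2, h3⟩ := hprune hx (max η (lvl x)) (le_max_right _ _)
        exact ⟨x', ⟨h3, h1⟩, by rw [h2]; exact le_max_left _ _⟩)
    exact hx₀ b hb (hbx _ x₀ rfl (fun p hp => hx.1.trans hp.2))
  -- beyond the level `g γ` all the big nodes of level `γ` have split
  have hg : ∀ γ, ∃ δ, γ < δ ∧ ∀ x, big x → lvl x = γ → ∀ v, x ≤ v → δ ≤ lvl v →
      ∃ y, big y ∧ x ≤ y ∧ lvl y = δ ∧ ¬ y ≤ v := by
    intro γ
    have h1 : ∀ x : {x | lvl x = γ}, ∃ δ, big x.1 → ∃ y z, big y ∧ big z ∧ x.1 ≤ y ∧ x.1 ≤ z ∧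
        ¬ y ≤ z ∧ ¬ z ≤ y ∧ lvl y ≤ δ ∧ lvl z ≤ δ := by
      intro x
      by_cases hx : big x.1
      · obtain ⟨y, z, h2, h3, h4, h5, h6, h7⟩ := hsplit hx
        exact ⟨max (lvl y) (lvl z), fun _ => ⟨y, z, h2, h3, h4, h5, h6, h7, le_max_left _ _,
          le_max_right _ _⟩⟩
      · exact ⟨γ, fun h => absurd h hx⟩
    choose d hd using h1
    obtain ⟨δ, hδ⟩ := hV (range d ∪ {γ}) ((mk_union_le _ _).trans (add_le_of_le hKi
      (mk_range_le.trans (h.card γ)) (by simpa using one_le_aleph0.trans hKi)))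
    refine ⟨δ, hδ γ (Or.inr rfl), fun x hx hxγ v hxv hv => ?_⟩
    obtain ⟨y, z, h2, h3, h4, h5, h6, h7, h8, h9⟩ := hd ⟨x, hxγ⟩ hx
    have hdδ := (hδ _ (Or.inl ⟨⟨x, hxγ⟩, rfl⟩)).le
    obtain ⟨y', hy1, hy2, hy3⟩ := hprune h2 δ (h8.trans hdδ)
    obtain ⟨z', hz1, hz2, hz3⟩ := hprune h3 δ (h9.trans hdδ)
    by_cases hyv : y' ≤ v
    · refine ⟨z', hz3, h5.trans hz1, hz2, fun hzv => ?_⟩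
      have hyz : y' = z' := h.eq_of_le hyv hzv (hy2.trans hz2.symm)
      rw [← hyz] at hz1
      rcases le_total (lvl y) (lvl z) with hl | hl
      · exact h6 (h.comp hy1 hz1 hl)
      · exact h7 (h.comp hz1 hy1 hl)
    · exact ⟨y', hy3, h4.trans hy1, hy2, hyv⟩
  choose g hgγ hg using hg
  obtain ⟨r, wo⟩ := exists_wellFoundedLT I
  -- Levels `γ s`, indexed by a well-order of `I`, so far apart that the splitting over one is
  -- finished by the next.
  obtain ⟨γ, hγ⟩ := exists_wf_rec (V := I) (A := V)
    (fun s γ => lvl x₀ ≤ γ s ∧ ∀ t < s, g (γ t) ≤ γ s)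
    (fun s f f' he hf => by
      rw [← he s le_rfl]
      exact ⟨hf.1, fun t ht => by rw [← he t ht.le]; exact hf.2 t ht⟩)
    (fun s f _ => by
      obtain ⟨b, hb⟩ := hV (range (g ∘ f) ∪ {lvl x₀}) ((mk_union_le _ _).trans (add_le_of_le hKi
        (mk_range_le.trans hK) (by simpa using one_le_aleph0.trans hKi)))
      refine ⟨Function.update f s b, fun t ht => Function.update_of_ne ht.ne _ _, ?_, ?_⟩
      · rw [Function.update_self]; exact (hb _ (Or.inr rfl)).le
      · intro t ht
        rw [Function.update_self, Function.update_of_ne ht.ne]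
        exact (hb _ (Or.inl ⟨t, rfl⟩)).le)
  obtain ⟨top, htop⟩ := hV (range (g ∘ γ) ∪ {lvl x₀}) ((mk_union_le _ _).trans (add_le_of_le hKi
        (mk_range_le.trans hK) (by simpa using one_le_aleph0.trans hKi)))
  have hgtop : ∀ s, g (γ s) ≤ top := fun s => (htop _ (Or.inl ⟨s, rfl⟩)).le
  obtain ⟨v, hxv, hvl, hv⟩ := hprune hbig₀ top (htop _ (Or.inr rfl)).le
  -- many big nodes of level `top`, branching off from `v`
  have ha : ∀ s, ∃ a y, big a ∧ lvl a = top ∧ y ≤ a ∧ lvl y = g (γ s) ∧ ¬ y ≤ v ∧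
      ∃ x, x ≤ v ∧ x ≤ a ∧ lvl x = γ s := by
    intro s
    obtain ⟨x, hxv', hx⟩ := h.restr (q := v) (χ := γ s)
      (by rw [hvl]; exact (hgγ _).le.trans (hgtop s))
    have hbx : big x := ⟨h.comp hxv hxv' (by rw [hx]; exact (hγ s).1),
      lt_of_lt_of_le hv.2 (mk_le_mk_of_subset fun p hp => ⟨hp.1, hxv'.trans hp.2⟩)⟩
    obtain ⟨y, h1, h2, h3, h4⟩ := hg (γ s) x hbx hx v hxv' (by rw [hvl]; exact hgtop s)
    obtain ⟨a, h5, h6, h7⟩ := hprune h1 top (by rw [h3]; exact hgtop s)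
    exact ⟨a, y, h7, h6, h5, h3, h4, x, hxv', h2.trans h5, hx⟩
  choose a y ha1 ha2 ha3 ha4 ha5 x ha6 ha7 ha8 using ha
  have hainj : Function.Injective a := by
    -- By level `g (γ s) ≤ γ t` the node `a s` has left `v`, which `a t` follows up to level `γ t`.
    have key : ∀ s t, s < t → a s ≠ a t := by
      intro s t hst he
      refine ha5 s (le_trans (h.comp (ha3 s) (he ▸ ha7 t) ?_) (ha6 t))
      rw [ha4, ha8]
      exact (hγ t).2 s hst
    intro s t he
    rcases lt_trichotomy s t with h1 | h1 | h1
    · exact absurd he (key s t h1)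
    · exact h1
    · exact absurd he.symm (key t s h1)
  -- Elements of the antichain above every `a s` and beyond any given level; they are then raised to
  -- a common level `f β` to fit `star`.
  choose u huA hau hul using fun β s => hhigh (ha1 s) (max β top)
  have hf : ∀ β, ∃ δ, max β top < δ ∧ ∀ s, lvl (u β s) < δ := by
    intro β
    obtain ⟨δ, hδ⟩ := hV (range (fun s => lvl (u β s)) ∪ {max β top}) ((mk_union_le _ _).trans
      (add_le_of_le hKi (mk_range_le.trans hK) (by simpa using one_le_aleph0.trans hKi)))
    exact ⟨δ, hδ _ (Or.inr rfl), fun s => hδ _ (Or.inl ⟨s, rfl⟩)⟩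
  choose f hf1 hf2 using hf
  have hw : ∀ β s, ∃ w, u β s ≤ w ∧ lvl w = f β := by
    intro β s
    obtain ⟨w, _, hw1, hw2⟩ := h.node (f β) {u β s} ∅ (by simpa using one_le_aleph0.trans hI)
      (by simp) (by rintro p rfl q rfl; exact Or.inl le_rfl) (by rintro p rfl; exact hf2 β s)
    exact ⟨w, hw2 _ rfl, hw1⟩
  choose w hw1 hw2 using hw
  obtain ⟨β, β', s, hle, hws⟩ := h.star top a hainj ha2 f w
    (fun β => (le_max_left _ _).trans_lt (hf1 β)) (fun β => (le_max_right _ _).trans_lt (hf1 β))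
    hw2 (fun β s => (hau β s).trans (hw1 β s))
  -- Both elements of the antichain lie below `w β' s`, hence are comparable, but their levels
  -- differ.
  have hlt : lvl (u β s) < lvl (u β' s) :=
    (hf2 β s).trans_le (hle.trans ((le_max_left _ _).trans (hul β' s).le))
  have hcomp := h.comp ((hw1 β s).trans hws) (hw1 β' s) hlt.le
  exact hlt.ne (congrArg lvl (hA.eq (huA β s) (huA β' s) hcomp))

end Souslin

/-! ### The cone above a node off all branches -/

section SouslinTree

variable [LinearOrder V] {N : Type u} [PartialOrder N] {lvl : N → V}

/-- The nodes above a node that is not on a branch form a Souslin tree. -/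
theorem IsRichTree.exists_isSouslinTree [WellFoundedLT V] [NoMaxOrder V] [Nonempty V]
    (h : IsRichTree K I lvl) (hI : ℵ₀ ≤ #I) (hK : #I ≤ #K) (hVI : ∀ β : V, #(Iic β) ≤ #K)
    (hV : ∀ s : Set V, #s ≤ #K → ∃ b, ∀ η ∈ s, η < b) (hVK : #V = succ #K) :
    ∃ (T : Type u) (_ : PartialOrder T),
      IsSouslinTree T (succ #K) ∧ IsCompleteTree T (succ #I) := by
  have hKi : ℵ₀ ≤ #K := hI.trans hK
  obtain ⟨x₀, hx₀, hb₀⟩ := h.exists_root hI (Classical.arbitrary V)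
  rw [← hx₀] at hb₀
  have hup : ∀ p : N, ∀ β, lvl p < β → ∃ u, lvl u = β ∧ p ≤ u := by
    intro p β hp
    obtain ⟨u, -, hu1, hu2⟩ := h.node β {p} ∅ (by simpa using one_le_aleph0.trans hI)
      (by simp) (by rintro p rfl q rfl; exact Or.inl le_rfl) (by rintro _ rfl; exact hp)
    exact ⟨u, hu1, hu2 p rfl⟩
  have hchain : ∀ C : Set N, (∀ p ∈ C, x₀ ≤ p) → (∀ p ∈ C, ∀ q ∈ C, p ≤ q ∨ q ≤ p) →
      #C ≤ #K := by
    intro C hC hcmp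
    by_contra hlt
    obtain ⟨b, hb, hbC⟩ := h.exists_branch hcmp (fun η => by
      by_contra! hno
      exact hlt ((mk_le_mk_of_subset fun p hp => (hno p hp).le).trans (h.mk_lvl_lt hKi hVI η)))
    exact hb₀ b hb (hbC _ x₀ rfl hC)
  refine ⟨{p : N // x₀ ≤ p}, inferInstance, ⟨?_, ?_, ?_, ?_⟩, ?_⟩
  · intro x
    have hwf : WellFounded (fun a b : Iio x => a < b) :=
      Subrelation.wf (fun {a b} hab => h.lt (show a.1.1 < b.1.1 from hab))
        (InvImage.wf (fun a : Iio x => lvl a.1.1) wellFounded_lt)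
    refine { wf := hwf, trichotomous := fun a b hab hba => ?_ }
    have ha : a.1.1 ≤ x.1 := a.2.le
    have hb : b.1.1 ≤ x.1 := b.2.le
    rcases le_total (lvl a.1.1) (lvl b.1.1) with hl | hl
    · exact (show a ≤ b from h.comp ha hb hl).eq_of_not_lt hab
    · exact ((show b ≤ a from h.comp hb ha hl).eq_of_not_lt hba).symm
  · refine le_antisymm ?_ (succ_le_of_lt (lt_of_not_ge fun hle => ?_))
    · have hun : (univ : Set N) = ⋃ η : V, {p | lvl p = η} := by ext; simp
      refine (mk_subtype_le _).trans ?_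
      rw [← mk_univ, hun]
      exact mk_iUnion_le_of_le (hKi.trans (le_succ _)) hVK.le
        (fun η => (h.card η).trans (le_succ _))
    · obtain ⟨b, hb⟩ := hV (range fun p : {p : N // x₀ ≤ p} => lvl p.1) (mk_range_le.trans hle)
      obtain ⟨u, hu1, hu2⟩ := hup x₀ b (hb _ ⟨⟨x₀, le_rfl⟩, rfl⟩)
      exact (hb _ ⟨⟨u, hu2⟩, rfl⟩).ne hu1
  · intro C hC
    refine (lt_succ_of_le ?_).ne
    rw [← mk_image_eq (f := Subtype.val) Subtype.val_injective]
    refine hchain _ ?_ ?_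
    · rintro _ ⟨p, -, rfl⟩; exact p.2
    · rintro _ ⟨p, hp, rfl⟩ _ ⟨q, hq, rfl⟩
      exact hC.total hp hq
  · intro A hA
    refine (lt_succ_of_le ?_).ne
    rw [← mk_image_eq (f := Subtype.val) Subtype.val_injective]
    refine h.mk_antichain_le hI hK hVI hV hb₀ ?_ ?_
    · rintro _ ⟨p, hp, rfl⟩ _ ⟨q, hq, rfl⟩ hne hle
      exact hA hp hq (fun he => hne (congrArg _ he)) hle
    · rintro _ ⟨p, -, rfl⟩; exact p.2
  · intro C hC hcard
    -- The node `x₀` joins the chain so that the upper bound stays in the cone, also for the empty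
    -- chain.
    have hcard' : #(insert x₀ (Subtype.val '' C) : Set N) ≤ #I :=
      mk_insert_le.trans (add_le_of_le hI (mk_image_le.trans (lt_succ_iff.1 hcard))
        (one_le_aleph0.trans hI))
    obtain ⟨b, hb⟩ := hV (lvl '' insert x₀ (Subtype.val '' C))
      (mk_image_le.trans (hcard'.trans hK))
    obtain ⟨u, -, hu1, hu2⟩ := h.node b (insert x₀ (Subtype.val '' C)) ∅ hcard' (by simp)
      (by
        rintro _ (rfl | ⟨p, hp, rfl⟩) _ (rfl | ⟨q, hq, rfl⟩)
        · exact Or.inl le_rfl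
        · exact Or.inl q.2
        · exact Or.inr p.2
        · exact hC.total hp hq)
      (fun p hp => hb _ ⟨p, hp, rfl⟩)
    refine ⟨⟨u, hu2 _ (mem_insert _ _)⟩, fun p hp => Or.inl ?_⟩
    have hpu : p.1 ≤ u := hu2 _ (mem_insert_of_mem _ ⟨p, hp, rfl⟩)
    refine lt_of_le_of_ne hpu fun he => ?_
    refine (hb (lvl p.1) ⟨p.1, mem_insert_of_mem _ ⟨p, hp, rfl⟩, rfl⟩).ne ?_
    rw [he]; exact hu1

end SouslinTree

/-! ### Consequences of the diamond -/

section Diamond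

variable [LinearOrder K]

/-- The closure points of a function form a club. -/
theorem isClub_closurePoints [WellFoundedLT K] (hI : ℵ₀ ≤ #I) (hKI : ∀ j : K, #(Iio j) ≤ #I)
    (hreg : ∀ s : Set K, #s ≤ #I → ∃ j, ∀ i ∈ s, i < j) (h : K → K) (j₀ : K) :
    IsClub {j | j₀ < j ∧ ∀ i < j, h i < j} := by
  refine ⟨fun d hd hne _ a ha => ⟨?_, fun i hi => ?_⟩, fun a => ?_⟩
  · obtain ⟨j, hj⟩ := hne
    exact (hd hj).1.trans_le (ha.1 hj)
  · obtain ⟨j, hj, hij⟩ := (lt_isLUB_iff ha).1 hi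
    exact ((hd hj).2 i hij).trans_le (ha.1 hj)
  · have hg : ∀ x, ∃ y, x < y ∧ j₀ < y ∧ ∀ i ≤ x, h i < y := by
      intro x
      have h1 : #(Iio x ∪ {x} : Set K) ≤ #I := (mk_union_le _ _).trans
        (add_le_of_le hI (hKI x) (by simpa using one_le_aleph0.trans hI))
      have h2 : #(h '' (Iio x ∪ {x}) ∪ {x, j₀} : Set K) ≤ #I :=
        (mk_union_le _ _).trans (add_le_of_le hI (mk_image_le.trans h1)
          ((toFinite ({x, j₀} : Set K)).lt_aleph0.le.trans hI))
      obtain ⟨y, hy⟩ := hreg _ h2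
      refine ⟨y, hy _ (Or.inr (Or.inl rfl)), hy _ (Or.inr (Or.inr rfl)), fun i hi => ?_⟩
      exact hy _ (Or.inl ⟨i, hi.lt_or_eq, rfl⟩)
    choose g hg1 hg2 hg3 using hg
    -- The least bound of the iterates of `g` is a closure point: anything below it is at most some
    -- iterate, and `g` dominates `h` there.
    have hbd : {y | ∀ n : ℕ, g^[n] a < y}.Nonempty := by
      obtain ⟨y, hy⟩ := hreg (range fun n : ULift.{u} ℕ => g^[n.down] a)
        (mk_range_le.trans (by simpa using hI))
      exact ⟨y, fun n => hy _ ⟨⟨n⟩, rfl⟩⟩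
    have hmem := wellFounded_lt.min_mem _ hbd
    refine ⟨wellFounded_lt.min _ hbd, ⟨?_, fun i hi => ?_⟩, (hmem 0).le⟩
    · exact (hg2 a).trans (hmem 1)
    · have hn : ¬ ∀ n : ℕ, g^[n] a < i := fun hi' => wellFounded_lt.not_lt_min _ (show i ∈ {y | ∀ n : ℕ, g^[n] a < y} from hi') hi
      push Not at hn
      obtain ⟨n, hn⟩ := hn
      refine (hg3 _ i hn).trans ?_
      rw [← Function.iterate_succ_apply' g n a]
      exact hmem (n + 1)

theorem IsClub.preimage_orderIso {α : Type*} {β : Type*} [LinearOrder α] [LinearOrder β]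
    {t : Set β} (ht : IsClub t) (e : α ≃o β) : IsClub (e ⁻¹' t) := by
  refine ⟨fun d hd hne _ a ha => ?_, fun a => ?_⟩
  · exact ht.isLUB_mem (image_subset_iff.2 hd) (hne.image e) (e.isLUB_image'.2 ha)
  · obtain ⟨b, hb, hab⟩ := ht.isCofinal (e a)
    exact ⟨e.symm b, by simpa using hb, by simpa [e.le_symm_apply] using hab⟩

/-- A diamond sequence on a well-order guesses at closure points of any function. -/
def IsDiamondSeq (A : K → Set K) : Prop :=
  ∀ (B : Set K) (h : K → K) (j₀ : K), ∃ j, j₀ < j ∧ (∀ i < j, h i < j) ∧ B ∩ Iio j = A j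

theorem DiamondPrinciple.exists_isDiamondSeq [WellFoundedLT K] {κ : Cardinal.{u}} (hd : DiamondPrinciple κ)
    (e : K ≃o Iio κ.ord) (hI : ℵ₀ ≤ #I) (hKI : ∀ j : K, #(Iio j) ≤ #I)
    (hreg : ∀ s : Set K, #s ≤ #I → ∃ j, ∀ i ∈ s, i < j) : ∃ A : K → Set K, IsDiamondSeq A := by
  obtain ⟨A, -, hA⟩ := hd
  refine ⟨fun j => {x | (e x).1 ∈ A (e j).1}, fun B h j₀ => ?_⟩
  obtain ⟨ξ, hξ1, hξ2⟩ := hA ((fun x => (e x).1) '' B) (by rintro _ ⟨x, -, rfl⟩; exact (e x).2)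
    ((isClub_closurePoints hI hKI hreg h j₀).preimage_orderIso e.symm)
  refine ⟨e.symm ξ, hξ2.1, hξ2.2, ?_⟩
  ext x
  rw [mem_ofPred_eq, e.apply_symm_apply]
  rw [mem_ofPred_eq] at hξ1
  rw [← hξ1]
  constructor
  · rintro ⟨hx, hlt⟩
    exact ⟨⟨x, hx, rfl⟩, show (e x).1 < ξ.1 from e.lt_symm_apply.1 hlt⟩
  · rintro ⟨⟨y, hy, hyx⟩, hlt⟩
    obtain rfl : y = x := e.injective (Subtype.ext hyx)
    exact ⟨hy, e.lt_symm_apply.2 hlt⟩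

/-- The diamond is applied to the code of the union of the chain, at points closed under the stages
at which elements enter and under bounds for the codes of each `D i`. At such a point the union cut
off at `j` is `D j`, by monotonicity in one direction and continuity in the other. -/
theorem IsDiamondSeq.guesses {A : K → Set K} (hA : IsDiamondSeq A) {c : Cardinal.{u}}
    (hc : ℵ₀ ≤ c) (hreg : ∀ s : Set K, #s ≤ c → ∃ j, ∀ i ∈ s, i < j) {H : Type u} (e : H ↪ K) :
    Guesses (fun j => e ⁻¹' A j) c := by
  intro D hmono hD hcont j₀
  have hst : ∀ i, ∃ st, ∀ x, e x = i → (∃ j, x ∈ D j) → x ∈ D st := by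
    intro i
    by_cases hi : ∃ x, e x = i ∧ ∃ j, x ∈ D j
    · obtain ⟨x, rfl, j, hj⟩ := hi
      exact ⟨j, fun y hy _ => e.injective hy ▸ hj⟩
    · exact ⟨i, fun x hx hxj => absurd ⟨x, hx, hxj⟩ hi⟩
  choose st hst using hst
  choose bd hbd using fun i => hreg (e '' D i) (mk_image_le.trans (hD i))
  choose g hg using fun i => hreg {i, st i, bd i}
    ((toFinite ({i, st i, bd i} : Set K)).lt_aleph0.le.trans hc)
  obtain ⟨j, hj, hcl, hBA⟩ := hA (e '' ⋃ i, D i) g j₀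
  refine ⟨j, hj, ?_⟩
  ext x
  rw [mem_preimage, ← hBA]
  constructor
  · rintro ⟨⟨y, hy, hyx⟩, hlt⟩
    obtain rfl : y = x := e.injective hyx
    refine hmono ?_ (hst (e y) y rfl (mem_iUnion.1 hy))
    exact ((hg _ _ (by simp)).trans (hcl _ hlt)).le
  · intro hx
    refine ⟨⟨x, mem_iUnion.2 ⟨j, hx⟩, rfl⟩, ?_⟩
    obtain ⟨i, hi, hxi⟩ := hcont j ⟨j₀, hj⟩
      (fun i hi => ⟨g i, hg i i (by simp), hcl i hi⟩) x hx
    exact (hbd i _ ⟨x, hxi, rfl⟩).trans ((hg i _ (by simp)).trans (hcl i hi))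

/-- The graph of a function codes to a set of at most `#I` elements of `K`, which is bounded. A
guess beyond the bound captures it entirely, so the place of the guess determines the function. -/
theorem IsDiamondSeq.mk_fun_le {A : K → Set K} (hA : IsDiamondSeq A) (hI : ℵ₀ ≤ #I)
    (hK : #I ≤ #K) (hreg : ∀ s : Set K, #s ≤ #I → ∃ j, ∀ i ∈ s, i < j) : #(I → K) ≤ #K := by
  obtain ⟨p⟩ : #(K × K) ≤ #K := by
    rw [← mul_def, mul_eq_self (hI.trans hK)]
  obtain ⟨ι⟩ := hK
  have : ∀ f : I → K, ∃ j, range (fun s => p (ι s, f s)) = A j := by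
    intro f
    obtain ⟨j₀, hj₀⟩ := hreg (range fun s => p (ι s, f s)) mk_range_le
    obtain ⟨j, hj, -, hB⟩ := hA (range fun s => p (ι s, f s)) id j₀
    refine ⟨j, hB ▸ (inter_eq_left.2 fun x hx => (hj₀ x hx).trans hj).symm⟩
  choose j hj using this
  refine mk_le_of_injective (f := j) fun f f' he => funext fun s => ?_
  have h1 : p (ι s, f s) ∈ range (fun s => p (ι s, f' s)) := by
    rw [hj, ← he, ← hj]; exact ⟨s, rfl⟩
  obtain ⟨t, ht⟩ := h1
  have h2 := Prod.ext_iff.1 (p.injective ht)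
  obtain rfl := ι.injective h2.1
  exact h2.2.symm

end Diamond

/-! ### Cardinal arithmetic and passage to the index types -/

theorem Code.mk_le (hK : ℵ₀ ≤ #K) (hIK : #(I → K) ≤ #K) : #(Code K I) ≤ #K := by
  let f : Code K I → ULift.{u} ℕ × List K × (I → K)
    | .lev a => (⟨0⟩, [a], fun _ => a)
    | .ord a b => (⟨1⟩, [a, b], fun _ => a)
    | .pred a n b m => (⟨2⟩, [a, n, b, m], fun _ => a)
    | .fact a c b w => (⟨3⟩, [a, c, b], w)
    | .chain a n => (⟨4⟩, [a, n], fun _ => a)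
    | .goal a y => (⟨5⟩, [a], y)
  have hf : Function.Injective f := by
    intro x y h
    cases x <;> cases y <;> simp only [f, Prod.mk.injEq, ULift.up.injEq, List.cons.injEq] at h <;>
      grind
  have : Infinite K := infinite_iff.2 hK
  refine (mk_le_of_injective hf).trans ?_
  rw [← mul_def, ← mul_def, mk_list_eq_mk]
  exact mul_le_of_le hK (by simp [hK]) (mul_le_of_le hK le_rfl hIK)

/-- Elements of `V` are identified with ordinals by `typein`. At ordinals outside `Γ` the cofinality
is not `succ c`, hence at most `c`, and any cofinal set of that size will do. -/
theorem BaumgartnerSquare.exists_isShortSquare {c : Cardinal.{u}}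
    (hs : BaumgartnerSquare (succ c)) [LinearOrder V] [WellFoundedLT V]
    (hV : Ordinal.type (fun a b : V => a < b) = (succ (succ c)).ord) :
    ∃ Γ C, IsShortSquare (V := V) Γ C c := by
  classical
  obtain ⟨Γ, C, h⟩ := hs
  let v : V → Ordinal.{u} := fun β => Ordinal.typein (fun a b : V => a < b) β
  have hv : ∀ {a b}, v a < v b ↔ a < b := fun {a b} => Ordinal.typein_lt_typein _
  have hvle : ∀ {a b}, v a ≤ v b ↔ a ≤ b := fun {a b} => by
    rw [← not_lt, hv, not_lt]
  have hvinj : Function.Injective v := Ordinal.typein_injective _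
  have hvtop : ∀ β, v β < (succ (succ c)).ord := fun β => by
    rw [← hV]; exact Ordinal.typein_lt_type _ β
  have hvsurj : ∀ {o β}, o < v β → ∃ ζ < β, v ζ = o := by
    intro o β ho
    obtain ⟨ζ, rfl⟩ := Ordinal.mem_range_typein_iff (fun a b : V => a < b) |>.2
      (ho.trans (Ordinal.typein_lt_type _ β))
    exact ⟨ζ, hv.1 ho, rfl⟩
  have hcof : ∀ β, v β ∉ Γ → ∃ S : Set V, (∀ ζ ∈ S, ζ < β) ∧ (∀ ζ < β, ∃ ζ' ∈ S, ζ ≤ ζ') ∧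
      #S ≤ c := by
    intro β hβ
    obtain ⟨S, hS, hcard⟩ := Order.exists_cof_eq (α := Iio β)
    refine ⟨Subtype.val '' S, ?_, fun ζ hζ => ?_, mk_image_le.trans ?_⟩
    · rintro _ ⟨ζ, -, rfl⟩; exact ζ.2
    · obtain ⟨ζ', h1, h2⟩ := hS ⟨ζ, hζ⟩
      exact ⟨ζ', ⟨ζ', h1, rfl⟩, h2⟩
    · rw [hcard, Order.cof_Iio, ← lt_succ_iff]
      refine lt_of_le_of_ne ?_ fun he => hβ (h.cof_subset ⟨hvtop β, he⟩)
      exact (Ordinal.cof_le_card _).trans (card_le_iff.2 (hvtop β))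
  choose! S hS1 hS2 hS3 using hcof
  have hΓ : ∀ {β}, β ∈ v ⁻¹' Γ → (if v β ∈ Γ then v ⁻¹' C (v β) else S β) = v ⁻¹' C (v β) :=
    fun hβ => if_pos hβ
  have hΓ' : ∀ {β}, v β ∉ Γ → (if v β ∈ Γ then v ⁻¹' C (v β) else S β) = S β :=
    fun hβ => if_neg hβ
  refine ⟨v ⁻¹' Γ, fun β => if v β ∈ Γ then v ⁻¹' C (v β) else S β, ?_, ?_, ?_, ?_, ?_⟩
  · intro β ζ hζ
    by_cases hβ : v β ∈ Γ
    · rw [hΓ hβ] at hζ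
      exact hv.1 ((h.club _ hβ).1 hζ)
    · rw [hΓ' hβ] at hζ
      exact hS1 β hβ ζ hζ
  · intro β ζ hζ
    by_cases hβ : v β ∈ Γ
    · rw [hΓ hβ]
      obtain ⟨α, hα1, hα2⟩ := (h.club _ hβ).2.isCofinal ⟨v ζ, hv.2 hζ⟩
      obtain ⟨ζ', -, hζ'⟩ := hvsurj α.2
      refine ⟨ζ', ?_, hvle.1 (hζ' ▸ hα2)⟩
      rw [mem_preimage, hζ']
      exact hα1
    · rw [hΓ' hβ]
      exact hS2 β hβ ζ hζ
  · intro β ζ hβ hζ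
    rw [hΓ hβ] at hζ ⊢
    -- A proper initial segment of a set of order type at most `(succ c).ord` has size at most `c`.
    have h1 := (Ordinal.typein_lt_type (fun a b : C (v β) => a < b) ⟨v ζ, hζ⟩).trans_le
      (h.otp_le _ hβ)
    rw [Cardinal.lift_ord, lt_ord, Ordinal.card_typein, lift_succ, lt_succ_iff] at h1
    have h2 := lift_mk_le_lift_mk_of_injective
      (f := fun p : (v ⁻¹' C (v β) ∩ Iio ζ : Set V) =>
        (⟨⟨v p.1, p.2.1⟩, hv.2 p.2.2⟩ : {y : C (v β) // y < ⟨v ζ, hζ⟩}))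
      (fun p q hpq => Subtype.ext (hvinj (congrArg (fun z => z.1.1) hpq)))
    rw [lift_id'.{u, u + 1}] at h2
    exact lift_le.1 (h2.trans h1)
  · intro β hβ
    rw [hΓ' hβ]
    exact hS3 β hβ
  · intro β α hβ hαβ hne hlim
    obtain ⟨ζ₀, hζ₀, hζ₀α⟩ := hne
    rw [hΓ hβ] at hζ₀
    have hlim' : ∀ o < v α, ∃ o' ∈ C (v β), o < o' ∧ o' < v α := by
      intro o ho
      obtain ⟨ζ, hζ, rfl⟩ := hvsurj ho
      obtain ⟨ζ', h1, h2, h3⟩ := hlim ζ hζ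
      rw [hΓ hβ] at h1
      exact ⟨v ζ', h1, hv.2 h2, hv.2 h3⟩
    have hα : v α ∈ C (v β) := by
      refine (h.club _ hβ).2.isLUB_mem (x := ⟨v α, hv.2 hαβ⟩)
        (t := {x : Iio (v β) | x.1 ∈ C (v β) ∧ x.1 < v α}) (fun x hx => hx.1)
        ⟨⟨v ζ₀, hv.2 (hζ₀α.trans hαβ)⟩, hζ₀, hv.2 hζ₀α⟩ ⟨fun x hx => hx.2.le, fun b hb => ?_⟩
      by_contra hlt
      obtain ⟨o', h1, h2, h3⟩ := hlim' b.1 (not_le.1 hlt)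
      exact absurd h2 (not_lt.2 (hb (a := ⟨o', h3.trans (hv.2 hαβ)⟩) ⟨h1, h3⟩))
    have hacc : v α ∈ ordAcc (C (v β)) := by
      refine ⟨hα, ⟨fun x hx => le_of_lt hx.2, fun b hb => ?_⟩,
        pos_of_gt (hv.2 hζ₀α)⟩
      by_contra hlt
      obtain ⟨o', h1, h2, h3⟩ := hlim' b (not_le.1 hlt)
      exact absurd h2 (not_lt.2 (hb ⟨h1, h3⟩))
    obtain ⟨h1, h2⟩ := h.coherent _ hβ _ hacc
    rw [hΓ hβ, hΓ h1, h2]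
    refine ⟨hα, h1, ?_⟩
    ext ζ
    simp [hv]

theorem exists_gt_of_mk_le {c : Cardinal.{u}} (hc : ℵ₀ ≤ c) (s : Set (succ c).ord.ToType)
    (hs : #s ≤ c) : ∃ b, ∀ η ∈ s, η < b := by
  by_contra! hno
  have h1 : IsCofinal s := fun b => hno b
  have h2 := Order.cof_le h1
  rw [Ordinal.cof_toType, (isRegular_succ hc).cof_ord] at h2
  exact (lt_succ c).not_ge (h2.trans hs)

theorem mk_Iio_toType_le {c : Cardinal.{u}} (β : (succ c).ord.ToType) : #(Iio β) ≤ c := by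
  simpa using! mk_Iio_lt β (by simp)

theorem mk_Iic_toType_le {c : Cardinal.{u}} (hc : ℵ₀ ≤ c) (β : (succ c).ord.ToType) :
    #(Iic β) ≤ c := by
  rw [← Iio_union_right]
  exact (mk_union_le _ _).trans (add_le_of_le hc (mk_Iio_toType_le β)
    (by simpa using one_le_aleph0.trans hc))

theorem corollary1 (lam : Cardinal.{u}) (hlam : ℵ₀ ≤ lam)
    (hdiamond : DiamondPrinciple (succ lam)) (hsquare : BaumgartnerSquare (succ lam)) :
    ∃ (T : Type u) (_ : PartialOrder T),
      IsSouslinTree T (succ (succ lam)) ∧ IsCompleteTree T (succ lam) := by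
  have hsucc : ℵ₀ ≤ succ lam := hlam.trans (le_succ _)
  have hI : ℵ₀ ≤ #lam.out := by rwa [mk_out]
  have hKeq : #(succ lam).ord.ToType = succ lam := mk_ord_toType _
  have hVeq : #(succ (succ lam)).ord.ToType = succ (succ lam) := mk_ord_toType _
  have hK : #lam.out < #(succ lam).ord.ToType := by
    rw [hKeq, mk_out]; exact lt_succ _
  have hKI : ∀ j : (succ lam).ord.ToType, #(Iio j) ≤ #lam.out := fun j => by
    rw [mk_out]; exact mk_Iio_toType_le j
  have hreg : ∀ s : Set (succ lam).ord.ToType, #s ≤ #lam.out → ∃ j, ∀ i ∈ s, i < j := fun s hs =>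
    exists_gt_of_mk_le hlam s (by rwa [mk_out] at hs)
  have hV : ∀ s : Set (succ (succ lam)).ord.ToType, #s ≤ #(succ lam).ord.ToType →
      ∃ b, ∀ η ∈ s, η < b := fun s hs => exists_gt_of_mk_le hsucc s (by rwa [hKeq] at hs)
  have hVI : ∀ β : (succ (succ lam)).ord.ToType, #(Iic β) ≤ #(succ lam).ord.ToType := fun β => by
    rw [hKeq]; exact mk_Iic_toType_le hsucc β
  have : NoMaxOrder (succ (succ lam)).ord.ToType :=
    ⟨fun a => (hV {a} (by simpa using one_le_aleph0.trans (hI.trans hK.le))).imp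
      fun b hb => hb a rfl⟩
  have : Nonempty (succ (succ lam)).ord.ToType := by
    rw [← mk_ne_zero_iff, hVeq]
    exact (aleph0_pos.trans_le (hsucc.trans (le_succ _))).ne'
  have : Nonempty (succ lam).ord.ToType :=
    mk_ne_zero_iff.1 (aleph0_pos.trans_le (hI.trans hK.le)).ne'
  obtain ⟨A, hA⟩ := hdiamond.exists_isDiamondSeq Ordinal.ToType.mk.symm hI hKI hreg
  -- This embeds the codes into `K`, where the diamond sequence lives.
  obtain ⟨e⟩ := Code.mk_le (hI.trans hK.le) (hA.mk_fun_le hI hK.le hreg)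
  obtain ⟨Γ, C, hC⟩ := hsquare.exists_isShortSquare (V := (succ (succ lam)).ord.ToType)
    (Ordinal.type_toType _)
  replace hC : IsShortSquare Γ C #lam.out := by rwa [mk_out]
  obtain ⟨B, hB⟩ := exists_isMatrix hI hK hKI hreg hC
  choose ψ hψ using fun t : (succ (succ lam)).ord.ToType =>
    exists_injOn_iff_injective.2 ⟨_, (hVI t).some.injective⟩
  obtain ⟨T, hT⟩ := exists_isRich hI hK hKI hreg hB (hA.guesses hI hreg e) hψ
  let := hT.inv.partialOrder
  have := (hT.isRichTree hI hV).exists_isSouslinTree hI hK.le hVI hV (by rw [hVeq, hKeq])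
  rwa [hKeq, mk_out] at this
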